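/- For $s\in\mathbb R$ and $t>0$ let $f_s(t)=\frac{t^s-st+s-1}{s(s-1)}$ if $s\notin\{0,1\}$, $f_0(t)=t-\log t-1$ and $f_1(t)=t\log t-t+1$, so that $f_s''(t)=t^{s-2}$. For a function $f$ on $(0,\infty)$ put $\bar f(a,b)=f(a)+f(b)-2f\!\left(\frac{a+b}2\right)$, and for $a,b>0$ let $$\lambda_s(a,b)=\frac{\bar f_{s+1}(a,b)}{\bar f_s(a,b)}\quad(a\ne b),\qquad \lambda_s(a,a)=a.$$ Let $$H=\frac{2}{1/a+1/b},\quad G=\sqrt{ab},\quad L=\frac{b-a}{\log b-\log a},\quad I=\frac1e\left(\frac{b^b}{a^a}\right)^{1/(b-a)},\quad A=\frac{a+b}2,\quad S=a^{\frac a{a+b}}b^{\frac b{a+b}}$$ be the harmonic, geometric, logarithmic, identric, arithmetic and Gini means of $a,b>0$, with $L(a,a)=I(a,a)=a$. **Theorem 3.** 1. For all $a,b>0$, $\lambda_s(a,b)$ is monotone increasing in $s\in\mathbb R$. 2. $\lambda_s(a,b)\le H(a,b)$ for all $a,b>0$ and each $s\le-4$. 3. $H(a,b)\le\lambda_s(a,b)\le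 G(a,b)$ for all $a,b>0$ and $-3\le s\le-1$. 4. $G(a,b)\le\lambda_s(a,b)\le L(a,b)$ for all $a,b>0$ and $-\frac12\le s\le0$. 5. There is a number $s_0\in(\frac1{12},\frac1{11})$ such that $L(a,b)\le\lambda_s(a,b)\le I(a,b)$ for all $a,b>0$ and $s_0\le s\le1$. 6. There is a number $s_1\in(1.03,1.04)$ such that $I(a,b)\le\lambda_s(a,b)\le A(a,b)$ for all $a,b>0$ and $s_1\le s\le2$. 7. $A(a,b)\le\lambda_s(a,b)\le S(a,b)$ for all $a,b>0$ and $2\le s\le5$. 8. There is no $s\in\mathbb R$ such that $S(a,b)\le\lambda_s(a,b)$ for all $a,b>0$. All these bounds are best possible: for each inequality in 2--7, the stated end of the range of $s$ at which it is limited cannot be improved. That is, for each $s\in\mathbb R$, where an inequality between means is understood to hold for all $a,b>0$: $\lambda_s\le H$ iff $s\le-4$; $H\le\lambda_s$ iff $s\ge-3$; $\lambda_s\le G$ iff $s\le-1$; $G\le\lambda_s$ iff $s\ge-\frac12$; $\lambda_s\le L$ iff $s\le0$; $L\le\lambda_s$ iff $s\ge s_0$; $\lambda_s\le I$ iff $s\le1$;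 $I\le\lambda_s$ iff $s\ge s_1$; $\lambda_s\le A$ iff $s\le2$; $A\le\lambda_s$ iff $s\ge2$; $\lambda_s\le S$ iff $s\le5$. -/

import Mathlib

/-- The harmonic mean. -/
noncomputable def meanH (a b : ℝ) : ℝ := 2 * (1 / a + 1 / b)⁻¹

/-- The geometric mean. -/
noncomputable def meanG (a b : ℝ) : ℝ := Real.sqrt (a * b)

open Classical in
/-- The logarithmic mean, extended by `L(a, a) = a`. -/
noncomputable def meanL (a b : ℝ) : ℝ :=
  if a = b then a else (b - a) / (Real.log b - Real.log a)

open Classical in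
/-- The identric mean, extended by `I(a, a) = a`. -/
noncomputable def meanI (a b : ℝ) : ℝ :=
  if a = b then a else (b ^ b / a ^ a) ^ (1 / (b - a)) / Real.exp 1

/-- The arithmetic mean. -/
noncomputable def meanA (a b : ℝ) : ℝ := (a + b) / 2

/-- The Gini mean. -/
noncomputable def meanS (a b : ℝ) : ℝ := a ^ (a / (a + b)) * b ^ (b / (a + b))

open Classical in
/-- The convex functions `f_s` on `(0, ∞)`, normalised by `f_s(1) = f_s'(1) = 0`,
with `f_s''(t) = t ^ (s - 2)`. -/
noncomputable def fPow (s t : ℝ) : ℝ :=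
  if s = 0 then t - Real.log t - 1
  else if s = 1 then t * Real.log t - t + 1
  else (t ^ s - s * t + s - 1) / (s * (s - 1))

/-- The functional `f(a) + f(b) - 2 f((a + b) / 2)`. -/
noncomputable def jensenBar (f : ℝ → ℝ) (a b : ℝ) : ℝ := f a + f b - 2 * f ((a + b) / 2)

open Classical in
/-- The mean `λ_s(a, b)`; on the diagonal, where the quotient is `0 / 0`, it has the value `a`
that every mean has there. -/
noncomputable def lambdaMean (s a b : ℝ) : ℝ :=
  if a = b then a else jensenBar (fPow (s + 1)) a b / jensenBar (fPow s) a b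

open Set Filter Topology

/-! Each `fPow s` is strictly convex, so λ_s is a quotient of two positive convexity defects. For s
≤ t and l = λ_s, the function f_{t+1} - l f_t - l^(t-s) (f_{s+1} - l f_s) has second derivative
y^(s-2) (y - l)(y^(t-s) - l^(t-s)) ≥ 0, and its defect yields λ_t ≥ l. Hence the parameters
satisfying a given inequality form a half-line, and each equivalence needs only the inequality at
the endpoint and its failure beyond.

Endpoints: all the means are symmetric and homogeneous, so pairs (e^(-u), e^u) suffice
(`IsHomMean.le`), and everything becomes hyperbolic in u. At s = -4, -3, -1, -1/2 and 2 algebra or x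
≤ sinh x decides; s = 0 rests on Lazarević's inequality (`sq_mul_sinh_le`), s = 1 reduces to s = 0,
and s = 5 uses the artanh series.

Failure beyond the endpoint: the expansion λ_s(1-x, 1+x) = 1 + (s-2)x²/6 + o(x²)
(`tendsto_lambdaMean_local`) settles every upper bound and A ≤ λ_s. The lower bounds H and G, and
the impossibility for S, are decided by a → 0 with b = 1.

The numbers s₀ and s₁ are infima of up-closed sets, attained by continuity in s
(`exists_threshold`). L ≤ λ_s fails at s = 1/12 for an explicit pair, and I ≤ λ_s fails at s = 1.03
as a → 0. They hold at 227/2500 < 1/11 and 10399/10000 < 1.04: for small u a logarithmic derivative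
is nonnegative, for large u one works with e^(-2u). Both routes end in polynomial inequalities on
intervals, mostly written in Bernstein form, that is, with positive coefficients in the distances to
the two ends of the interval. -/

/-- A function with nonnegative derivative between `a` and `b` satisfies `f a ≤ f b`. -/
theorem le_of_hasDerivAt_nonneg {f f' : ℝ → ℝ} {a b : ℝ} (hab : a ≤ b)
    (hd : ∀ x ∈ Icc a b, HasDerivAt f (f' x) x) (h : ∀ x ∈ Ioo a b, 0 ≤ f' x) : f a ≤ f b := by
  have hm : MonotoneOn f (Icc a b) := by
    refine monotoneOn_of_hasDerivWithinAt_nonneg (convex_Icc a b)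
      (fun x hx => (hd x hx).continuousAt.continuousWithinAt) (f' := f') ?_ ?_
    · intro x hx
      exact (hd x (interior_subset hx)).hasDerivWithinAt
    · intro x hx
      rw [interior_Icc] at hx
      exact h x hx
  exact hm (left_mem_Icc.2 hab) (right_mem_Icc.2 hab) hab

theorem nonneg_of_hasDerivAt_nonneg {f f' : ℝ → ℝ} (h0 : f 0 = 0)
    (hd : ∀ x, 0 ≤ x → HasDerivAt f (f' x) x) (h : ∀ x, 0 < x → 0 ≤ f' x) {x : ℝ} (hx : 0 ≤ x) :
    0 ≤ f x := by
  rw [← h0]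
  exact le_of_hasDerivAt_nonneg hx (fun y hy => hd y hy.1) (fun y hy => h y hy.1)

/-! ### Convexity of f_s and monotonicity of λ_s in s. -/

/-- The derivative of `fPow s`. -/
noncomputable def fPowDeriv (s t : ℝ) : ℝ :=
  if s = 1 then Real.log t else (t ^ (s - 1) - 1) / (s - 1)

theorem hasDerivAt_fPow (s : ℝ) {t : ℝ} (ht : 0 < t) :
    HasDerivAt (fPow s) (fPowDeriv s t) t := by
  unfold fPowDeriv
  by_cases h0 : s = 0
  · subst h0
    have : fPow 0 = fun t => t - Real.log t - 1 := by ext t; simp [fPow]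
    rw [this]
    have := ((hasDerivAt_id t).sub (Real.hasDerivAt_log ht.ne')).sub_const 1
    refine this.congr_deriv ?_
    simp [Real.rpow_neg_one]
    ring
  by_cases h1 : s = 1
  · subst h1
    have : fPow 1 = fun t => t * Real.log t - t + 1 := by ext t; simp [fPow]
    rw [this]
    have := (((hasDerivAt_id t).mul (Real.hasDerivAt_log ht.ne')).sub (hasDerivAt_id t)).add_const 1
    refine this.congr_deriv ?_
    simp [ht.ne']
  have : fPow s = fun t => (t ^ s - s * t + s - 1) / (s * (s - 1)) := by
    ext t; simp [fPow, h0, h1]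
  rw [this]
  have hs1 : s - 1 ≠ 0 := sub_ne_zero.2 h1
  have := ((((Real.hasDerivAt_rpow_const (p := s) (Or.inl ht.ne')).sub
    ((hasDerivAt_id t).const_mul s)).add_const s).sub_const 1).div_const (s * (s - 1))
  refine this.congr_deriv ?_
  rw [if_neg h1]
  field_simp

theorem hasDerivAt_fPowDeriv (s : ℝ) {t : ℝ} (ht : 0 < t) :
    HasDerivAt (fPowDeriv s) (t ^ (s - 2)) t := by
  by_cases h1 : s = 1
  · subst h1
    have : fPowDeriv 1 = fun t => Real.log t := by ext t; simp [fPowDeriv]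
    rw [this]
    have e : t ^ ((1 : ℝ) - 2) = t⁻¹ := by
      norm_num [Real.rpow_neg_one]
    rw [e]
    exact Real.hasDerivAt_log ht.ne'
  have : fPowDeriv s = fun t => (t ^ (s - 1) - 1) / (s - 1) := by
    ext t; simp [fPowDeriv, h1]
  rw [this]
  have hs1 : s - 1 ≠ 0 := sub_ne_zero.2 h1
  have := ((Real.hasDerivAt_rpow_const (p := s - 1) (Or.inl ht.ne')).sub_const 1).div_const (s - 1)
  refine this.congr_deriv ?_
  rw [show s - 1 - 1 = s - 2 by ring]
  field_simp

theorem jensenBar_nonneg {F F' F'' : ℝ → ℝ} (h1 : ∀ t, 0 < t → HasDerivAt F (F' t) t)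
    (h2 : ∀ t, 0 < t → HasDerivAt F' (F'' t) t) (h3 : ∀ t, 0 < t → 0 ≤ F'' t) {a b : ℝ}
    (ha : 0 < a) (hb : 0 < b) : 0 ≤ jensenBar F a b := by
  have hc : ConvexOn ℝ (Ioi 0) F := by
    refine convexOn_of_hasDerivWithinAt2_nonneg (convex_Ioi 0)
      (fun x hx => (h1 x hx).continuousAt.continuousWithinAt) (f' := F') (f'' := F'') ?_ ?_ ?_ <;>
      rw [interior_Ioi]
    · exact fun x hx => (h1 x hx).hasDerivWithinAt
    · exact fun x hx => (h2 x hx).hasDerivWithinAt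
    · exact fun x hx => h3 x hx
  have := hc.2 (mem_Ioi.2 ha) (mem_Ioi.2 hb) (show (0 : ℝ) ≤ 1 / 2 by norm_num)
    (show (0 : ℝ) ≤ 1 / 2 by norm_num) (by norm_num)
  simp only [smul_eq_mul] at this
  rw [show 1 / 2 * a + 1 / 2 * b = (a + b) / 2 by ring] at this
  unfold jensenBar
  linarith

theorem jensenBar_pos {F F' F'' : ℝ → ℝ} (h1 : ∀ t, 0 < t → HasDerivAt F (F' t) t)
    (h2 : ∀ t, 0 < t → HasDerivAt F' (F'' t) t) (h3 : ∀ t, 0 < t → 0 < F'' t) {a b : ℝ}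
    (ha : 0 < a) (hb : 0 < b) (hab : a ≠ b) : 0 < jensenBar F a b := by
  have hm : StrictMonoOn F' (Ioi 0) := by
    refine strictMonoOn_of_hasDerivWithinAt_pos (convex_Ioi 0)
      (fun x hx => (h2 x hx).continuousAt.continuousWithinAt) (f' := F'') ?_ ?_ <;>
      rw [interior_Ioi]
    · exact fun x hx => (h2 x hx).hasDerivWithinAt
    · exact fun x hx => h3 x hx
  have hc : StrictConvexOn ℝ (Ioi 0) F := by
    refine StrictMonoOn.strictConvexOn_of_deriv (convex_Ioi 0)
      (fun x hx => (h1 x hx).continuousAt.continuousWithinAt) ?_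
    rw [interior_Ioi]
    exact hm.congr fun x hx => ((h1 x hx).deriv).symm
  have := hc.2 (mem_Ioi.2 ha) (mem_Ioi.2 hb) hab (show (0 : ℝ) < 1 / 2 by norm_num)
    (show (0 : ℝ) < 1 / 2 by norm_num) (by norm_num)
  simp only [smul_eq_mul] at this
  rw [show 1 / 2 * a + 1 / 2 * b = (a + b) / 2 by ring] at this
  unfold jensenBar
  linarith

theorem jensenBar_fPow_pos (s : ℝ) {a b : ℝ} (ha : 0 < a) (hb : 0 < b) (hab : a ≠ b) :
    0 < jensenBar (fPow s) a b :=
  jensenBar_pos (fun _ ht => hasDerivAt_fPow s ht) (fun _ ht => hasDerivAt_fPowDeriv s ht)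
    (fun _ ht => Real.rpow_pos_of_pos ht _) ha hb hab

theorem lambdaMean_self (s a : ℝ) : lambdaMean s a a = a := by simp [lambdaMean]

theorem lambdaMean_of_ne (s : ℝ) {a b : ℝ} (hab : a ≠ b) :
    lambdaMean s a b = jensenBar (fPow (s + 1)) a b / jensenBar (fPow s) a b := by
  simp [lambdaMean, hab]

theorem lambdaMean_pos (s : ℝ) {a b : ℝ} (ha : 0 < a) (hb : 0 < b) : 0 < lambdaMean s a b := by
  by_cases hab : a = b
  · subst hab; rwa [lambdaMean_self]
  · rw [lambdaMean_of_ne s hab]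
    exact div_pos (jensenBar_fPow_pos _ ha hb hab) (jensenBar_fPow_pos _ ha hb hab)

theorem lambdaMean_monotone {a b : ℝ} (ha : 0 < a) (hb : 0 < b) :
    Monotone (fun s : ℝ => lambdaMean s a b) := by
  intro s t hst
  by_cases hab : a = b
  · subst hab; simp [lambdaMean_self]
  have hl := lambdaMean_pos s ha hb
  simp only
  set l := lambdaMean s a b with hl_def
  have hs := jensenBar_fPow_pos s ha hb hab
  have ht := jensenBar_fPow_pos t ha hb hab
  have hls : jensenBar (fPow (s + 1)) a b = l * jensenBar (fPow s) a b := by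
    rw [hl_def, lambdaMean_of_ne s hab]; field_simp
  -- The term with factor l^(t-s) has zero defect by the choice of l, but it makes the second
  -- derivative factor into two differences of equal sign.
  have key : 0 ≤ jensenBar (fun y => fPow (t + 1) y - l * fPow t y -
      l ^ (t - s) * (fPow (s + 1) y - l * fPow s y)) a b := by
    refine jensenBar_nonneg
      (F' := fun y => fPowDeriv (t + 1) y - l * fPowDeriv t y -
        l ^ (t - s) * (fPowDeriv (s + 1) y - l * fPowDeriv s y))
      (F'' := fun y => y ^ (t + 1 - 2) - l * y ^ (t - 2) -
        l ^ (t - s) * (y ^ (s + 1 - 2) - l * y ^ (s - 2))) ?_ ?_ ?_ ha hb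
    · intro y hy
      exact ((hasDerivAt_fPow _ hy).sub ((hasDerivAt_fPow _ hy).const_mul l)).sub
        (((hasDerivAt_fPow _ hy).sub ((hasDerivAt_fPow _ hy).const_mul l)).const_mul _)
    · intro y hy
      exact ((hasDerivAt_fPowDeriv _ hy).sub ((hasDerivAt_fPowDeriv _ hy).const_mul l)).sub
        (((hasDerivAt_fPowDeriv _ hy).sub ((hasDerivAt_fPowDeriv _ hy).const_mul l)).const_mul _)
    · intro y hy
      have e1 : y ^ (t + 1 - 2) = y ^ (s - 2) * y ^ (t - s) * y := by
        rw [← Real.rpow_add hy, ← Real.rpow_add_one hy.ne']; ring_nf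
      have e2 : y ^ (t - 2) = y ^ (s - 2) * y ^ (t - s) := by
        rw [← Real.rpow_add hy]; ring_nf
      have e3 : y ^ (s + 1 - 2) = y ^ (s - 2) * y := by
        rw [← Real.rpow_add_one hy.ne']; ring_nf
      rw [e1, e2, e3]
      have : y ^ (s - 2) * y ^ (t - s) * y - l * (y ^ (s - 2) * y ^ (t - s)) -
          l ^ (t - s) * (y ^ (s - 2) * y - l * y ^ (s - 2)) =
          y ^ (s - 2) * ((y - l) * (y ^ (t - s) - l ^ (t - s))) := by ring
      rw [this]
      refine mul_nonneg (Real.rpow_pos_of_pos hy _).le ?_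
      rcases le_total y l with h | h
      · have := Real.rpow_le_rpow hy.le h (sub_nonneg.2 hst)
        exact mul_nonneg_of_nonpos_of_nonpos (by linarith) (by linarith)
      · have := Real.rpow_le_rpow hl.le h (sub_nonneg.2 hst)
        exact mul_nonneg (by linarith) (by linarith)
  rw [lambdaMean_of_ne t hab, le_div_iff₀ ht]
  have e : jensenBar (fun y => fPow (t + 1) y - l * fPow t y -
      l ^ (t - s) * (fPow (s + 1) y - l * fPow s y)) a b =
      jensenBar (fPow (t + 1)) a b - l * jensenBar (fPow t) a b -
      l ^ (t - s) * (jensenBar (fPow (s + 1)) a b - l * jensenBar (fPow s) a b) := by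
    unfold jensenBar; ring
  rw [e, hls] at key
  linarith

/-! ### Closed forms, homogeneity and reduction to reciprocal pairs. -/

theorem jensenBar_fPow_of_ne {s : ℝ} (h0 : s ≠ 0) (h1 : s ≠ 1) (a b : ℝ) :
    jensenBar (fPow s) a b = (a ^ s + b ^ s - 2 * ((a + b) / 2) ^ s) / (s * (s - 1)) := by
  simp only [jensenBar, fPow, h0, h1, if_false]
  ring

theorem jensenBar_fPow_zero (a b : ℝ) :
    jensenBar (fPow 0) a b = 2 * Real.log ((a + b) / 2) - Real.log a - Real.log b := by
  simp only [jensenBar, fPow, if_true]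
  ring

theorem jensenBar_fPow_one (a b : ℝ) :
    jensenBar (fPow 1) a b =
      a * Real.log a + b * Real.log b - (a + b) * Real.log ((a + b) / 2) := by
  simp only [jensenBar, fPow, one_ne_zero, if_false, if_true]
  ring

theorem jensenBar_comm (f : ℝ → ℝ) (a b : ℝ) : jensenBar f a b = jensenBar f b a := by
  unfold jensenBar
  rw [add_comm b a]
  ring

theorem jensenBar_fPow_mul (s : ℝ) {r a b : ℝ} (hr : 0 < r) (ha : 0 < a) (hb : 0 < b) :
    jensenBar (fPow s) (r * a) (r * b) = r ^ s * jensenBar (fPow s) a b := by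
  have hm : 0 < (a + b) / 2 := by positivity
  have e : (r * a + r * b) / 2 = r * ((a + b) / 2) := by ring
  by_cases h0 : s = 0
  · subst h0
    rw [jensenBar_fPow_zero, jensenBar_fPow_zero, e, Real.log_mul hr.ne' ha.ne',
      Real.log_mul hr.ne' hb.ne', Real.log_mul hr.ne' hm.ne', Real.rpow_zero]
    ring
  by_cases h1 : s = 1
  · subst h1
    rw [jensenBar_fPow_one, jensenBar_fPow_one, e, Real.log_mul hr.ne' ha.ne',
      Real.log_mul hr.ne' hb.ne', Real.log_mul hr.ne' hm.ne', Real.rpow_one]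
    ring
  rw [jensenBar_fPow_of_ne h0 h1, jensenBar_fPow_of_ne h0 h1, e, Real.mul_rpow hr.le ha.le,
    Real.mul_rpow hr.le hb.le, Real.mul_rpow hr.le hm.le]
  ring

/-- Symmetric functions of two positive numbers that are homogeneous of degree one and reflexive. -/
structure IsHomMean (M : ℝ → ℝ → ℝ) : Prop where
  self : ∀ a, 0 < a → M a a = a
  comm : ∀ a b, 0 < a → 0 < b → M a b = M b a
  mul : ∀ r a b, 0 < r → 0 < a → 0 < b → M (r * a) (r * b) = r * M a b

/-- By symmetry a < b. Dividing by the geometric mean e^v turns the pair into (e^(-u), e^u), with u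
half of log (b / a). -/
theorem IsHomMean.le {M N : ℝ → ℝ → ℝ} (hM : IsHomMean M) (hN : IsHomMean N)
    (h : ∀ u, 0 < u → M (Real.exp (-u)) (Real.exp u) ≤ N (Real.exp (-u)) (Real.exp u))
    (a b : ℝ) (ha : 0 < a) (hb : 0 < b) : M a b ≤ N a b := by
  have main : ∀ a b : ℝ, 0 < a → a < b → M a b ≤ N a b := by
    intro a b ha hab
    have hb := ha.trans hab
    have hu : 0 < (Real.log b - Real.log a) / 2 := by
      have := Real.log_lt_log ha hab
      linarith
    have e1 : a = Real.exp ((Real.log a + Real.log b) / 2) *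
        Real.exp (-((Real.log b - Real.log a) / 2)) := by
      rw [← Real.exp_add]
      rw [show (Real.log a + Real.log b) / 2 + -((Real.log b - Real.log a) / 2) = Real.log a by ring,
        Real.exp_log ha]
    have e2 : b = Real.exp ((Real.log a + Real.log b) / 2) *
        Real.exp ((Real.log b - Real.log a) / 2) := by
      rw [← Real.exp_add]
      rw [show (Real.log a + Real.log b) / 2 + ((Real.log b - Real.log a) / 2) = Real.log b by ring,
        Real.exp_log hb]
    generalize (Real.log a + Real.log b) / 2 = v at e1 e2
    generalize (Real.log b - Real.log a) / 2 = u at e1 e2 hu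
    subst e1 e2
    rw [hM.mul _ _ _ (Real.exp_pos _) (Real.exp_pos _) (Real.exp_pos _),
      hN.mul _ _ _ (Real.exp_pos _) (Real.exp_pos _) (Real.exp_pos _)]
    exact mul_le_mul_of_nonneg_left (h _ hu) (Real.exp_pos _).le
  rcases lt_trichotomy a b with hab | hab | hab
  · exact main a b ha hab
  · subst hab
    rw [hM.self a ha, hN.self a ha]
  · rw [hM.comm a b ha hb, hN.comm a b ha hb]
    exact main b a hb hab

theorem isHomMean_lambdaMean (s : ℝ) : IsHomMean (lambdaMean s) where
  self a _ := lambdaMean_self s a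
  comm a b _ _ := by
    by_cases hab : a = b
    · subst hab; rfl
    · rw [lambdaMean_of_ne s hab, lambdaMean_of_ne s (Ne.symm hab), jensenBar_comm _ a,
        jensenBar_comm _ a]
  mul r a b hr ha hb := by
    by_cases hab : a = b
    · subst hab; rw [lambdaMean_self, lambdaMean_self]
    · have hab' : r * a ≠ r * b := fun h => hab (mul_left_cancel₀ hr.ne' h)
      have hp := Real.rpow_pos_of_pos hr s
      have hj := jensenBar_fPow_pos s ha hb hab
      rw [lambdaMean_of_ne s hab, lambdaMean_of_ne s hab', jensenBar_fPow_mul _ hr ha hb,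
        jensenBar_fPow_mul _ hr ha hb, Real.rpow_add_one hr.ne']
      field_simp

theorem isHomMean_meanH : IsHomMean meanH where
  self a ha := by unfold meanH; field_simp; norm_num
  comm a b _ _ := by unfold meanH; rw [add_comm]
  mul r a b hr ha hb := by unfold meanH; field_simp

theorem isHomMean_meanG : IsHomMean meanG where
  self a ha := by unfold meanG; exact Real.sqrt_mul_self ha.le
  comm a b _ _ := by unfold meanG; rw [mul_comm]
  mul r a b hr ha hb := by
    unfold meanG
    rw [show r * a * (r * b) = r ^ 2 * (a * b) by ring, Real.sqrt_mul (by positivity),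
      Real.sqrt_sq hr.le]

theorem isHomMean_meanA : IsHomMean meanA where
  self a _ := by unfold meanA; ring
  comm a b _ _ := by unfold meanA; ring
  mul r a b _ _ _ := by unfold meanA; ring

theorem isHomMean_meanL : IsHomMean meanL where
  self a _ := by simp [meanL]
  comm a b _ _ := by
    unfold meanL
    by_cases hab : a = b
    · subst hab; rfl
    · rw [if_neg hab, if_neg (Ne.symm hab), ← neg_sub a b, ← neg_sub (Real.log a), neg_div_neg_eq]
  mul r a b hr ha hb := by
    unfold meanL
    by_cases hab : a = b
    · subst hab; simp
    · have hab' : r * a ≠ r * b := fun h => hab (mul_left_cancel₀ hr.ne' h)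
      rw [if_neg hab, if_neg hab', Real.log_mul hr.ne' ha.ne', Real.log_mul hr.ne' hb.ne']
      rw [show Real.log r + Real.log b - (Real.log r + Real.log a) = Real.log b - Real.log a by ring]
      ring

theorem meanI_of_ne {a b : ℝ} (ha : 0 < a) (hb : 0 < b) (hab : a ≠ b) :
    meanI a b = Real.exp ((b * Real.log b - a * Real.log a) / (b - a) - 1) := by
  unfold meanI
  rw [if_neg hab, Real.exp_sub, Real.rpow_def_of_pos (by positivity),
    Real.log_div (by positivity) (by positivity), Real.log_rpow hb, Real.log_rpow ha]
  congr 2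
  ring

theorem meanS_eq {a b : ℝ} (ha : 0 < a) (hb : 0 < b) :
    meanS a b = Real.exp ((a * Real.log a + b * Real.log b) / (a + b)) := by
  unfold meanS
  rw [Real.rpow_def_of_pos ha, Real.rpow_def_of_pos hb, ← Real.exp_add]
  congr 1
  ring

theorem isHomMean_meanI : IsHomMean meanI where
  self a _ := by simp [meanI]
  comm a b ha hb := by
    by_cases hab : a = b
    · subst hab; rfl
    · rw [meanI_of_ne ha hb hab, meanI_of_ne hb ha (Ne.symm hab), ← neg_sub a b,
        ← neg_sub (a * Real.log a), neg_div_neg_eq]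
  mul r a b hr ha hb := by
    by_cases hab : a = b
    · subst hab; simp [meanI]
    · have hab' : r * a ≠ r * b := fun h => hab (mul_left_cancel₀ hr.ne' h)
      have hba : b - a ≠ 0 := sub_ne_zero.2 (Ne.symm hab)
      rw [meanI_of_ne ha hb hab, meanI_of_ne (mul_pos hr ha) (mul_pos hr hb) hab',
        Real.log_mul hr.ne' ha.ne', Real.log_mul hr.ne' hb.ne']
      have : r = Real.exp (Real.log r) := (Real.exp_log hr).symm
      conv_rhs => rw [this, ← Real.exp_add]
      congr 1
      rw [show r * b - r * a = r * (b - a) by ring]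
      field_simp
      ring

theorem isHomMean_meanS : IsHomMean meanS where
  self a ha := by
    rw [meanS_eq ha ha, show (a * Real.log a + a * Real.log a) / (a + a) = Real.log a by
      field_simp, Real.exp_log ha]
  comm a b ha hb := by
    rw [meanS_eq ha hb, meanS_eq hb ha, add_comm a b, add_comm (a * Real.log a)]
  mul r a b hr ha hb := by
    rw [meanS_eq ha hb, meanS_eq (mul_pos hr ha) (mul_pos hr hb),
      Real.log_mul hr.ne' ha.ne', Real.log_mul hr.ne' hb.ne']
    have : r = Real.exp (Real.log r) := (Real.exp_log hr).symm
    conv_rhs => rw [this, ← Real.exp_add]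
    congr 1
    field_simp
    ring

/-! ### The means on pairs (e^(-u), e^u). -/

section Hyperbolic

open Real

theorem exp_neg_add_exp (u : ℝ) : (exp (-u) + exp u) / 2 = cosh u := by
  rw [cosh_eq]; ring

theorem exp_neg_ne_exp {u : ℝ} (hu : 0 < u) : exp (-u) ≠ exp u := by
  intro h
  have := exp_injective h
  linarith

theorem meanH_exp (u : ℝ) : meanH (exp (-u)) (exp u) = 1 / cosh u := by
  unfold meanH
  rw [cosh_eq, exp_neg]
  have := exp_pos u
  field_simp

theorem meanG_exp (u : ℝ) : meanG (exp (-u)) (exp u) = 1 := by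
  unfold meanG
  rw [← exp_add]; simp

theorem meanL_exp {u : ℝ} (hu : 0 < u) : meanL (exp (-u)) (exp u) = sinh u / u := by
  unfold meanL
  rw [if_neg (exp_neg_ne_exp hu), log_exp, log_exp, sinh_eq]
  field_simp
  ring

theorem meanI_exp {u : ℝ} (hu : 0 < u) :
    meanI (exp (-u)) (exp u) = exp (u * cosh u / sinh u - 1) := by
  rw [meanI_of_ne (exp_pos _) (exp_pos _) (exp_neg_ne_exp hu), log_exp, log_exp, sinh_eq, cosh_eq]
  congr 2
  have h : exp u - exp (-u) ≠ 0 := sub_ne_zero.2 (exp_neg_ne_exp hu).symm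
  field_simp
  ring

theorem meanS_exp (u : ℝ) : meanS (exp (-u)) (exp u) = exp (u * sinh u / cosh u) := by
  rw [meanS_eq (exp_pos _) (exp_pos _), log_exp, log_exp, sinh_eq, cosh_eq]
  congr 1
  have := exp_pos u
  have := exp_pos (-u)
  field_simp
  ring

theorem jensenBar_fPow_exp {s : ℝ} (h0 : s ≠ 0) (h1 : s ≠ 1) (u : ℝ) :
    jensenBar (fPow s) (exp (-u)) (exp u) =
      2 * (cosh (s * u) - cosh u ^ s) / (s * (s - 1)) := by
  rw [jensenBar_fPow_of_ne h0 h1, exp_neg_add_exp, cosh_eq (s * u), ← exp_mul, ← exp_mul]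
  ring_nf

theorem jensenBar_fPow_zero_exp (u : ℝ) :
    jensenBar (fPow 0) (exp (-u)) (exp u) = 2 * log (cosh u) := by
  rw [jensenBar_fPow_zero, exp_neg_add_exp, log_exp, log_exp]
  ring

theorem jensenBar_fPow_one_exp (u : ℝ) :
    jensenBar (fPow 1) (exp (-u)) (exp u) = 2 * (u * sinh u - cosh u * log (cosh u)) := by
  rw [jensenBar_fPow_one, exp_neg_add_exp, log_exp, log_exp, sinh_eq]
  rw [show exp (-u) + exp u = 2 * cosh u by rw [← exp_neg_add_exp]; ring]
  ring

theorem lambdaMean_exp_le {s u B : ℝ} (hu : 0 < u)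
    (h : jensenBar (fPow (s + 1)) (exp (-u)) (exp u) ≤
      B * jensenBar (fPow s) (exp (-u)) (exp u)) :
    lambdaMean s (exp (-u)) (exp u) ≤ B := by
  rw [lambdaMean_of_ne s (exp_neg_ne_exp hu), div_le_iff₀
    (jensenBar_fPow_pos s (exp_pos _) (exp_pos _) (exp_neg_ne_exp hu))]
  exact h

theorem le_lambdaMean_exp {s u B : ℝ} (hu : 0 < u)
    (h : B * jensenBar (fPow s) (exp (-u)) (exp u) ≤
      jensenBar (fPow (s + 1)) (exp (-u)) (exp u)) :
    B ≤ lambdaMean s (exp (-u)) (exp u) := by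
  rw [lambdaMean_of_ne s (exp_neg_ne_exp hu), le_div_iff₀
    (jensenBar_fPow_pos s (exp_pos _) (exp_pos _) (exp_neg_ne_exp hu))]
  exact h

end Hyperbolic

/-! ### Endpoint inequalities for H, G and the upper bound L. -/

section Endpoints

open Real

/-- A function on `(0, b]` with nonnegative derivative that is bounded below near `0` by a function
tending to `0` is nonnegative at `b`. -/
theorem nonneg_of_hasDerivAt_of_tendsto {f f' g : ℝ → ℝ} {b : ℝ} (hb : 0 < b)
    (hd : ∀ x, 0 < x → x ≤ b → HasDerivAt f (f' x) x)
    (h : ∀ x, 0 < x → x < b → 0 ≤ f' x) (hg : Tendsto g (𝓝[>] 0) (𝓝 0))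
    (hgf : ∀ᶠ x in 𝓝[>] 0, g x ≤ f x) : 0 ≤ f b := by
  refine le_of_tendsto hg ?_
  have : Ioc 0 b ∈ 𝓝[>] (0 : ℝ) := Ioc_mem_nhdsGT hb
  filter_upwards [this, hgf] with x hx hgx
  refine hgx.trans ?_
  exact le_of_hasDerivAt_nonneg hx.2 (fun y hy => hd y (hx.1.trans_le hy.1) hy.2)
    (fun y hy => h y (hx.1.trans hy.1) hy.2)

theorem hasDerivAt_log_cosh (u : ℝ) : HasDerivAt (fun u => log (cosh u)) (sinh u / cosh u) u :=
  (hasDerivAt_cosh u).log (cosh_pos u).ne'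

theorem hasDerivAt_sinh_div_cosh (u : ℝ) :
    HasDerivAt (fun u => sinh u / cosh u) (1 / cosh u ^ 2) u := by
  refine ((hasDerivAt_sinh u).div (hasDerivAt_cosh u) (cosh_pos u).ne').congr_deriv ?_
  congr 1
  nlinarith [cosh_sq u]

theorem log_cosh_nonneg (u : ℝ) : 0 ≤ log (cosh u) := log_nonneg (one_le_cosh u)

theorem cosh_rpow_neg_natCast (u : ℝ) (n : ℕ) : cosh u ^ (-(n : ℝ)) = (cosh u ^ n)⁻¹ := by
  rw [rpow_neg (cosh_pos u).le, rpow_natCast]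

theorem cosh_four_mul (u : ℝ) : cosh (4 * u) = 8 * cosh u ^ 4 - 8 * cosh u ^ 2 + 1 := by
  rw [show 4 * u = 2 * (2 * u) by ring, cosh_two_mul, cosh_two_mul, sinh_two_mul]
  have := cosh_sq u
  have h : sinh u ^ 2 = cosh u ^ 2 - 1 := by linarith
  ring_nf
  simp only [show sinh u ^ 4 = (sinh u ^ 2) ^ 2 by ring, h]
  ring

/-- The difference is rational in c = cosh u. Its factor (c² - 1)³ reflects that λ_{-4} and H agree
to second order at the diagonal; at s = -3 only the square of c² - 1 appears. -/
theorem lambdaMean_le_meanH : ∀ a b : ℝ, 0 < a → 0 < b → lambdaMean (-4) a b ≤ meanH a b := by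
  refine (isHomMean_lambdaMean _).le isHomMean_meanH fun u hu => lambdaMean_exp_le hu ?_
  rw [meanH_exp, jensenBar_fPow_exp (by norm_num) (by norm_num),
    jensenBar_fPow_exp (by norm_num) (by norm_num)]
  have e3 : cosh u ^ ((-4 : ℝ) + 1) = (cosh u ^ 3)⁻¹ := by
    rw [← cosh_rpow_neg_natCast]; norm_num
  have e4 : cosh u ^ (-4 : ℝ) = (cosh u ^ 4)⁻¹ := by
    rw [← cosh_rpow_neg_natCast]; norm_num
  rw [e3, e4, show ((-4 : ℝ) + 1) * u = -(3 * u) by ring, show (-4 : ℝ) * u = -(4 * u) by ring,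
    cosh_neg, cosh_neg, cosh_three_mul, cosh_four_mul]
  have hc := one_le_cosh u
  set c := cosh u
  have hc0 : 0 < c := by linarith
  have key : 0 ≤ (c ^ 2 - 1) ^ 3 * (4 * c ^ 2 + 3) := by
    have : 0 ≤ c ^ 2 - 1 := by nlinarith
    positivity
  have e : 1 / c * (2 * (8 * c ^ 4 - 8 * c ^ 2 + 1 - (c ^ 4)⁻¹) / (-4 * (-4 - 1))) -
      2 * (4 * c ^ 3 - 3 * c - (c ^ 3)⁻¹) / ((-4 + 1) * (-4 + 1 - 1)) =
      (c ^ 2 - 1) ^ 3 * (4 * c ^ 2 + 3) / (30 * c ^ 5) := by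
    field_simp
    ring
  have : 0 ≤ (c ^ 2 - 1) ^ 3 * (4 * c ^ 2 + 3) / (30 * c ^ 5) := by positivity
  linarith

theorem meanH_le_lambdaMean : ∀ a b : ℝ, 0 < a → 0 < b → meanH a b ≤ lambdaMean (-3) a b := by
  refine isHomMean_meanH.le (isHomMean_lambdaMean _) fun u hu => le_lambdaMean_exp hu ?_
  rw [meanH_exp, jensenBar_fPow_exp (by norm_num) (by norm_num),
    jensenBar_fPow_exp (by norm_num) (by norm_num)]
  have e3 : cosh u ^ ((-3 : ℝ) + 1) = (cosh u ^ 2)⁻¹ := by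
    rw [← cosh_rpow_neg_natCast]; norm_num
  have e4 : cosh u ^ (-3 : ℝ) = (cosh u ^ 3)⁻¹ := by
    rw [← cosh_rpow_neg_natCast]; norm_num
  rw [e3, e4, show ((-3 : ℝ) + 1) * u = -(2 * u) by ring, show (-3 : ℝ) * u = -(3 * u) by ring,
    cosh_neg, cosh_neg, cosh_three_mul, cosh_two_mul]
  have hs : sinh u ^ 2 = cosh u ^ 2 - 1 := by linarith [cosh_sq u]
  rw [hs]
  have hc := one_le_cosh u
  set c := cosh u
  have hc0 : 0 < c := by linarith
  have e : 2 * (c ^ 2 + (c ^ 2 - 1) - (c ^ 2)⁻¹) / ((-3 + 1) * (-3 + 1 - 1)) -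
      1 / c * (2 * (4 * c ^ 3 - 3 * c - (c ^ 3)⁻¹) / (-3 * (-3 - 1))) =
      (c ^ 2 - 1) ^ 2 / (6 * c ^ 4) := by
    field_simp
    ring
  have : 0 ≤ (c ^ 2 - 1) ^ 2 / (6 * c ^ 4) := by positivity
  linarith

theorem lambdaMean_le_meanG : ∀ a b : ℝ, 0 < a → 0 < b → lambdaMean (-1) a b ≤ meanG a b := by
  refine (isHomMean_lambdaMean _).le isHomMean_meanG fun u hu => lambdaMean_exp_le hu ?_
  rw [meanG_exp, show (-1 : ℝ) + 1 = 0 by norm_num, jensenBar_fPow_zero_exp,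
    jensenBar_fPow_exp (by norm_num) (by norm_num), rpow_neg_one, neg_one_mul, cosh_neg]
  -- The defect of f_{-1} is cosh u - 1/cosh u = 2 sinh (log (cosh u)), and that of f_0 is 2 log
  -- (cosh u).
  have h := self_le_sinh_iff.2 (log_cosh_nonneg u)
  rw [sinh_eq, exp_neg, exp_log (cosh_pos u)] at h
  linarith

theorem meanG_le_lambdaMean :
    ∀ a b : ℝ, 0 < a → 0 < b → meanG a b ≤ lambdaMean (-1 / 2) a b := by
  refine isHomMean_meanG.le (isHomMean_lambdaMean _) fun u hu => le_lambdaMean_exp hu ?_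
  rw [meanG_exp, jensenBar_fPow_exp (by norm_num) (by norm_num),
    jensenBar_fPow_exp (by norm_num) (by norm_num)]
  have e1 : cosh u ^ ((-1 / 2 : ℝ) + 1) = √(cosh u) := by
    rw [sqrt_eq_rpow]; norm_num
  have e2 : cosh u ^ (-1 / 2 : ℝ) = (√(cosh u))⁻¹ := by
    rw [sqrt_eq_rpow, ← rpow_neg (cosh_pos u).le]; norm_num
  rw [e1, e2, show ((-1 / 2 : ℝ) + 1) * u = u / 2 by ring, show (-1 / 2 : ℝ) * u = -(u / 2) by ring,
    cosh_neg]
  have hp := one_le_cosh (u / 2)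
  have hq : √(cosh u) ^ 2 = 2 * cosh (u / 2) ^ 2 - 1 := by
    rw [sq_sqrt (cosh_pos u).le]
    have := cosh_two_mul (u / 2)
    rw [show 2 * (u / 2) = u by ring] at this
    linarith [cosh_sq (u / 2)]
  have hq0 : 0 < √(cosh u) := sqrt_pos.2 (cosh_pos u)
  set q := √(cosh u)
  set p := cosh (u / 2)
  -- Since q² = 2p² - 1, the squares of the two sides differ by exactly (q - 1/q)².
  have h4 : 4 * p ≤ 3 * q + q⁻¹ := by
    have hi : q * q⁻¹ = 1 := mul_inv_cancel₀ hq0.ne'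
    have hi0 : 0 < q⁻¹ := by positivity
    refine (sq_le_sq₀ (by positivity) (by positivity)).1 ?_
    nlinarith [sq_nonneg (q - q⁻¹)]
  norm_num
  linarith

theorem hasDerivAt_cosh_rpow (p u : ℝ) :
    HasDerivAt (fun u => cosh u ^ p) (p * cosh u ^ (p - 1) * sinh u) u := by
  refine ((hasDerivAt_cosh u).rpow_const (p := p) (Or.inl (cosh_pos u).ne')).congr_deriv ?_
  ring

/-- Lazarević's inequality. -/
theorem pow_three_mul_cosh_le {u : ℝ} (hu : 0 ≤ u) : u ^ 3 * cosh u ≤ sinh u ^ 3 := by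
  have hr : ∀ v : ℝ, (cosh v ^ (1 / 3 : ℝ)) ^ 3 = cosh v := by
    intro v
    rw [← rpow_natCast, ← rpow_mul (cosh_pos v).le]; norm_num
  have key : 0 ≤ sinh u * cosh u ^ (-1 / 3 : ℝ) - u := by
    refine nonneg_of_hasDerivAt_nonneg (f := fun u => sinh u * cosh u ^ (-1 / 3 : ℝ) - u) (by simp)
      (fun v _ => ((hasDerivAt_sinh v).mul (hasDerivAt_cosh_rpow (-1 / 3) v)).sub
        (hasDerivAt_id v)) ?_ hu
    intro v _
    have h0 : 0 < cosh v ^ (1 / 3 : ℝ) := rpow_pos_of_pos (cosh_pos v) _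
    have e1 : cosh v ^ (-1 / 3 : ℝ) = (cosh v ^ (1 / 3 : ℝ))⁻¹ := by
      rw [← rpow_neg (cosh_pos v).le]; norm_num
    have e2 : cosh v ^ (-1 / 3 - 1 : ℝ) = ((cosh v ^ (1 / 3 : ℝ)) ^ 4)⁻¹ := by
      rw [← rpow_natCast, ← rpow_mul (cosh_pos v).le, ← rpow_neg (cosh_pos v).le]; norm_num
    have hS : sinh v ^ 2 = cosh v ^ 2 - 1 := by linarith [cosh_sq v]
    have := hr v
    rw [e1, e2]
    set r := cosh v ^ (1 / 3 : ℝ)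
    rw [← this] at hS ⊢
    -- In terms of r = cosh^(1/3) the derivative is rational with a visible square.
    have e : r ^ 3 * r⁻¹ + sinh v * (-1 / 3 * (r ^ 4)⁻¹ * sinh v) - 1 =
        (r ^ 2 - 1) ^ 2 * (2 * r ^ 2 + 1) / (3 * r ^ 4) := by
      have : sinh v * (-1 / 3 * (r ^ 4)⁻¹ * sinh v) = -1 / 3 * (r ^ 4)⁻¹ * sinh v ^ 2 := by ring
      rw [this, hS]
      field_simp
      ring
    rw [e]
    positivity
  have h0 : 0 < cosh u ^ (1 / 3 : ℝ) := rpow_pos_of_pos (cosh_pos u) _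
  have e1 : cosh u ^ (-1 / 3 : ℝ) = (cosh u ^ (1 / 3 : ℝ))⁻¹ := by
    rw [← rpow_neg (cosh_pos u).le]; norm_num
  have h1 : u * cosh u ^ (1 / 3 : ℝ) ≤ sinh u := by
    rw [e1, sub_nonneg, ← div_eq_mul_inv, le_div_iff₀ h0] at key
    exact key
  have := pow_le_pow_left₀ (by positivity) h1 3
  rwa [mul_pow, hr] at this

/-- This is λ_0 ≤ L with denominators cleared. After division by sinh u + u cosh u, the difference
tends to 0 at 0 and its derivative has numerator sinh³ u - u³ cosh u, nonnegative by Lazarević. -/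
theorem sq_mul_sinh_le {u : ℝ} (hu : 0 < u) :
    u ^ 2 * sinh u ≤ log (cosh u) * (sinh u + u * cosh u) := by
  have hpos : ∀ v, 0 < v → 0 < sinh v + v * cosh v := fun v hv =>
    add_pos (sinh_pos_iff.2 hv) (mul_pos hv (cosh_pos v))
  have key : 0 ≤ log (cosh u) - u ^ 2 * sinh u / (sinh u + u * cosh u) := by
    refine nonneg_of_hasDerivAt_of_tendsto
      (f := fun u => log (cosh u) - u ^ 2 * sinh u / (sinh u + u * cosh u)) (g := fun u => -u ^ 2) hu
      (fun v hv _ => (hasDerivAt_log_cosh v).sub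
        ((((hasDerivAt_id v).pow 2).mul (hasDerivAt_sinh v)).div
          ((hasDerivAt_sinh v).add ((hasDerivAt_id v).mul (hasDerivAt_cosh v)))
          (hpos v hv).ne')) ?_ ?_ ?_
    · intro v hv _
      have hp := hpos v hv
      have hL := pow_three_mul_cosh_le hv.le
      have hc := cosh_pos v
      have hc2 : cosh v ^ 2 = sinh v ^ 2 + 1 := cosh_sq v
      simp only [id, Pi.mul_apply, Pi.pow_apply]
      rw [div_sub_div _ _ hc.ne' (by positivity)]
      refine div_nonneg ?_ (by positivity)
      have e : sinh v * (sinh v + v * cosh v) ^ 2 - cosh v * ((((2 : ℕ) : ℝ) * v ^ (2 - 1) * 1 * sinh v + v ^ 2 * cosh v) *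
        (sinh v + v * cosh v) - v ^ 2 * sinh v * (cosh v + (1 * cosh v + v * sinh v))) =
        sinh v ^ 3 - v ^ 3 * cosh v * (cosh v ^ 2 - sinh v ^ 2) := by
        push_cast
        ring
      rw [e, hc2]
      linarith
    · have : Tendsto (fun u : ℝ => -u ^ 2) (𝓝 0) (𝓝 (-0 ^ 2)) := by
        apply Continuous.tendsto; fun_prop
      simp only [ne_eq, OfNat.ofNat_ne_zero, not_false_eq_true, zero_pow, neg_zero] at this
      exact this.mono_left nhdsWithin_le_nhds
    · filter_upwards [self_mem_nhdsWithin] with v hv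
      have hv : 0 < v := hv
      have h1 : v ^ 2 * sinh v / (sinh v + v * cosh v) ≤ v ^ 2 := by
        rw [div_le_iff₀ (hpos v hv)]
        have := mul_pos hv (cosh_pos v)
        nlinarith [sq_nonneg v, mul_nonneg (sq_nonneg v) this.le]
      have := log_cosh_nonneg v
      linarith
  rw [sub_nonneg, div_le_iff₀ (hpos u hu)] at key
  exact key

theorem lambdaMean_le_meanL : ∀ a b : ℝ, 0 < a → 0 < b → lambdaMean 0 a b ≤ meanL a b := by
  refine (isHomMean_lambdaMean _).le isHomMean_meanL fun u hu => lambdaMean_exp_le hu ?_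
  rw [meanL_exp hu, zero_add, jensenBar_fPow_one_exp, jensenBar_fPow_zero_exp]
  have := sq_mul_sinh_le hu
  rw [div_mul_eq_mul_div, le_div_iff₀ hu]
  linarith

end Endpoints

/-! ### Endpoint inequalities for I, A and S. -/

section Endpoints

open Real

theorem lambdaMean_two {a b : ℝ} (ha : 0 < a) (hb : 0 < b) : lambdaMean 2 a b = meanA a b := by
  by_cases hab : a = b
  · subst hab; rw [lambdaMean_self, isHomMean_meanA.self a ha]
  have h := jensenBar_fPow_pos 2 ha hb hab
  rw [lambdaMean_of_ne 2 hab, div_eq_iff h.ne', jensenBar_fPow_of_ne (by norm_num) (by norm_num),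
    jensenBar_fPow_of_ne (by norm_num) (by norm_num), show (2 : ℝ) + 1 = (3 : ℕ) by norm_num]
  simp only [rpow_natCast, rpow_two]
  unfold meanA
  push_cast
  ring

theorem tendsto_sinh_div_self : Tendsto (fun u : ℝ => sinh u / u) (𝓝[>] 0) (𝓝 1) := by
  have h := (hasDerivAt_sinh 0).tendsto_slope
  rw [cosh_zero] at h
  refine (h.mono_left (nhdsWithin_mono _ fun x hx => ne_of_gt hx)).congr fun u => ?_
  rw [slope_def_field, sinh_zero, sub_zero, sub_zero]

theorem log_cosh_le (u : ℝ) : log (cosh u) ≤ u ^ 2 / 2 := by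
  rw [log_le_iff_le_exp (cosh_pos u)]
  exact cosh_le_exp_half_sq u

theorem hasDerivAt_mul_cosh_div_sinh {v : ℝ} (hv : 0 < v) :
    HasDerivAt (fun u => u * cosh u / sinh u) ((cosh v * sinh v - v) / sinh v ^ 2) v := by
  refine (((hasDerivAt_id v).mul (hasDerivAt_cosh v)).div (hasDerivAt_sinh v)
    (sinh_pos_iff.2 hv).ne').congr_deriv ?_
  simp only [id, Pi.mul_apply]
  congr 1
  have := cosh_sq v
  nlinarith

theorem one_le_mul_cosh_div_sinh {u : ℝ} (hu : 0 < u) : 1 ≤ u * cosh u / sinh u := by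
  rw [le_div_iff₀ (sinh_pos_iff.2 hu), one_mul, ← sub_nonneg]
  refine nonneg_of_hasDerivAt_nonneg (f := fun u => u * cosh u - sinh u) (by simp)
    (fun v _ => ((hasDerivAt_id v).mul (hasDerivAt_cosh v)).sub (hasDerivAt_sinh v)) ?_ hu.le
  intro v hv
  have := mul_pos hv (sinh_pos_iff.2 hv)
  simp only [id]
  linarith

theorem cosh_mul_log_cosh_lt {u : ℝ} (hu : 0 < u) : 0 < u * sinh u - cosh u * log (cosh u) := by
  have := jensenBar_fPow_pos 1 (exp_pos (-u)) (exp_pos u) (exp_neg_ne_exp hu)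
  rw [jensenBar_fPow_one_exp] at this
  linarith

/-- This quotient is what log (cosh u) ≤ u²/2 leaves of the ratio in `sinh_sq_le_identric`; its
limit supplies the starting value at 0. -/
theorem tendsto_identric_defect :
    Tendsto (fun u : ℝ => (2 * u * sinh u - u ^ 2 * cosh u) / sinh u ^ 2)
      (𝓝[>] 0) (𝓝 1) := by
  have h1 := tendsto_sinh_div_self
  have h2 : Tendsto cosh (𝓝[>] 0) (𝓝 1) := by
    have := (continuous_cosh.tendsto 0).mono_left (nhdsWithin_le_nhds (s := Ioi 0))
    rwa [cosh_zero] at this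
  have h3 : Tendsto (fun u : ℝ => 2 / (sinh u / u) - cosh u / (sinh u / u) ^ 2)
      (𝓝[>] 0) (𝓝 (2 / 1 - 1 / 1 ^ 2)) :=
    (tendsto_const_nhds.div h1 one_ne_zero).sub (h2.div (h1.pow 2) (by norm_num))
  have h5 : (2 / 1 - 1 / 1 ^ 2 : ℝ) = 1 := by norm_num
  rw [h5] at h3
  refine h3.congr' ?_
  filter_upwards [self_mem_nhdsWithin] with u hu
  have hu0 : u ≠ 0 := ne_of_gt hu
  have hs : sinh u ≠ 0 := (sinh_pos_iff.2 hu).ne'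
  field_simp

/-- This is λ_1 ≤ I, the defect of f_2 being sinh² u. The logarithm of the ratio of the two sides
has a derivative whose sign is decided by `sq_mul_sinh_le`, so s = 1 follows from s = 0. -/
theorem sinh_sq_le_identric {u : ℝ} (hu : 0 < u) :
    sinh u ^ 2 ≤ exp (u * cosh u / sinh u - 1) * (2 * (u * sinh u - cosh u * log (cosh u))) := by
  have key : 0 ≤ u * cosh u / sinh u - 1 - 2 * log (sinh u) + log 2 +
      log (u * sinh u - cosh u * log (cosh u)) := by
    refine nonneg_of_hasDerivAt_of_tendsto
      (f := fun u => u * cosh u / sinh u - 1 - 2 * log (sinh u) + log 2 +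
        log (u * sinh u - cosh u * log (cosh u)))
      (f' := fun v => (cosh v * sinh v - v) / sinh v ^ 2 - 2 * (cosh v / sinh v) +
        (v * cosh v - sinh v * log (cosh v)) / (v * sinh v - cosh v * log (cosh v)))
      hu ?_ ?_ (log_one ▸ tendsto_identric_defect.log one_ne_zero) ?_
    · intro v hv _
      have hq : HasDerivAt (fun u => u * sinh u - cosh u * log (cosh u))
          (v * cosh v - sinh v * log (cosh v)) v := by
        refine (((hasDerivAt_id v).mul (hasDerivAt_sinh v)).sub
          ((hasDerivAt_cosh v).mul (hasDerivAt_log_cosh v))).congr_deriv ?_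
        have := cosh_pos v
        simp only [id]
        field_simp
        ring
      exact ((((hasDerivAt_mul_cosh_div_sinh hv).sub_const 1).sub
        (((hasDerivAt_sinh v).log (sinh_pos_iff.2 hv).ne').const_mul 2)).add_const _).add
        (hq.log (cosh_mul_log_cosh_lt hv).ne')
    · intro v hv _
      have hS := sinh_pos_iff.2 hv
      have hc2 : cosh v ^ 2 = sinh v ^ 2 + 1 := cosh_sq v
      have hq := cosh_mul_log_cosh_lt hv
      have hk := sq_mul_sinh_le hv
      have e : (cosh v * sinh v - v) / sinh v ^ 2 - 2 * (cosh v / sinh v) +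
          (v * cosh v - sinh v * log (cosh v)) / (v * sinh v - cosh v * log (cosh v)) =
          (log (cosh v) * (sinh v * (cosh v ^ 2 - sinh v ^ 2) + v * cosh v) - v ^ 2 * sinh v) /
          (sinh v ^ 2 * (v * sinh v - cosh v * log (cosh v))) := by
        have := hq.ne'
        obtain ⟨q, hqe⟩ : ∃ q, v * sinh v - cosh v * log (cosh v) = q := ⟨_, rfl⟩
        rw [hqe] at this ⊢
        generalize log (cosh v) = l at *
        field_simp
        rw [← hqe]
        ring
      rw [e, hc2]
      refine div_nonneg ?_ (by positivity)
      linarith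
    · filter_upwards [self_mem_nhdsWithin, tendsto_identric_defect.eventually (lt_mem_nhds one_pos)]
        with v hv hpos
      have hv : 0 < v := hv
      have hS := sinh_pos_iff.2 hv
      have h1 := one_le_mul_cosh_div_sinh hv
      have hq := cosh_mul_log_cosh_lt hv
      have h2 := mul_le_mul_of_nonneg_left (log_cosh_le v) (cosh_pos v).le
      have e : log 2 + log (v * sinh v - cosh v * log (cosh v)) - 2 * log (sinh v) =
          log (2 * (v * sinh v - cosh v * log (cosh v)) / sinh v ^ 2) := by
        rw [log_div (by positivity) (by positivity), log_mul (by norm_num) hq.ne', log_pow]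
        push_cast
        ring
      have h3 : log ((2 * v * sinh v - v ^ 2 * cosh v) / sinh v ^ 2) ≤
          log (2 * (v * sinh v - cosh v * log (cosh v)) / sinh v ^ 2) := by
        refine log_le_log hpos ?_
        refine div_le_div_of_nonneg_right ?_ (by positivity)
        linarith
      linarith
  have hq := cosh_mul_log_cosh_lt hu
  have hS := sinh_pos_iff.2 hu
  rw [← log_le_log_iff (by positivity) (by positivity), log_mul (exp_pos _).ne' (by positivity),
    log_exp, log_mul (by norm_num) hq.ne', log_pow]
  push_cast
  linarith

theorem lambdaMean_le_meanI : ∀ a b : ℝ, 0 < a → 0 < b → lambdaMean 1 a b ≤ meanI a b := by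
  refine (isHomMean_lambdaMean _).le isHomMean_meanI fun u hu => lambdaMean_exp_le hu ?_
  rw [meanI_exp hu, jensenBar_fPow_one_exp, jensenBar_fPow_exp (by norm_num) (by norm_num),
    show (1 : ℝ) + 1 = 2 by norm_num, cosh_two_mul, rpow_two]
  have := sinh_sq_le_identric hu
  linarith

/-- These are the first two terms of artanh at tanh u; the difference has derivative tanh⁴. -/
theorem add_cube_le_of_tanh {u : ℝ} (hu : 0 ≤ u) :
    sinh u / cosh u + (sinh u / cosh u) ^ 3 / 3 ≤ u := by
  rw [← sub_nonneg]
  refine nonneg_of_hasDerivAt_nonneg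
    (f := fun u => u - (sinh u / cosh u + (sinh u / cosh u) ^ 3 / 3)) (by simp)
    (fun v _ => (hasDerivAt_id v).sub ((hasDerivAt_sinh_div_cosh v).add
      (((hasDerivAt_sinh_div_cosh v).pow 3).div_const 3))) ?_ hu
  intro v _
  have hc := cosh_pos v
  have hS : sinh v ^ 2 = cosh v ^ 2 - 1 := by linarith [cosh_sq v]
  have e : 1 - (1 / cosh v ^ 2 + ((3 : ℕ) : ℝ) * (sinh v / cosh v) ^ (3 - 1) * (1 / cosh v ^ 2) / 3) =
      (cosh v ^ 2 - 1) ^ 2 / cosh v ^ 4 := by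
    push_cast
    rw [div_pow, hS]
    field_simp
    ring
  rw [e]
  positivity

/-- With x = tanh u one has λ_5 = cosh u (1 + x² + x⁴/15)/(1 + x²/2) and S = e^(ux), so this is the
logarithm of λ_5 ≤ S. Differentiation compares u with a rational function of x, which stays below x
+ x³/3. -/
theorem log_le_mul_tanh {u : ℝ} (hu : 0 ≤ u) :
    log (cosh u) + log (1 + (sinh u / cosh u) ^ 2 + (sinh u / cosh u) ^ 4 / 15) ≤
      u * (sinh u / cosh u) + log (1 + (sinh u / cosh u) ^ 2 / 2) := by
  rw [← sub_nonneg]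
  have hder : ∀ v : ℝ, HasDerivAt (fun u => u * (sinh u / cosh u) +
      log (1 + (sinh u / cosh u) ^ 2 / 2) -
      (log (cosh u) + log (1 + (sinh u / cosh u) ^ 2 + (sinh u / cosh u) ^ 4 / 15)))
      (1 * (sinh v / cosh v) + v * (1 / cosh v ^ 2) +
        2 * (sinh v / cosh v) * (1 / cosh v ^ 2) / 2 / (1 + (sinh v / cosh v) ^ 2 / 2) -
        (sinh v / cosh v + (2 * (sinh v / cosh v) * (1 / cosh v ^ 2) +
          4 * (sinh v / cosh v) ^ 3 * (1 / cosh v ^ 2) / 15) /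
          (1 + (sinh v / cosh v) ^ 2 + (sinh v / cosh v) ^ 4 / 15))) v := by
    intro v
    have h2 : HasDerivAt (fun u => (sinh u / cosh u) ^ 2)
        (2 * (sinh v / cosh v) * (1 / cosh v ^ 2)) v := by
      simpa using (hasDerivAt_sinh_div_cosh v).fun_pow 2
    have h4 : HasDerivAt (fun u => (sinh u / cosh u) ^ 4)
        (4 * (sinh v / cosh v) ^ 3 * (1 / cosh v ^ 2)) v := by
      simpa using (hasDerivAt_sinh_div_cosh v).fun_pow 4
    have hl1 := ((h2.div_const 2).const_add 1).log (by positivity)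
    have hl2 := ((h2.const_add 1).add (h4.div_const 15)).log (ne_of_gt (by
      simp only [Pi.add_apply]; positivity))
    exact (((hasDerivAt_id v).mul (hasDerivAt_sinh_div_cosh v)).add hl1).sub
      ((hasDerivAt_log_cosh v).add hl2)
  refine nonneg_of_hasDerivAt_nonneg (by simp) (fun v _ => hder v) ?_ hu
  intro v hv
  have hx := add_cube_le_of_tanh hv.le
  have hx0 : 0 < sinh v / cosh v := div_pos (sinh_pos_iff.2 hv) (cosh_pos v)
  have hd : 0 < 1 / cosh v ^ 2 := by have := cosh_pos v; positivity
  set x := sinh v / cosh v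
  set d := 1 / cosh v ^ 2
  have hr : x * (1 + 4 * x ^ 2 / 15 + x ^ 4 / 15) ≤
      (x + x ^ 3 / 3) * ((1 + x ^ 2 + x ^ 4 / 15) * (1 + x ^ 2 / 2)) := by
    rw [← sub_nonneg]
    have : (x + x ^ 3 / 3) * ((1 + x ^ 2 + x ^ 4 / 15) * (1 + x ^ 2 / 2)) -
        x * (1 + 4 * x ^ 2 / 15 + x ^ 4 / 15) =
        x ^ 3 * (47 / 30 + x ^ 2 + 2 / 9 * x ^ 4 + x ^ 6 / 90) := by ring
    rw [this]
    positivity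
  have e : 1 * x + v * d + 2 * x * d / 2 / (1 + x ^ 2 / 2) -
      (x + (2 * x * d + 4 * x ^ 3 * d / 15) / (1 + x ^ 2 + x ^ 4 / 15)) =
      d * (v - x * (1 + 4 * x ^ 2 / 15 + x ^ 4 / 15) /
        ((1 + x ^ 2 + x ^ 4 / 15) * (1 + x ^ 2 / 2))) := by
    field_simp
    ring
  rw [e]
  refine mul_nonneg hd.le (sub_nonneg.2 ?_)
  rw [div_le_iff₀ (by positivity)]
  refine hr.trans (mul_le_mul_of_nonneg_right hx (by positivity))

theorem cosh_five_mul (u : ℝ) :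
    cosh (5 * u) = 16 * cosh u ^ 5 - 20 * cosh u ^ 3 + 5 * cosh u := by
  rw [show 5 * u = 3 * u + 2 * u by ring, cosh_add, cosh_three_mul, cosh_two_mul, sinh_three_mul,
    sinh_two_mul]
  have h : sinh u ^ 2 = cosh u ^ 2 - 1 := by linarith [cosh_sq u]
  ring_nf
  simp only [show sinh u ^ 4 = (sinh u ^ 2) ^ 2 by ring, h]
  ring

theorem lambdaMean_le_meanS : ∀ a b : ℝ, 0 < a → 0 < b → lambdaMean 5 a b ≤ meanS a b := by
  refine (isHomMean_lambdaMean _).le isHomMean_meanS fun u hu => lambdaMean_exp_le hu ?_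
  rw [meanS_exp, jensenBar_fPow_exp (by norm_num) (by norm_num),
    jensenBar_fPow_exp (by norm_num) (by norm_num), show ((5 : ℝ) + 1) = (6 : ℕ) by norm_num,
    rpow_natCast, show cosh u ^ (5 : ℝ) = cosh u ^ 5 by rw [← rpow_natCast]; norm_num,
    cosh_five_mul, show ((6 : ℕ) : ℝ) * u = 2 * (3 * u) by push_cast; ring, cosh_two_mul,
    sinh_sq, cosh_three_mul]
  have h := log_le_mul_tanh hu.le
  have hc := one_le_cosh u
  have hx2 : (sinh u / cosh u) ^ 2 = (cosh u ^ 2 - 1) / cosh u ^ 2 := by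
    rw [div_pow]; congr 1; linarith [cosh_sq u]
  have hx4 : (sinh u / cosh u) ^ 4 = ((cosh u ^ 2 - 1) / cosh u ^ 2) ^ 2 := by
    rw [← hx2]; ring
  rw [hx2, hx4] at h
  rw [mul_div_assoc u]
  generalize u * (sinh u / cosh u) = t at *
  generalize cosh u = c at *
  have hw : 0 ≤ c ^ 2 - 1 := by nlinarith
  rw [← log_mul (by positivity) (by positivity), ← sub_le_iff_le_add,
    ← log_div (by positivity) (by positivity), log_le_iff_le_exp (by positivity)] at h
  rw [div_le_iff₀ (by positivity)] at h
  generalize exp t = t at *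
  push_cast
  have h2 := mul_le_mul_of_nonneg_left h (show 0 ≤ c ^ 3 * (c ^ 2 - 1) by positivity)
  have e1 : c ^ 3 * (c ^ 2 - 1) * (c * (1 + (c ^ 2 - 1) / c ^ 2 + ((c ^ 2 - 1) / c ^ 2) ^ 2 / 15)) =
      (31 * c ^ 6 - 48 * c ^ 4 + 18 * c ^ 2 - 1) / 15 := by
    field_simp
    ring
  have e2 : c ^ 3 * (c ^ 2 - 1) * (t * (1 + (c ^ 2 - 1) / c ^ 2 / 2)) =
      t * ((15 * c ^ 5 - 20 * c ^ 3 + 5 * c) / 10) := by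
    field_simp
    ring
  rw [e1, e2] at h2
  refine le_trans (le_of_eq ?_) (h2.trans (le_of_eq ?_)) <;> ring

end Endpoints

/-! ### Second-order expansion at the diagonal: sharpness of the upper bounds. -/

section LocalExpansion

open Real

/-- Two applications of l'Hôpital's rule to `F (1 - x) + F (1 + x) - 2 F 1` at `x = 0`. -/
theorem tendsto_jensenBar_div_pow {F F' F'' : ℝ → ℝ} (h1 : ∀ t, 0 < t → HasDerivAt F (F' t) t)
    (h2 : ∀ t, 0 < t → HasDerivAt F' (F'' t) t) (n : ℕ) {l : ℝ}
    (h : Tendsto (fun x => (F'' (1 - x) + F'' (1 + x)) / ((n + 2) * ((n + 1) * x ^ n)))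
      (𝓝[>] 0) (𝓝 l)) :
    Tendsto (fun x => jensenBar F (1 - x) (1 + x) / x ^ (n + 2)) (𝓝[>] 0) (𝓝 l) := by
  have hIoo : Ioo (0 : ℝ) 1 ∈ 𝓝[>] (0 : ℝ) := Ioo_mem_nhdsGT one_pos
  have hsub : ∀ x : ℝ, HasDerivAt (fun x : ℝ => 1 - x) (-1) x := fun x => by
    simpa using (hasDerivAt_id x).const_sub 1
  have hadd : ∀ x : ℝ, HasDerivAt (fun x : ℝ => 1 + x) 1 x := fun x => by
    simpa using (hasDerivAt_id x).const_add 1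
  have d1 : ∀ x ∈ Ioo (-1 : ℝ) 1, HasDerivAt (fun x => jensenBar F (1 - x) (1 + x))
      (F' (1 + x) - F' (1 - x)) x := by
    intro x hx
    have e : (fun x => jensenBar F (1 - x) (1 + x)) =
        fun x => F (1 - x) + F (1 + x) - 2 * F 1 := by
      ext x
      unfold jensenBar
      rw [show (1 - x + (1 + x)) / 2 = 1 by ring]
    rw [e]
    have ha := (h1 (1 - x) (by linarith [hx.2])).comp x (hsub x)
    have hb := (h1 (1 + x) (by linarith [hx.1])).comp x (hadd x)
    refine ((ha.add hb).sub_const (2 * F 1)).congr_deriv ?_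
    ring
  have d2 : ∀ x ∈ Ioo (-1 : ℝ) 1, HasDerivAt (fun x => F' (1 + x) - F' (1 - x))
      (F'' (1 - x) + F'' (1 + x)) x := by
    intro x hx
    have ha := (h2 (1 - x) (by linarith [hx.2])).comp x (hsub x)
    have hb := (h2 (1 + x) (by linarith [hx.1])).comp x (hadd x)
    refine (hb.sub ha).congr_deriv ?_
    ring
  have h0 : (0 : ℝ) ∈ Ioo (-1 : ℝ) 1 := by constructor <;> norm_num
  have hle : 𝓝[>] (0 : ℝ) ≤ 𝓝 0 := nhdsWithin_le_nhds
  have hpow : ∀ k : ℕ, ∀ c : ℝ, Tendsto (fun x : ℝ => c * x ^ (k + 1)) (𝓝[>] 0) (𝓝 0) := by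
    intro k c
    have : Tendsto (fun x : ℝ => c * x ^ (k + 1)) (𝓝 0) (𝓝 (c * 0 ^ (k + 1))) :=
      (Continuous.tendsto (by fun_prop) 0)
    rw [zero_pow (Nat.succ_ne_zero k), mul_zero] at this
    exact this.mono_left hle
  refine HasDerivAt.lhopital_zero_nhdsGT (f' := fun x => F' (1 + x) - F' (1 - x))
    (g' := fun x => (n + 2 : ℝ) * x ^ (n + 1)) ?_ ?_ ?_ ?_ ?_ ?_
  · filter_upwards [hIoo] with x hx
    exact d1 x ⟨by linarith [hx.1], hx.2⟩
  · filter_upwards with x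
    have := hasDerivAt_pow (n + 2) x
    refine this.congr_deriv ?_
    push_cast
    simp
  · filter_upwards [hIoo] with x hx
    have := hx.1
    positivity
  · have := (d1 0 h0).continuousAt.tendsto.mono_left hle
    have e : jensenBar F (1 - 0) (1 + 0) = 0 := by unfold jensenBar; norm_num; ring
    rwa [e] at this
  · simpa using hpow (n + 1) 1
  refine HasDerivAt.lhopital_zero_nhdsGT (f' := fun x => F'' (1 - x) + F'' (1 + x))
    (g' := fun x => (n + 2 : ℝ) * ((n + 1) * x ^ n)) ?_ ?_ ?_ ?_ ?_ h
  · filter_upwards [hIoo] with x hx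
    exact d2 x ⟨by linarith [hx.1], hx.2⟩
  · filter_upwards with x
    have := (hasDerivAt_pow (n + 1) x).const_mul (n + 2 : ℝ)
    refine this.congr_deriv ?_
    push_cast
    simp
  · filter_upwards [hIoo] with x hx
    have := hx.1
    positivity
  · have := (d2 0 h0).continuousAt.tendsto.mono_left hle
    simpa using this
  · exact hpow n _

theorem tendsto_one_sub_add_rpow (p : ℝ) :
    Tendsto (fun x : ℝ => (1 - x) ^ p + (1 + x) ^ p) (𝓝[>] 0) (𝓝 2) := by
  have : ContinuousAt (fun x : ℝ => (1 - x) ^ p + (1 + x) ^ p) 0 := by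
    refine ContinuousAt.add ?_ ?_
    · exact (by fun_prop : ContinuousAt (fun x : ℝ => 1 - x) 0).rpow_const (Or.inl (by norm_num))
    · exact (by fun_prop : ContinuousAt (fun x : ℝ => 1 + x) 0).rpow_const (Or.inl (by norm_num))
  have h := this.tendsto.mono_left (nhdsWithin_le_nhds (s := Ioi 0))
  norm_num at h
  exact h

/-- The function f_{s+1} - f_s has second derivative t^(s-2) (t - 1). Its values at 1 - x and 1 + x
add up to x ((1+x)^(s-2) - (1-x)^(s-2)) ~ 2(s-2)x², so its defect is ~ (s-2)x⁴/6, while that of f_s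
is ~ x². -/
theorem tendsto_lambdaMean_local (s : ℝ) :
    Tendsto (fun x => (lambdaMean s (1 - x) (1 + x) - 1) / x ^ 2) (𝓝[>] 0) (𝓝 ((s - 2) / 6)) := by
  have hIoo : Ioo (0 : ℝ) 1 ∈ 𝓝[>] (0 : ℝ) := Ioo_mem_nhdsGT one_pos
  have hg : Tendsto (fun x => jensenBar (fPow s) (1 - x) (1 + x) / x ^ (0 + 2))
      (𝓝[>] 0) (𝓝 1) := by
    refine tendsto_jensenBar_div_pow (fun _ => hasDerivAt_fPow s) (fun _ => hasDerivAt_fPowDeriv s) 0 ?_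
    have := (tendsto_one_sub_add_rpow (s - 2)).div_const 2
    norm_num at this
    simpa using this
  have hd : Tendsto (fun x => jensenBar (fun t => fPow (s + 1) t - fPow s t) (1 - x) (1 + x) /
      x ^ (2 + 2)) (𝓝[>] 0) (𝓝 ((s - 2) / 6)) := by
    refine tendsto_jensenBar_div_pow
      (F' := fun t => fPowDeriv (s + 1) t - fPowDeriv s t)
      (F'' := fun t => t ^ (s + 1 - 2) - t ^ (s - 2))
      (fun _ ht => (hasDerivAt_fPow _ ht).sub (hasDerivAt_fPow _ ht))
      (fun _ ht => (hasDerivAt_fPowDeriv _ ht).sub (hasDerivAt_fPowDeriv _ ht)) 2 ?_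
    have hq : HasDerivAt (fun x : ℝ => (1 + x) ^ (s - 2) - (1 - x) ^ (s - 2)) (2 * (s - 2)) 0 := by
      have ha : HasDerivAt (fun x : ℝ => 1 + x) 1 0 := by
        simpa using (hasDerivAt_id (0 : ℝ)).const_add 1
      have hb : HasDerivAt (fun x : ℝ => 1 - x) (-1) 0 := by
        simpa using (hasDerivAt_id (0 : ℝ)).const_sub 1
      refine ((ha.rpow_const (p := s - 2) (Or.inl (by norm_num))).sub
        (hb.rpow_const (p := s - 2) (Or.inl (by norm_num)))).congr_deriv ?_
      norm_num
      ring
    have hs := hq.tendsto_slope.mono_left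
      (nhdsWithin_mono (0 : ℝ) (fun x (hx : x ∈ Ioi (0 : ℝ)) => ne_of_gt hx))
    have := hs.div_const 12
    rw [show 2 * (s - 2) / 12 = (s - 2) / 6 by ring] at this
    refine this.congr' ?_
    filter_upwards [hIoo] with x hx
    have hx0 : x ≠ 0 := hx.1.ne'
    have hm : (0 : ℝ) < 1 - x := by linarith [hx.2]
    have hp : (0 : ℝ) < 1 + x := by linarith [hx.1]
    have e1 : (1 - x) ^ (s + 1 - 2) = (1 - x) ^ (s - 2) * (1 - x) := by
      rw [← rpow_add_one hm.ne']; ring_nf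
    have e2 : (1 + x) ^ (s + 1 - 2) = (1 + x) ^ (s - 2) * (1 + x) := by
      rw [← rpow_add_one hp.ne']; ring_nf
    rw [e1, e2, slope_def_field]
    push_cast
    norm_num
    field_simp
    ring
  have := hd.div hg one_ne_zero
  rw [div_one] at this
  refine this.congr' ?_
  filter_upwards [hIoo] with x hx
  have hx0 : 0 < x := hx.1
  have hm : (0 : ℝ) < 1 - x := by linarith [hx.2]
  have hp : (0 : ℝ) < 1 + x := by linarith [hx.1]
  have hne : 1 - x ≠ 1 + x := by intro h; linarith
  have hj := jensenBar_fPow_pos s hm hp hne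
  rw [lambdaMean_of_ne s hne]
  have e : jensenBar (fun t => fPow (s + 1) t - fPow s t) (1 - x) (1 + x) =
      jensenBar (fPow (s + 1)) (1 - x) (1 + x) - jensenBar (fPow s) (1 - x) (1 + x) := by
    unfold jensenBar; ring
  simp only [Pi.div_apply]
  rw [e]
  field_simp
  ring

/-- A mean whose expansion at the diagonal has a smaller second order coefficient than `λ_s`
is not above `λ_s`. -/
theorem le_of_lambdaMean_le_of_expansion {M : ℝ → ℝ → ℝ} {c C : ℝ}
    (hM : ∀ᶠ x in 𝓝[>] (0 : ℝ), M (1 - x) (1 + x) ≤ 1 + c * x ^ 2 + C * x ^ 4) {s : ℝ}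
    (h : ∀ a b : ℝ, 0 < a → 0 < b → lambdaMean s a b ≤ M a b) : (s - 2) / 6 ≤ c := by
  have h2 : Tendsto (fun x : ℝ => c + C * x ^ 2) (𝓝[>] 0) (𝓝 c) := by
    have : Tendsto (fun x : ℝ => c + C * x ^ 2) (𝓝 0) (𝓝 (c + C * 0 ^ 2)) :=
      Continuous.tendsto (by fun_prop) 0
    rw [zero_pow two_ne_zero, mul_zero, add_zero] at this
    exact this.mono_left nhdsWithin_le_nhds
  refine le_of_tendsto_of_tendsto (tendsto_lambdaMean_local s) h2 ?_
  filter_upwards [hM, Ioo_mem_nhdsGT (one_pos (α := ℝ))] with x hx hx1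
  have hx0 : 0 < x := hx1.1
  have := h (1 - x) (1 + x) (by linarith [hx1.2]) (by linarith)
  rw [div_le_iff₀ (by positivity)]
  nlinarith

/-- The means H, G, L, I, A, S have second-order coefficients c = -1, -1/2, -1/3, -1/6, 0, 1/2 at
the diagonal, and (s - 2)/6 ≤ c reads s ≤ -4, -1, 0, 1, 2, 5. -/
theorem le_neg_four_of_lambdaMean_le_meanH {s : ℝ}
    (h : ∀ a b : ℝ, 0 < a → 0 < b → lambdaMean s a b ≤ meanH a b) : s ≤ -4 := by
  have := le_of_lambdaMean_le_of_expansion (c := -1) (C := 0) ?_ h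
  · linarith
  filter_upwards [Ioo_mem_nhdsGT (one_pos (α := ℝ))] with x hx
  have hm : (0 : ℝ) < 1 - x := by linarith [hx.2]
  have hp : (0 : ℝ) < 1 + x := by linarith [hx.1]
  unfold meanH
  refine le_of_eq ?_
  field_simp
  ring

theorem le_neg_one_of_lambdaMean_le_meanG {s : ℝ}
    (h : ∀ a b : ℝ, 0 < a → 0 < b → lambdaMean s a b ≤ meanG a b) : s ≤ -1 := by
  have := le_of_lambdaMean_le_of_expansion (c := -1 / 2) (C := 0) ?_ h
  · linarith
  filter_upwards [Ioo_mem_nhdsGT (one_pos (α := ℝ))] with x hx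
  unfold meanG
  rw [sqrt_le_left (by nlinarith [hx.1, hx.2])]
  nlinarith [sq_nonneg (x ^ 2)]

theorem le_two_of_lambdaMean_le_meanA {s : ℝ}
    (h : ∀ a b : ℝ, 0 < a → 0 < b → lambdaMean s a b ≤ meanA a b) : s ≤ 2 := by
  have := le_of_lambdaMean_le_of_expansion (c := 0) (C := 0) ?_ h
  · linarith
  filter_upwards with x
  unfold meanA
  linarith

theorem two_le_of_meanA_le_lambdaMean {s : ℝ}
    (h : ∀ a b : ℝ, 0 < a → 0 < b → meanA a b ≤ lambdaMean s a b) : 2 ≤ s := by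
  have : 0 ≤ (s - 2) / 6 := by
    refine ge_of_tendsto (tendsto_lambdaMean_local s) ?_
    filter_upwards [Ioo_mem_nhdsGT (one_pos (α := ℝ))] with x hx
    have := h (1 - x) (1 + x) (by linarith [hx.2]) (by linarith [hx.1])
    unfold meanA at this
    exact div_nonneg (by linarith) (sq_nonneg x)
  linarith

theorem hasDerivAt_log_one_add {x : ℝ} (h : -1 < x) :
    HasDerivAt (fun x : ℝ => log (1 + x)) (1 / (1 + x)) x :=
  ((hasDerivAt_id x).const_add 1).log (by simp only [id]; linarith)

theorem hasDerivAt_log_one_sub {x : ℝ} (h : x < 1) :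
    HasDerivAt (fun x : ℝ => log (1 - x)) (-1 / (1 - x)) x :=
  ((hasDerivAt_id x).const_sub 1).log (by simp only [id]; linarith)

theorem log_sub_log_ge {x : ℝ} (h0 : 0 ≤ x) (h1 : x < 1) :
    2 * (x + x ^ 3 / 3) ≤ log (1 + x) - log (1 - x) := by
  rw [← sub_nonneg]
  have := le_of_hasDerivAt_nonneg
    (f := fun x => log (1 + x) - log (1 - x) - 2 * (x + x ^ 3 / 3))
    (f' := fun x => 1 / (1 + x) - -1 / (1 - x) - 2 * (1 + x ^ 2)) h0 ?_ ?_
  · simpa using this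
  · intro y hy
    refine ((hasDerivAt_log_one_add (by linarith [hy.1])).sub
      (hasDerivAt_log_one_sub (by linarith [hy.2]))).sub
      (((hasDerivAt_id y).add (((hasDerivAt_id y).pow 3).div_const 3)).const_mul 2) |>.congr_deriv ?_
    simp
  · intro y hy
    have hm : (0 : ℝ) < 1 - y := by linarith [hy.2]
    have hp : (0 : ℝ) < 1 + y := by linarith [hy.1]
    have : 1 / (1 + y) - -1 / (1 - y) - 2 * (1 + y ^ 2) = 2 * y ^ 4 / ((1 + y) * (1 - y)) := by
      field_simp
      ring
    rw [this]
    positivity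

theorem log_sub_log_le {x : ℝ} (h0 : 0 ≤ x) (h1 : x ≤ 1 / 2) :
    log (1 + x) - log (1 - x) ≤ 2 * x + 4 * x ^ 3 := by
  rw [← sub_nonneg]
  have := le_of_hasDerivAt_nonneg
    (f := fun x => 2 * x + 4 * x ^ 3 - (log (1 + x) - log (1 - x)))
    (f' := fun x => 2 + 12 * x ^ 2 - (1 / (1 + x) - -1 / (1 - x))) h0 ?_ ?_
  · simpa using this
  · intro y hy
    refine (((hasDerivAt_id y).const_mul 2).add (((hasDerivAt_id y).pow 3).const_mul 4)).sub
      ((hasDerivAt_log_one_add (by linarith [hy.1])).sub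
      (hasDerivAt_log_one_sub (by linarith [hy.2]))) |>.congr_deriv ?_
    simp
    ring
  · intro y hy
    have hm : (0 : ℝ) < 1 - y := by linarith [hy.2]
    have hp : (0 : ℝ) < 1 + y := by linarith [hy.1]
    have : 2 + 12 * y ^ 2 - (1 / (1 + y) - -1 / (1 - y)) =
        2 * y ^ 2 * (5 - 6 * y ^ 2) / ((1 + y) * (1 - y)) := by
      field_simp
      ring
    rw [this]
    have : 0 < 5 - 6 * y ^ 2 := by nlinarith [hy.1, hy.2]
    positivity

theorem nonpos_of_lambdaMean_le_meanL {s : ℝ}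
    (h : ∀ a b : ℝ, 0 < a → 0 < b → lambdaMean s a b ≤ meanL a b) : s ≤ 0 := by
  have := le_of_lambdaMean_le_of_expansion (c := -1 / 3) (C := 1 / 9) ?_ h
  · linarith
  -- The bound on the logarithms gives L ≤ 1/(1 + x²/3), and this is at most 1 - x²/3 + x⁴/9.
  filter_upwards [Ioo_mem_nhdsGT (one_pos (α := ℝ))] with x hx
  have hx0 := hx.1
  have hl := log_sub_log_ge hx.1.le hx.2
  unfold meanL
  rw [if_neg (by intro h; linarith)]
  rw [div_le_iff₀ (by nlinarith [pow_pos hx0 3])]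
  have h1 : 0 < 1 + -1 / 3 * x ^ 2 + 1 / 9 * x ^ 4 := by nlinarith [sq_nonneg (x ^ 2 - 1)]
  have := mul_le_mul_of_nonneg_left hl h1.le
  nlinarith [pow_pos hx0 7]

theorem le_one_of_lambdaMean_le_meanI {s : ℝ}
    (h : ∀ a b : ℝ, 0 < a → 0 < b → lambdaMean s a b ≤ meanI a b) : s ≤ 1 := by
  have := le_of_lambdaMean_le_of_expansion (c := -1 / 6) (C := 1 / 36) ?_ h
  · linarith
  filter_upwards [Ioo_mem_nhdsGT (one_pos (α := ℝ))] with x hx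
  have hx0 := hx.1
  have hx1 := hx.2
  have hm : (0 : ℝ) < 1 - x := by linarith
  have hp : (0 : ℝ) < 1 + x := by linarith
  rw [meanI_of_ne hm hp (by intro h; linarith)]
  -- The difference has derivative -x² - log (1 - x²) ≥ 0.
  have hN : (1 + x) * log (1 + x) - (1 - x) * log (1 - x) ≤ 2 * x - x ^ 3 / 3 := by
    rw [← sub_nonneg]
    have := le_of_hasDerivAt_nonneg
      (f := fun x => 2 * x - x ^ 3 / 3 - ((1 + x) * log (1 + x) - (1 - x) * log (1 - x)))
      (f' := fun x => 2 - x ^ 2 - (log (1 + x) + 1 - (-log (1 - x) - 1))) hx0.le ?_ ?_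
    · simpa using this
    · intro y hy
      have hm : (0 : ℝ) < 1 - y := by linarith [hy.2]
      have hp : (0 : ℝ) < 1 + y := by linarith [hy.1]
      refine (((hasDerivAt_id y).const_mul 2).sub (((hasDerivAt_id y).pow 3).div_const 3)).sub
        ((((hasDerivAt_id y).const_add 1).mul (hasDerivAt_log_one_add (by linarith))).sub
        (((hasDerivAt_id y).const_sub 1).mul (hasDerivAt_log_one_sub (by linarith)))) |>.congr_deriv ?_
      simp only [id]
      field_simp
      push_cast
      ring
    · intro y hy
      have hm : (0 : ℝ) < 1 - y := by linarith [hy.2]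
      have hp : (0 : ℝ) < 1 + y := by linarith [hy.1]
      have h2 := log_le_sub_one_of_pos (mul_pos hp hm)
      rw [log_mul hp.ne' hm.ne'] at h2
      nlinarith
  have hexp : ((1 + x) * log (1 + x) - (1 - x) * log (1 - x)) / (1 + x - (1 - x)) - 1 ≤
      -(x ^ 2 / 6) := by
    rw [show 1 + x - (1 - x) = 2 * x by ring, sub_le_iff_le_add, div_le_iff₀ (by positivity)]
    nlinarith
  refine (exp_le_exp.2 hexp).trans ?_
  have := abs_le.1 (abs_exp_sub_one_sub_id_le (x := -(x ^ 2 / 6)) (by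
    rw [abs_neg, abs_of_nonneg (by positivity)]; nlinarith))
  nlinarith [this.2]

theorem le_five_of_lambdaMean_le_meanS {s : ℝ}
    (h : ∀ a b : ℝ, 0 < a → 0 < b → lambdaMean s a b ≤ meanS a b) : s ≤ 5 := by
  have := le_of_lambdaMean_le_of_expansion (c := 1 / 2) (C := 3 / 2) ?_ h
  · linarith
  filter_upwards [Ioo_mem_nhdsGT (show (0 : ℝ) < 1 / 2 by norm_num)] with x hx
  have hx0 := hx.1
  have hx1 := hx.2
  have hm : (0 : ℝ) < 1 - x := by linarith
  have hp : (0 : ℝ) < 1 + x := by linarith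
  rw [meanS_eq hm hp]
  have hN : (1 - x) * log (1 - x) + (1 + x) * log (1 + x) ≤ x ^ 2 + x ^ 4 := by
    rw [← sub_nonneg]
    have := le_of_hasDerivAt_nonneg
      (f := fun x => x ^ 2 + x ^ 4 - ((1 - x) * log (1 - x) + (1 + x) * log (1 + x)))
      (f' := fun x => 2 * x + 4 * x ^ 3 - ((-log (1 - x) - 1) + (log (1 + x) + 1))) hx0.le ?_ ?_
    · simpa using this
    · intro y hy
      have hm : (0 : ℝ) < 1 - y := by linarith [hy.2]
      have hp : (0 : ℝ) < 1 + y := by linarith [hy.1]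
      refine (((hasDerivAt_id y).pow 2).add ((hasDerivAt_id y).pow 4)).sub
        ((((hasDerivAt_id y).const_sub 1).mul (hasDerivAt_log_one_sub (by linarith))).add
        (((hasDerivAt_id y).const_add 1).mul (hasDerivAt_log_one_add (by linarith))))
        |>.congr_deriv ?_
      simp only [id]
      field_simp
      push_cast
      ring
    · intro y hy
      have := log_sub_log_le hy.1.le (by linarith [hy.2])
      linarith
  have hexp : ((1 - x) * log (1 - x) + (1 + x) * log (1 + x)) / (1 - x + (1 + x)) ≤
      (x ^ 2 + x ^ 4) / 2 := by
    rw [show 1 - x + (1 + x) = 2 by ring]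
    linarith
  refine (exp_le_exp.2 hexp).trans ?_
  have hx2 : x ^ 2 ≤ 1 / 4 := by nlinarith
  have hx4 : x ^ 4 ≤ x ^ 2 := by nlinarith [sq_nonneg x]
  have := abs_le.1 (abs_exp_sub_one_sub_id_le (x := (x ^ 2 + x ^ 4) / 2) (by
    rw [abs_of_nonneg (by positivity)]; nlinarith))
  have h5 : ((x ^ 2 + x ^ 4) / 2) ^ 2 ≤ x ^ 4 := by
    have : (x ^ 2 + x ^ 4) / 2 ≤ x ^ 2 := by linarith
    have := pow_le_pow_left₀ (by positivity) this 2
    nlinarith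
  linarith [this.2]

end LocalExpansion

/-! ### Behaviour as a → 0: sharpness of the lower bounds. -/

section Boundary

open Real

theorem tendsto_rpow_zero {p : ℝ} (hp : 0 < p) :
    Tendsto (fun a : ℝ => a ^ p) (𝓝[>] 0) (𝓝 0) := by
  have := (continuousAt_rpow_const 0 p (Or.inr hp.le)).tendsto
  rw [zero_rpow hp.ne'] at this
  exact this.mono_left nhdsWithin_le_nhds

theorem tendsto_one_sub_mid_rpow (p : ℝ) :
    Tendsto (fun a : ℝ => 1 - 2 * ((a + 1) / 2) ^ p) (𝓝[>] 0) (𝓝 (1 - 2 * (1 / 2) ^ p)) := by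
  have : ContinuousAt (fun a : ℝ => 1 - 2 * ((a + 1) / 2) ^ p) 0 :=
    continuousAt_const.sub (continuousAt_const.mul
      ((by fun_prop : ContinuousAt (fun a : ℝ => (a + 1) / 2) 0).rpow_const
        (Or.inl (by norm_num))))
  have := this.tendsto.mono_left (nhdsWithin_le_nhds (s := Ioi 0))
  rwa [zero_add] at this

theorem jensenBar_fPow_right_one {s : ℝ} (h0 : s ≠ 0) (h1 : s ≠ 1) (a : ℝ) :
    jensenBar (fPow s) a 1 = (a ^ s + (1 - 2 * ((a + 1) / 2) ^ s)) / (s * (s - 1)) := by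
  rw [jensenBar_fPow_of_ne h0 h1, one_rpow]
  ring

theorem tendsto_jensenBar_fPow_right_one {s : ℝ} (h0 : 0 < s) (h1 : s ≠ 1) :
    Tendsto (fun a => jensenBar (fPow s) a 1) (𝓝[>] 0)
      (𝓝 ((1 - 2 * (1 / 2) ^ s) / (s * (s - 1)))) := by
  have := ((tendsto_rpow_zero h0).add (tendsto_one_sub_mid_rpow s)).div_const (s * (s - 1))
  rw [zero_add] at this
  exact this.congr fun a => (jensenBar_fPow_right_one h0.ne' h1 a).symm

theorem mul_jensenBar_le_of_le_lambdaMean {s a m : ℝ} (ha : 0 < a) (ha1 : a < 1)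
    (h : m ≤ lambdaMean s a 1) :
    m * jensenBar (fPow s) a 1 ≤ jensenBar (fPow (s + 1)) a 1 := by
  rw [lambdaMean_of_ne s ha1.ne, le_div_iff₀ (jensenBar_fPow_pos s ha one_pos ha1.ne)] at h
  exact h

/-- For s < -1 the powers of a dominate: λ_s(a, 1) ~ a (s-1)/(s+1), while H ~ 2a. Multiplying by
a^(-(s+1)) makes both sides converge, and 2 ≤ (s-1)/(s+1) excludes s < -3. -/
theorem neg_three_le_of_meanH_le_lambdaMean {s : ℝ}
    (h : ∀ a b : ℝ, 0 < a → 0 < b → meanH a b ≤ lambdaMean s a b) : -3 ≤ s := by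
  by_contra! hs
  have hB : ∀ p r : ℝ, 0 < r → Tendsto (fun a : ℝ => 1 + a ^ r * (1 - 2 * ((a + 1) / 2) ^ p))
      (𝓝[>] 0) (𝓝 1) := by
    intro p r hr
    have := ((tendsto_rpow_zero hr).mul (tendsto_one_sub_mid_rpow p)).const_add 1
    rwa [zero_mul, add_zero] at this
  have hL : Tendsto (fun a : ℝ => 2 / (1 + a) *
      ((1 + a ^ (-s) * (1 - 2 * ((a + 1) / 2) ^ s)) / (s * (s - 1)))) (𝓝[>] 0)
      (𝓝 (2 / (1 + 0) * (1 / (s * (s - 1))))) := by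
    refine Tendsto.mul ?_ ((hB s (-s) (by linarith)).div_const _)
    have : ContinuousAt (fun a : ℝ => 2 / (1 + a)) 0 :=
      continuousAt_const.div (by fun_prop) (by norm_num)
    exact this.tendsto.mono_left nhdsWithin_le_nhds
  have hR := (hB (s + 1) (-(s + 1)) (by linarith)).div_const ((s + 1) * s)
  have key := le_of_tendsto_of_tendsto hL hR (by
    filter_upwards [Ioo_mem_nhdsGT (one_pos (α := ℝ))] with a ha
    have ha0 := ha.1
    have := mul_jensenBar_le_of_le_lambdaMean ha.1 ha.2 (h a 1 ha.1 one_pos)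
    rw [jensenBar_fPow_right_one (by linarith) (by linarith),
      jensenBar_fPow_right_one (by linarith) (by linarith)] at this
    have hp : 0 < a ^ (-(s + 1)) := rpow_pos_of_pos ha0 _
    have h2 := mul_le_mul_of_nonneg_left this hp.le
    have e1 : a ^ (-(s + 1)) * a ^ (s + 1) = 1 := by
      rw [← rpow_add ha0]; simp
    have e2 : a ^ (-(s + 1)) * a = a ^ (-s) := by
      rw [← rpow_add_one ha0.ne']; ring_nf
    have e3 : a ^ (-s) * a ^ s = 1 := by
      rw [← rpow_add ha0]; simp
    have eH : meanH a 1 = a * (2 / (1 + a)) := by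
      unfold meanH; field_simp
    rw [eH] at h2
    calc _ = a ^ (-(s + 1)) * (a * (2 / (1 + a)) *
          ((a ^ s + (1 - 2 * ((a + 1) / 2) ^ s)) / (s * (s - 1)))) := by
          linear_combination -(2 / (1 + a) / (s * (s - 1)) *
            (a ^ s + (1 - 2 * ((a + 1) / 2) ^ s))) * e2 - (2 / (1 + a) / (s * (s - 1))) * e3
      _ ≤ _ := h2
      _ = _ := by
          rw [show s + 1 - 1 = s by ring]
          linear_combination (1 / ((s + 1) * s)) * e1)
  have h1 : 0 < s * (s - 1) := by nlinarith
  have h2 : 0 < (s + 1) * s := by nlinarith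
  rw [add_zero, div_one, mul_one_div, div_le_div_iff₀ h1 h2] at key
  nlinarith

/-- For -1 < t < 0, λ_t(a, 1) has order a^(-t), which for t < -1/2 is negligible against G =
a^(1/2). -/
theorem neg_half_le_of_meanG_le_lambdaMean {s : ℝ}
    (h : ∀ a b : ℝ, 0 < a → 0 < b → meanG a b ≤ lambdaMean s a b) : -1 / 2 ≤ s := by
  by_contra! hs
  -- Monotonicity allows s to be raised into (-1, -1/2), where the defect of f_{t+1} stays bounded
  -- as a → 0.
  obtain ⟨t, ht1, ht2, hst⟩ : ∃ t : ℝ, -1 < t ∧ t < -1 / 2 ∧ s ≤ t :=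
    ⟨max s (-3 / 4), lt_max_of_lt_right (by norm_num), max_lt hs (by norm_num), le_max_left _ _⟩
  have hL : Tendsto (fun a : ℝ => (1 + a ^ (-t) * (1 - 2 * ((a + 1) / 2) ^ t)) / (t * (t - 1)))
      (𝓝[>] 0) (𝓝 ((1 + 0 * (1 - 2 * (1 / 2) ^ t)) / (t * (t - 1)))) :=
    (((tendsto_rpow_zero (by linarith)).mul (tendsto_one_sub_mid_rpow t)).const_add 1).div_const _
  have hR : Tendsto (fun a : ℝ => a ^ (-t - 1 / 2) * jensenBar (fPow (t + 1)) a 1) (𝓝[>] 0)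
      (𝓝 (0 * ((1 - 2 * (1 / 2) ^ (t + 1)) / ((t + 1) * (t + 1 - 1))))) :=
    (tendsto_rpow_zero (by linarith)).mul
      (tendsto_jensenBar_fPow_right_one (by linarith) (by linarith))
  have key := le_of_tendsto_of_tendsto hL hR (by
    filter_upwards [Ioo_mem_nhdsGT (one_pos (α := ℝ))] with a ha
    have ha0 := ha.1
    have := mul_jensenBar_le_of_le_lambdaMean ha.1 ha.2
      ((h a 1 ha.1 one_pos).trans (lambdaMean_monotone ha.1 one_pos hst))
    rw [jensenBar_fPow_right_one (by linarith) (by linarith)] at this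
    have hp : 0 < a ^ (-t - 1 / 2) := rpow_pos_of_pos ha0 _
    have h2 := mul_le_mul_of_nonneg_left this hp.le
    have e2 : a ^ (-t - 1 / 2) * a ^ (1 / 2 : ℝ) = a ^ (-t) := by
      rw [← rpow_add ha0]; ring_nf
    have e3 : a ^ (-t) * a ^ t = 1 := by
      rw [← rpow_add ha0]; simp
    have eG : meanG a 1 = a ^ (1 / 2 : ℝ) := by
      unfold meanG; rw [mul_one, sqrt_eq_rpow]
    rw [eG] at h2
    refine le_trans (le_of_eq ?_) h2
    linear_combination -(1 / (t * (t - 1)) * (a ^ t + (1 - 2 * ((a + 1) / 2) ^ t))) * e2 -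
      (1 / (t * (t - 1))) * e3)
  have h1 : 0 < t * (t - 1) := by nlinarith
  rw [zero_mul, zero_mul, add_zero] at key
  have : 0 < 1 / (t * (t - 1)) := by positivity
  linarith

/-- For s > 1 both defects have finite limits, and λ_s(0+, 1) = (s-1)(1 - 2^(-s)) / ((s+1)(1 -
2^(1-s))). -/
theorem limit_le_of_le_lambdaMean {M : ℝ → ℝ → ℝ} {s l : ℝ} (hs : 1 < s)
    (hM : Tendsto (fun a => M a 1) (𝓝[>] 0) (𝓝 l))
    (h : ∀ a b : ℝ, 0 < a → 0 < b → M a b ≤ lambdaMean s a b) :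
    l * (1 - 2 * (1 / 2) ^ s) * (s + 1) ≤ (1 - (1 / 2) ^ s) * (s - 1) := by
  have hL := hM.mul (tendsto_jensenBar_fPow_right_one (s := s) (by linarith) hs.ne')
  have hR := tendsto_jensenBar_fPow_right_one (s := s + 1) (by linarith) (by linarith)
  have key := le_of_tendsto_of_tendsto hL hR (by
    filter_upwards [Ioo_mem_nhdsGT (one_pos (α := ℝ))] with a ha
    exact mul_jensenBar_le_of_le_lambdaMean ha.1 ha.2 (h a 1 ha.1 one_pos))
  have h1 : 0 < s * (s - 1) := by nlinarith
  have h2 : 0 < (s + 1) * (s + 1 - 1) := by nlinarith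
  rw [rpow_add_one (by norm_num), ← mul_div_assoc, div_le_div_iff₀ h1 h2] at key
  have h3 : s * (l * (1 - 2 * (1 / 2) ^ s) * (s + 1)) ≤ s * ((1 - (1 / 2) ^ s) * (s - 1)) := by
    linarith
  exact le_of_mul_le_mul_left h3 (by linarith)

theorem not_meanS_le_lambdaMean (s : ℝ) :
    ¬ ∀ a b : ℝ, 0 < a → 0 < b → meanS a b ≤ lambdaMean s a b := by
  intro h
  have ht : 2 ≤ max s 2 := le_max_right _ _
  have h' : ∀ a b : ℝ, 0 < a → 0 < b → meanS a b ≤ lambdaMean (max s 2) a b := fun a b ha hb =>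
    (h a b ha hb).trans (lambdaMean_monotone ha hb (le_max_left _ _))
  generalize max s 2 = t at ht h'
  have hM : Tendsto (fun a => meanS a 1) (𝓝[>] 0) (𝓝 1) := by
    have : ContinuousAt (fun a : ℝ => exp (a * log a / (a + 1))) 0 :=
      (continuous_mul_log.continuousAt.div (by fun_prop) (by norm_num)).rexp
    have := this.tendsto.mono_left (nhdsWithin_le_nhds (s := Ioi 0))
    rw [zero_mul, zero_div, exp_zero] at this
    refine this.congr' ?_
    filter_upwards [self_mem_nhdsWithin] with a ha
    rw [meanS_eq ha one_pos, log_one, mul_zero, add_zero]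
  have key := limit_le_of_le_lambdaMean (by linarith) hM h'
  -- The limit inequality with l = 1 says 2 · 2^t ≤ t + 3, which Bernoulli's 1 + t ≤ 2^t contradicts
  -- for t ≥ 2.
  have hq := one_add_mul_self_le_rpow_one_add (s := 1) (by norm_num) (p := t) (by linarith)
  have e : (1 / 2 : ℝ) ^ t * (1 + 1) ^ t = 1 := by
    rw [← mul_rpow (by norm_num) (by norm_num)]; norm_num
  have hp : 0 < (1 / 2 : ℝ) ^ t := by positivity
  have := mul_le_mul_of_nonneg_left hq hp.le
  rw [e] at this
  nlinarith

theorem tendsto_meanI_right_one : Tendsto (fun a => meanI a 1) (𝓝[>] 0) (𝓝 (exp (-1))) := by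
  have : ContinuousAt (fun a : ℝ => exp (-(a * log a) / (1 - a) - 1)) 0 :=
    ((continuous_mul_log.continuousAt.neg.div (by fun_prop) (by norm_num)).sub
      continuousAt_const).rexp
  have := this.tendsto.mono_left (nhdsWithin_le_nhds (s := Ioi 0))
  rw [zero_mul, neg_zero, zero_div, zero_sub] at this
  refine this.congr' ?_
  filter_upwards [Ioo_mem_nhdsGT (one_pos (α := ℝ))] with a ha
  rw [meanI_of_ne ha.1 one_pos ha.2.ne, log_one, mul_zero, zero_sub]

/-- At s = 1.03 the limit of λ_s(a, 1) lies below the limit 1/e of I(a, 1) by only about 0.0014,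
hence the decimal bounds on log 2 and 1/e. -/
theorem not_meanI_le_lambdaMean :
    ¬ ∀ a b : ℝ, 0 < a → 0 < b → meanI a b ≤ lambdaMean 1.03 a b := by
  intro h
  have key := limit_le_of_le_lambdaMean (by norm_num) tendsto_meanI_right_one h
  have hr : (1 / 2 : ℝ) ^ (1.03 : ℝ) = exp (-(0.03 * log 2)) / 2 := by
    rw [rpow_def_of_pos (by norm_num), show log (1 / 2) * (1.03 : ℝ) = -(0.03 * log 2) - log 2 by
      rw [one_div, log_inv]; ring, exp_sub, exp_log (by norm_num)]
  have h1 := log_two_gt_d9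
  have h2 := log_two_lt_d9
  have he := exp_neg_one_gt_d9
  have hu' : exp (-(0.03 * log 2)) ≤ 0.979423 := by
    have h3 : 0.03 * log 2 ≤ 0.0207945 := by linarith
    have h4 : 0.020794 ≤ 0.03 * log 2 := by linarith
    have h5 := quadratic_le_exp_of_nonneg (x := 0.03 * log 2) (by positivity)
    have h6 : exp (-(0.03 * log 2)) * exp (0.03 * log 2) = 1 := by
      rw [← exp_add]; simp
    have h7 := exp_pos (-(0.03 * log 2))
    have h8 : (1.02101 : ℝ) ≤ exp (0.03 * log 2) := by nlinarith
    nlinarith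
  rw [hr] at key
  have h9 : (0.36787 : ℝ) * ((1 - 0.979423) * 2.03) ≤
      exp (-1) * ((1 - exp (-(0.03 * log 2))) * 2.03) := by
    refine mul_le_mul (by linarith) (by linarith) (by norm_num) (exp_pos _).le
  have h10 := exp_pos (-(0.03 * log 2))
  have h12 : (0.979 : ℝ) ≤ exp (-(0.03 * log 2)) := by
    have := add_one_le_exp (-(0.03 * log 2))
    linarith
  norm_num at key h9 ⊢
  nlinarith

end Boundary

/-! ### Continued-fraction bounds for u coth u. -/

section TanhBounds

open Real

theorem sinh_le_mul_cosh {u : ℝ} (hu : 0 ≤ u) : sinh u ≤ u * cosh u := by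
  rcases hu.eq_or_lt with rfl | hu
  · simp
  · have := one_le_mul_cosh_div_sinh hu
    rwa [le_div_iff₀ (sinh_pos_iff.2 hu), one_mul] at this

/-- In this chain the derivative of each difference is v times the preceding difference, so each
bound follows from its predecessor, starting from sinh u ≤ u cosh u. -/
theorem mul_cosh_le_sinh_one {u : ℝ} (hu : 0 ≤ u) : 3 * u * cosh u ≤ (3 + u ^ 2) * sinh u := by
  rw [← sub_nonneg]
  refine nonneg_of_hasDerivAt_nonneg (f := fun u => (3 + u ^ 2) * sinh u - 3 * u * cosh u)
    (f' := fun v => v * (v * cosh v - sinh v)) (by simp) (fun v _ => ?_) (fun v hv => ?_) hu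
  · refine (((((hasDerivAt_id v).fun_pow 2).const_add 3).mul (hasDerivAt_sinh v)).sub
      (((hasDerivAt_id v).const_mul 3).mul (hasDerivAt_cosh v))).congr_deriv ?_
    simp only [id]
    push_cast
    ring
  · exact mul_nonneg hv.le (sub_nonneg.2 (sinh_le_mul_cosh hv.le))

theorem sinh_mul_le_cosh_two {u : ℝ} (hu : 0 ≤ u) :
    (15 + 6 * u ^ 2) * sinh u ≤ (15 * u + u ^ 3) * cosh u := by
  rw [← sub_nonneg]
  refine nonneg_of_hasDerivAt_nonneg
    (f := fun u => (15 * u + u ^ 3) * cosh u - (15 + 6 * u ^ 2) * sinh u)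
    (f' := fun v => v * ((3 + v ^ 2) * sinh v - 3 * v * cosh v)) (by simp)
    (fun v _ => ?_) (fun v hv => ?_) hu
  · refine (((((hasDerivAt_id v).const_mul 15).add ((hasDerivAt_id v).fun_pow 3)).mul
      (hasDerivAt_cosh v)).sub (((((hasDerivAt_id v).fun_pow 2).const_mul 6).const_add 15).mul
      (hasDerivAt_sinh v))).congr_deriv ?_
    simp only [id, Pi.add_apply]
    push_cast
    ring
  · exact mul_nonneg hv.le (sub_nonneg.2 (mul_cosh_le_sinh_one hv.le))

/-- A continued fraction bound `u / tanh u ≤ (105 + 45 u² + u⁴) / (105 + 10 u²)`. -/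
theorem mul_cosh_le_sinh_three {u : ℝ} (hu : 0 ≤ u) :
    (105 * u + 10 * u ^ 3) * cosh u ≤ (105 + 45 * u ^ 2 + u ^ 4) * sinh u := by
  rw [← sub_nonneg]
  refine nonneg_of_hasDerivAt_nonneg
    (f := fun u => (105 + 45 * u ^ 2 + u ^ 4) * sinh u - (105 * u + 10 * u ^ 3) * cosh u)
    (f' := fun v => v * ((15 * v + v ^ 3) * cosh v - (15 + 6 * v ^ 2) * sinh v)) (by simp)
    (fun v _ => ?_) (fun v hv => ?_) hu
  · refine (((((((hasDerivAt_id v).fun_pow 2).const_mul 45).const_add 105).add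
      ((hasDerivAt_id v).fun_pow 4)).mul (hasDerivAt_sinh v)).sub
      ((((hasDerivAt_id v).const_mul 105).add (((hasDerivAt_id v).fun_pow 3).const_mul 10)).mul
      (hasDerivAt_cosh v))).congr_deriv ?_
    simp only [id, Pi.add_apply]
    push_cast
    ring
  · exact mul_nonneg hv.le (sub_nonneg.2 (sinh_mul_le_cosh_two hv.le))

/-- A continued fraction bound
`(945 + 420 u² + 15 u⁴) / (945 + 105 u² + u⁴) ≤ u / tanh u`. -/
theorem sinh_mul_le_cosh_four {u : ℝ} (hu : 0 ≤ u) :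
    (945 + 420 * u ^ 2 + 15 * u ^ 4) * sinh u ≤ (945 * u + 105 * u ^ 3 + u ^ 5) * cosh u := by
  rw [← sub_nonneg]
  refine nonneg_of_hasDerivAt_nonneg
    (f := fun u => (945 * u + 105 * u ^ 3 + u ^ 5) * cosh u -
      (945 + 420 * u ^ 2 + 15 * u ^ 4) * sinh u)
    (f' := fun v => v * ((105 + 45 * v ^ 2 + v ^ 4) * sinh v - (105 * v + 10 * v ^ 3) * cosh v))
    (by simp) (fun v _ => ?_) (fun v hv => ?_) hu
  · refine ((((((hasDerivAt_id v).const_mul 945).add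
      (((hasDerivAt_id v).fun_pow 3).const_mul 105)).add ((hasDerivAt_id v).fun_pow 5)).mul
      (hasDerivAt_cosh v)).sub ((((((hasDerivAt_id v).fun_pow 2).const_mul 420).const_add 945).add
      (((hasDerivAt_id v).fun_pow 4).const_mul 15)).mul (hasDerivAt_sinh v))).congr_deriv ?_
    simp only [id, Pi.add_apply]
    push_cast
    ring
  · exact mul_nonneg hv.le (sub_nonneg.2 (mul_cosh_le_sinh_three hv.le))

theorem cosh_mul_sub_cube_le {z : ℝ} (hz : 0 ≤ z) : cosh z * (z - z ^ 3 / 3) ≤ sinh z := by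
  rw [← sub_nonneg]
  refine nonneg_of_hasDerivAt_nonneg (f := fun z => sinh z - cosh z * (z - z ^ 3 / 3))
    (f' := fun z => z * (z * cosh z - sinh z) + z ^ 3 / 3 * sinh z) (by simp)
    (fun v _ => ?_) (fun v hv => ?_) hz
  · refine ((hasDerivAt_sinh v).sub ((hasDerivAt_cosh v).mul
      ((hasDerivAt_id v).sub (((hasDerivAt_id v).fun_pow 3).div_const 3)))).congr_deriv ?_
    simp only [id, Pi.sub_apply]
    push_cast
    ring
  · have h1 := sinh_le_mul_cosh hv.le
    have h2 := sinh_pos_iff.2 hv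
    exact add_nonneg (mul_nonneg hv.le (sub_nonneg.2 h1)) (by positivity)

end TanhBounds

/-! ### L ≤ λ_s at s = 227/2500 for u ≤ 3/2. -/

section LogarithmicSmall

open Real

/-- The polynomial inequality behind the monotonicity of the logarithmic comparison for small
arguments; `h` stands for `u / tanh u` and `U` for `u²`. -/
theorem logarithmic_poly_nonneg {h U : ℝ} (hU : 0 ≤ U) (hU' : U ≤ 9 / 4)
    (hh : (945 + 420 * U + 15 * U ^ 2) / (945 + 105 * U + U ^ 2) ≤ h) {s V : ℝ}
    (hs : s = 227 / 2500) (hV : V = (1 - s) * h + (1 + s)) :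
    (1 + s) * V ≤ (1 - s ^ 2 * U / 3) * (s * h * V ^ 2 +
      (1 - s) * h * ((1 - s) * (h ^ 2 - U) + (1 + s)) - s * (1 - s) * U * V) := by
  have hM : 0 < 945 + 105 * U + U ^ 2 := by positivity
  have h01 : 1 ≤ (945 + 420 * U + 15 * U ^ 2) / (945 + 105 * U + U ^ 2) := by
    rw [le_div_iff₀ hM]; nlinarith [sq_nonneg U]
  have base : ∀ k : ℝ, k = (945 + 420 * U + 15 * U ^ 2) / (945 + 105 * U + U ^ 2) →
      0 ≤ (1 - s ^ 2 * U / 3) * (s * k * ((1 - s) * k + (1 + s)) ^ 2 +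
        (1 - s) * k * ((1 - s) * (k ^ 2 - U) + (1 + s)) -
        s * (1 - s) * U * ((1 - s) * k + (1 + s))) - (1 + s) * ((1 - s) * k + (1 + s)) := by
    intro k hk
    have hw : 0 ≤ 9 / 4 - U := by linarith
    -- Bernstein form on [0, 9/4]: all coefficients in U and 9/4 - U are positive.
    have key : (1 - s ^ 2 * U / 3) * (s * k * ((1 - s) * k + (1 + s)) ^ 2 +
        (1 - s) * k * ((1 - s) * (k ^ 2 - U) + (1 + s)) -
        s * (1 - s) * U * ((1 - s) * k + (1 + s))) - (1 + s) * ((1 - s) * k + (1 + s)) =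
        U * (
      9151889076736 / 52734375 * (9 / 4 - U) ^ 7 +
        33268233424294288 / 32958984375 * U * (9 / 4 - U) ^ 6 +
        16844046732286355078 / 6866455078125 * U ^ 2 * (9 / 4 - U) ^ 5 +
        109938651357370665067 / 34332275390625 * U ^ 3 * (9 / 4 - U) ^ 4 +
        3284371983669481097267 / 1373291015625000 * U ^ 4 * (9 / 4 - U) ^ 3 +
        2736352903899984299539 / 2746582031250000 * U ^ 5 * (9 / 4 - U) ^ 2 +
        26698715277655983493109 / 131835937500000000 * U ^ 6 * (9 / 4 - U) +
        17015562981011267877281 / 1318359375000000000 * U ^ 7) / (945 + 105 * U + U ^ 2) ^ 3 := by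
      rw [hk, hs]
      field_simp
      ring
    rw [key]
    positivity
  have hb := base _ rfl
  set k := (945 + 420 * U + 15 * U ^ 2) / (945 + 105 * U + U ^ 2)
  -- This is the divided difference in h, between k and h, of the expression treated in `base`. Its
  -- sign lets h be replaced by its lower bound k.
  have hR : 0 ≤ (1 - s ^ 2 * U / 3) * ((1 - s) ^ 2 * (1 + s) * (h ^ 2 + h * k + k ^ 2 - U) +
      2 * s * (1 - s ^ 2) * (h + k) + s * (1 + s) ^ 2 + (1 - s ^ 2)) - (1 - s ^ 2) := by
    have hX : 3 / 4 ≤ h ^ 2 + h * k + k ^ 2 - U := by nlinarith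
    have ha : 99 / 100 ≤ 1 - s ^ 2 * U / 3 := by rw [hs]; linarith
    have hb : 6 / 5 ≤ (1 - s) ^ 2 * (1 + s) * (h ^ 2 + h * k + k ^ 2 - U) +
      2 * s * (1 - s ^ 2) * (h + k) + s * (1 + s) ^ 2 + (1 - s ^ 2) := by
      rw [hs]; nlinarith
    have := mul_le_mul ha hb (by norm_num) (by linarith)
    have : s ^ 2 = (227 / 2500) ^ 2 := by rw [hs]
    nlinarith
  have := mul_nonneg (sub_nonneg.2 hh) hR
  rw [hV, ← sub_nonneg]
  nlinarith

/-- This is the numerator of the derivative of log N - log V - s log cosh in `logarithmic_small`.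
The bound z - z³/3 ≤ tanh z at z = su removes the functions of su, and h = u coth u as variable
leaves `logarithmic_poly_nonneg`. -/
theorem logarithmic_deriv_nonneg {u : ℝ} (hu : 0 < u) (hu' : u ≤ 3 / 2) {s V : ℝ}
    (hs : s = 227 / 2500) (hV : V = (1 - s) * u * cosh u + (1 + s) * sinh u) :
    0 ≤ sinh (s * u) * (s * V ^ 2 * cosh u + (1 - s) * (sinh u + u * cosh u) * V * cosh u -
      (1 - s) * u * sinh u * (2 * cosh u + (1 - s) * u * sinh u) * cosh u -
      s * (1 - s) * u * sinh u ^ 2 * V) - cosh (s * u) * (s * (1 + s) * sinh u ^ 2 * V) := by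
  have hS := sinh_pos_iff.2 hu
  have hU : u ^ 2 ≤ 9 / 4 := by nlinarith
  obtain ⟨h, hh⟩ : ∃ h, h = u * cosh u / sinh u := ⟨_, rfl⟩
  have hc : cosh u = h * sinh u / u := by rw [hh]; field_simp
  have hhl : (945 + 420 * u ^ 2 + 15 * (u ^ 2) ^ 2) / (945 + 105 * u ^ 2 + (u ^ 2) ^ 2) ≤ h := by
    rw [hh, div_le_div_iff₀ (by positivity) hS]
    have := sinh_mul_le_cosh_four hu.le
    nlinarith
  have hW : V = sinh u * ((1 - s) * h + (1 + s)) := by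
    rw [hV, hc]; field_simp
  have key := logarithmic_poly_nonneg (sq_nonneg u) hU hhl hs rfl
  have hs0 : 0 < s := by rw [hs]; norm_num
  have hs1 : 0 < 1 - s := by rw [hs]; norm_num
  have hh1 : 1 ≤ h := by rw [hh]; exact one_le_mul_cosh_div_sinh hu
  set W := (1 - s) * h + (1 + s) with hWdef
  have hWpos : 0 < W := by positivity
  set B := s * h * W ^ 2 + (1 - s) * h * ((1 - s) * (h ^ 2 - u ^ 2) + (1 + s)) -
    s * (1 - s) * u ^ 2 * W with hB
  have hBR : s * V ^ 2 * cosh u + (1 - s) * (sinh u + u * cosh u) * V * cosh u -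
      (1 - s) * u * sinh u * (2 * cosh u + (1 - s) * u * sinh u) * cosh u -
      s * (1 - s) * u * sinh u ^ 2 * V = sinh u ^ 3 / u * B := by
    rw [hB, hW, hc, hWdef]
    field_simp
    ring
  have ha : 0 < 1 - s ^ 2 * u ^ 2 / 3 := by rw [hs]; linarith
  have hB0 : 0 ≤ B := by
    have : 0 ≤ (1 - s ^ 2 * u ^ 2 / 3) * B := le_trans (by positivity) key
    exact nonneg_of_mul_nonneg_right this ha
  have ht := cosh_mul_sub_cube_le (mul_pos hs0 hu).le
  have hC := cosh_pos (s * u)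
  rw [hBR, hW]
  have h1 := mul_le_mul_of_nonneg_right ht (show 0 ≤ sinh u ^ 3 / u * B by positivity)
  have h2 := mul_le_mul_of_nonneg_left key (show 0 ≤ cosh (s * u) * sinh u ^ 3 * s by positivity)
  have e : cosh (s * u) * (s * u - (s * u) ^ 3 / 3) * (sinh u ^ 3 / u * B) =
      cosh (s * u) * sinh u ^ 3 * s * ((1 - s ^ 2 * u ^ 2 / 3) * B) := by
    field_simp
  rw [e] at h1
  linarith

theorem hasDerivAt_sinh_mul (s u : ℝ) :
    HasDerivAt (fun u => sinh (s * u)) (s * cosh (s * u)) u := by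
  refine (((hasDerivAt_id u).const_mul s).sinh).congr_deriv ?_
  simp only [id]
  ring

theorem hasDerivAt_cosh_mul (s u : ℝ) :
    HasDerivAt (fun u => cosh (s * u)) (s * sinh (s * u)) u := by
  refine (((hasDerivAt_id u).const_mul s).cosh).congr_deriv ?_
  simp only [id]
  ring

theorem tendsto_const_mul_log_cosh (k : ℝ) :
    Tendsto (fun u => k * log (cosh u)) (𝓝[>] 0) (𝓝 0) := by
  have h : ContinuousAt (fun u => k * log (cosh u)) 0 :=
    continuousAt_const.mul (hasDerivAt_log_cosh 0).continuousAt
  have := h.tendsto.mono_left (nhdsWithin_le_nhds (s := Ioi 0))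
  rwa [cosh_zero, log_one, mul_zero] at this

theorem logarithmic_small {u : ℝ} (hu : 0 < u) (hu' : u ≤ 3 / 2) {s : ℝ} (hs : s = 227 / 2500) :
    cosh u ^ s * ((1 - s) * u * cosh u + (1 + s) * sinh u) ≤
      cosh (s * u) * ((1 - s) * u * cosh u + (1 + s) * sinh u) +
        (1 - s) * u * sinh u * sinh (s * u) := by
  have hs0 : 0 < s := by rw [hs]; norm_num
  have hs1 : 0 < 1 - s := by rw [hs]; norm_num
  have hV : ∀ v, 0 < v → 0 < (1 - s) * v * cosh v + (1 + s) * sinh v := fun v hv => by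
    have := sinh_pos_iff.2 hv
    have := cosh_pos v
    positivity
  have hN : ∀ v, 0 < v → 0 < cosh (s * v) * ((1 - s) * v * cosh v + (1 + s) * sinh v) +
        (1 - s) * v * sinh v * sinh (s * v) := fun v hv => by
    have := hV v hv
    have := sinh_pos_iff.2 hv
    have := sinh_pos_iff.2 (mul_pos hs0 hv)
    have := cosh_pos (s * v)
    positivity
  have dV : ∀ v, HasDerivAt (fun v => (1 - s) * v * cosh v + (1 + s) * sinh v)
      (2 * cosh v + (1 - s) * v * sinh v) v := by
    intro v
    refine ((((hasDerivAt_id v).const_mul (1 - s)).mul (hasDerivAt_cosh v)).add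
      ((hasDerivAt_sinh v).const_mul (1 + s))).congr_deriv ?_
    simp only [id]
    ring
  have dN : ∀ v, HasDerivAt (fun v => cosh (s * v) * ((1 - s) * v * cosh v + (1 + s) * sinh v) +
        (1 - s) * v * sinh v * sinh (s * v))
      (s * sinh (s * v) * ((1 - s) * v * cosh v + (1 + s) * sinh v) +
        cosh (s * v) * (2 * cosh v + (1 - s) * v * sinh v) +
        (1 - s) * (sinh v * sinh (s * v) + v * cosh v * sinh (s * v) +
          v * sinh v * (s * cosh (s * v)))) v := by
    intro v
    refine (((hasDerivAt_cosh_mul s v).mul (dV v)).add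
      ((((hasDerivAt_id v).const_mul (1 - s)).mul (hasDerivAt_sinh v)).mul
      (hasDerivAt_sinh_mul s v))).congr_deriv ?_
    simp only [id, Pi.mul_apply]
    ring
  -- The logarithm of N / (V cosh^s) is increasing, and near 0 it is at least -s log cosh, because N
  -- ≥ V.
  have key := nonneg_of_hasDerivAt_of_tendsto hu
    (fun v hv _ => (((dN v).log (hN v hv).ne').sub ((dV v).log (hV v hv).ne')).sub
      ((hasDerivAt_log_cosh v).const_mul s)) ?_ (tendsto_const_mul_log_cosh (-s)) ?_
  · simp only [Pi.sub_apply] at key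
    have h1 := hV u hu
    have h2 := hN u hu
    have hc := cosh_pos u
    rw [← log_le_log_iff (by positivity) h2, log_mul (by positivity) h1.ne', log_rpow hc]
    linarith
  · intro v hv hvu
    have hd := logarithmic_deriv_nonneg hv (hvu.le.trans hu') hs rfl
    have h1 := hV v hv
    have h2 := hN v hv
    have hc := cosh_pos v
    have combine : ∀ N N' V V' c d : ℝ, 0 < N → 0 < V → 0 < c →
        0 ≤ N' * V * c - N * V' * c - s * d * N * V → 0 ≤ N' / N - V' / V - s * (d / c) := by
      intro N N' V V' c d hN hV hc h
      have e : N' / N - V' / V - s * (d / c) =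
          (N' * V * c - N * V' * c - s * d * N * V) / (N * V * c) := by field_simp
      rw [e]
      positivity
    refine combine _ _ _ _ _ _ h2 h1 hc (hd.trans_eq ?_)
    ring
  · filter_upwards [self_mem_nhdsWithin] with v hv
    have hv : 0 < v := hv
    have h1 := hV v hv
    have hle : log ((1 - s) * v * cosh v + (1 + s) * sinh v) ≤
        log (cosh (s * v) * ((1 - s) * v * cosh v + (1 + s) * sinh v) +
        (1 - s) * v * sinh v * sinh (s * v)) := by
      refine log_le_log h1 ?_
      have h3 := le_mul_of_one_le_left h1.le (one_le_cosh (s * v))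
      have := sinh_pos_iff.2 hv
      have := sinh_pos_iff.2 (mul_pos hs0 hv)
      have : 0 ≤ (1 - s) * v * sinh v * sinh (s * v) := by positivity
      linarith
    simp only [Pi.sub_apply]
    linarith

end LogarithmicSmall

/-! ### Alternating Taylor bounds for e^(-z). -/

section ExpNeg
open Real

/-- Each signed remainder vanishes at 0 and has the previous one as its derivative. -/
theorem alternating_exp_neg (n : ℕ) : ∀ z : ℝ, 0 ≤ z →
    0 ≤ (-1) ^ n * (exp (-z) - ∑ i ∈ Finset.range n, (-z) ^ i / i.factorial) := by
  induction n with
  | zero => intro z _; simp [exp_nonneg]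
  | succ n ih =>
    intro z hz
    refine nonneg_of_hasDerivAt_nonneg
      (f := fun z => (-1) ^ (n + 1) *
        (exp (-z) - ∑ i ∈ Finset.range (n + 1), (-z) ^ i / i.factorial))
      (f' := fun z => (-1) ^ n * (exp (-z) - ∑ i ∈ Finset.range n, (-z) ^ i / i.factorial))
      ?_ (fun x _ => ?_) (fun x hx => ih x hx.le) hz
    · simp [Finset.sum_range_succ']
    · have hs : HasDerivAt (fun z : ℝ => ∑ i ∈ Finset.range (n + 1), (-z) ^ i / i.factorial)
          (∑ i ∈ Finset.range (n + 1), (i * (-x) ^ (i - 1) * (-1)) / i.factorial) x :=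
        HasDerivAt.fun_sum fun i _ => ((hasDerivAt_neg x).fun_pow i).div_const _
      refine ((((hasDerivAt_neg x).exp).sub hs).const_mul ((-1) ^ (n + 1))).congr_deriv ?_
      have e : ∑ i ∈ Finset.range (n + 1), ((i : ℝ) * (-x) ^ (i - 1) * (-1)) / i.factorial =
          -∑ i ∈ Finset.range n, (-x) ^ i / i.factorial := by
        rw [Finset.sum_range_succ', ← Finset.sum_neg_distrib]
        simp only [Nat.cast_zero, zero_mul, zero_div, add_zero]
        refine Finset.sum_congr rfl fun i _ => ?_
        rw [Nat.factorial_succ]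
        have : (i.factorial : ℝ) ≠ 0 := by positivity
        push_cast
        field_simp
      rw [e]
      ring

theorem exp_neg_le_quartic {z : ℝ} (hz : 0 ≤ z) :
    exp (-z) ≤ 1 - z + z ^ 2 / 2 - z ^ 3 / 6 + z ^ 4 / 24 := by
  have := alternating_exp_neg 5 z hz
  simp only [Finset.sum_range_succ, Finset.sum_range_zero, Nat.factorial] at this
  norm_num at this
  linarith

theorem exp_neg_le_sextic {z : ℝ} (hz : 0 ≤ z) :
    exp (-z) ≤ 1 - z + z ^ 2 / 2 - z ^ 3 / 6 + z ^ 4 / 24 - z ^ 5 / 120 + z ^ 6 / 720 := by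
  have := alternating_exp_neg 7 z hz
  simp only [Finset.sum_range_succ, Finset.sum_range_zero, Nat.factorial] at this
  norm_num at this
  linarith

theorem cubic_le_exp_neg {z : ℝ} (hz : 0 ≤ z) :
    1 - z + z ^ 2 / 2 - z ^ 3 / 6 ≤ exp (-z) := by
  have := alternating_exp_neg 4 z hz
  simp only [Finset.sum_range_succ, Finset.sum_range_zero, Nat.factorial] at this
  norm_num at this
  linarith

theorem septic_le_exp_neg {z : ℝ} (hz : 0 ≤ z) :
    1 - z + z ^ 2 / 2 - z ^ 3 / 6 + z ^ 4 / 24 - z ^ 5 / 120 + z ^ 6 / 720 - z ^ 7 / 5040 ≤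
      exp (-z) := by
  have := alternating_exp_neg 8 z hz
  simp only [Finset.sum_range_succ, Finset.sum_range_zero, Nat.factorial] at this
  norm_num at this
  linarith

theorem exp_neg_natCast_le (n : ℕ) : exp (-(n : ℝ)) ≤ 0.3678794412 ^ n := by
  have : exp (-(n : ℝ)) = exp (-1) ^ n := by
    rw [← exp_nat_mul]
    ring_nf
  rw [this]
  exact pow_le_pow_left₀ (exp_nonneg _) exp_neg_one_lt_d9.le n

end ExpNeg

/-! ### L ≤ λ_s at s = 227/2500 for u ≥ 3/2. -/

section LogarithmicLarge
open Real

theorem cosh_rpow_eq (s u : ℝ) :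
    cosh u ^ s = exp (s * u) * (2 ^ (-s) * (1 + exp (-2 * u)) ^ s) := by
  have e : cosh u = exp u * (2⁻¹ * (1 + exp (-2 * u))) := by
    rw [cosh_eq, show -2 * u = -u + -u by ring, exp_add, exp_neg]
    field_simp
  rw [e, mul_rpow (by positivity) (by positivity), mul_rpow (by norm_num) (by positivity),
    ← exp_mul, inv_rpow (by norm_num), rpow_neg (by norm_num), mul_comm u s]

theorem cosh_eq_exp_mul (u : ℝ) : cosh u = exp u * ((1 + exp (-2 * u)) / 2) := by
  rw [cosh_eq, show -2 * u = -u + -u by ring, exp_add, exp_neg]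
  field_simp

theorem sinh_eq_exp_mul (u : ℝ) : sinh u = exp u * ((1 - exp (-2 * u)) / 2) := by
  rw [sinh_eq, show -2 * u = -u + -u by ring, exp_add, exp_neg]
  field_simp

theorem two_rpow_neg_le : (2 : ℝ) ^ (-(227 / 2500) : ℝ) ≤ 469501 / 500000 := by
  rw [rpow_def_of_pos (by norm_num)]
  have h1 : log 2 * -(227 / 2500) ≤ -(0.0629377 : ℝ) := by
    have := log_two_gt_d9
    linarith
  refine (exp_le_exp.2 h1).trans ((exp_neg_le_quartic (by norm_num)).trans ?_)
  norm_num

/-- The factor e^(su) e^u / 2 cancels. Then 2^(-s) is replaced by a rational upper bound and (1 +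
y)^s by Bernoulli's 1 + sy, which leaves an inequality polynomial in u, y and E. -/
theorem logarithmic_of_exp_bound {u : ℝ} (hu : 0 < u) {s y E p : ℝ} (hs : s = 227 / 2500)
    (hy : y = exp (-2 * u)) (hE : E = exp (-2 * (s * u))) (hp : p = (1 - s) * u)
    (h : 469501 / 500000 * (1 + s * y) * (p * (1 + y) + (1 + s) * (1 - y)) ≤
      p * (1 + E * y) + (1 + s) * (1 - y) * (1 + E) / 2) :
    cosh u ^ s * ((1 - s) * u * cosh u + (1 + s) * sinh u) ≤
      cosh (s * u) * ((1 - s) * u * cosh u + (1 + s) * sinh u) +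
        (1 - s) * u * sinh u * sinh (s * u) := by
  rw [cosh_rpow_eq, cosh_eq_exp_mul u, sinh_eq_exp_mul u, cosh_eq_exp_mul (s * u),
    sinh_eq_exp_mul (s * u), ← hy, ← hE, ← hp]
  have hy0 : 0 < y := by rw [hy]; positivity
  have hy1 : y < 1 := by rw [hy, exp_lt_one_iff]; linarith
  have hs0 : 0 < s := by rw [hs]; norm_num
  have hp0 : 0 < p := by
    rw [hp, hs]
    linarith
  have hW : 0 < p * (1 + y) + (1 + s) * (1 - y) := by
    have : 0 < 1 - y := by linarith
    positivity
  have hb : (1 + y) ^ s ≤ 1 + s * y :=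
    rpow_one_add_le_one_add_mul_self (by linarith) hs0.le (by rw [hs]; norm_num)
  have ht : (2 : ℝ) ^ (-s) ≤ 469501 / 500000 := by
    have := two_rpow_neg_le
    rwa [hs]
  have h1 : 2 ^ (-s) * (1 + y) ^ s ≤ 469501 / 500000 * (1 + s * y) :=
    mul_le_mul ht hb (by positivity) (by norm_num)
  have h2 := (mul_le_mul_of_nonneg_right h1 hW.le).trans h
  have h3 := mul_le_mul_of_nonneg_left h2 (show 0 ≤ exp (s * u) * exp u / 2 by positivity)
  refine le_trans (le_of_eq ?_) (h3.trans (le_of_eq ?_)) <;> ring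

/-- Once y² is weakened to yY, the difference of the two sides is nondecreasing in E and, at E = e,
nonincreasing in y; so z above y and e below E are the worst case. -/
theorem exp_bound_of_le {s u p y z Y E e : ℝ} (hs : s = 227 / 2500) (hp : p = (1 - s) * u)
    (hu : 3 / 2 ≤ u) (hy : 0 ≤ y) (hyz : y ≤ z) (hyY : y ≤ Y) (he : e ≤ E)
    (hE : E ≤ 1)
    (h : 0 ≤ p + (1 + s) * (1 + e) / 2 - 469501 / 500000 * (p + (1 + s)) +
      z * (p * e - (1 + s) * (1 + e) / 2 - 469501 / 500000 * (p - (1 + s) + s * (p + (1 + s))) -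
        469501 / 500000 * s * Y * (p - (1 + s)))) :
    469501 / 500000 * (1 + s * y) * (p * (1 + y) + (1 + s) * (1 - y)) ≤
      p * (1 + E * y) + (1 + s) * (1 - y) * (1 + E) / 2 := by
  have hp1 : 1.36 ≤ p := by rw [hp, hs]; linarith
  have hY0 : 0 ≤ Y := hy.trans hyY
  have hc : p * e - (1 + s) * (1 + e) / 2 -
      469501 / 500000 * (p - (1 + s) + s * (p + (1 + s))) -
        469501 / 500000 * s * Y * (p - (1 + s)) ≤ 0 := by
    have h1 : (1 - e) * (p - (1 + s) / 2) ≥ 0 :=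
      mul_nonneg (by linarith) (by rw [hs]; linarith)
    have h2 : 469501 / 500000 * s * Y * (p - (1 + s)) ≥ 0 :=
      mul_nonneg (by rw [hs]; positivity) (by rw [hs]; linarith)
    rw [hs] at *
    linarith
  have h1 := mul_nonneg_of_nonpos_of_nonpos (sub_nonpos.2 hyz) hc
  have h2 : 0 ≤ (E - e) * ((1 + s) / 2 + y * (p - (1 + s) / 2)) := by
    refine mul_nonneg (by linarith) (add_nonneg (by rw [hs]; norm_num) (mul_nonneg hy ?_))
    rw [hs]
    linarith
  have h3 : 0 ≤ 469501 / 500000 * s * (p - (1 + s)) * (y * (Y - y)) := by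
    refine mul_nonneg (mul_nonneg (by rw [hs]; norm_num) ?_) (mul_nonneg hy (by linarith))
    rw [hs]
    linarith
  linarith

/-- On each bounded piece y and E are expanded at the left end by alternating Taylor bounds. The
resulting polynomial in u has positive Bernstein coefficients in the distances v and w to the two
ends. -/
theorem logarithmic_exp_bound_three_halves {u : ℝ} (hu : 3/2 ≤ u) (hu' : u ≤ 2) {s y E p : ℝ}
    (hs : s = 227 / 2500) (hy : y = exp (-2 * u)) (hE : E = exp (-2 * (s * u)))
    (hp : p = (1 - s) * u) :
    469501 / 500000 * (1 + s * y) * (p * (1 + y) + (1 + s) * (1 - y)) ≤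
      p * (1 + E * y) + (1 + s) * (1 - y) * (1 + E) / 2 := by
  obtain ⟨v, hv⟩ : ∃ v, v = u - 3/2 := ⟨_, rfl⟩
  obtain ⟨w, hw⟩ : ∃ w, w = 2 - u := ⟨_, rfl⟩
  have hv0 : 0 ≤ v := by linarith
  have hw0 : 0 ≤ w := by linarith
  have huv : u = 3/2 + v := by linarith
  have hwv : w = 1/2 - v := by linarith
  have hs0 : 0 < s := by rw [hs]; norm_num
  have hY : exp (-((3 : ℕ) : ℝ)) ≤ 12447/250000 :=
    (exp_neg_natCast_le 3).trans (by norm_num)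
  have hY' : y ≤ 12447/250000 := by
    rw [hy]
    refine le_trans (exp_le_exp.2 ?_) hY
    push_cast
    linarith
  have hyz : y ≤ 12447/250000 * (1 - 2 * v + (2 * v) ^ 2 / 2 - (2 * v) ^ 3 / 6 + (2 * v) ^ 4 / 24) := by
    have e : -2 * u = -((3 : ℕ) : ℝ) + -(2 * v) := by push_cast; linarith
    rw [hy, e, exp_add]
    exact mul_le_mul hY (exp_neg_le_quartic (by linarith)) (exp_nonneg _) (by norm_num)
  have hE0 : 1523/2000 ≤ exp (-(681 / 2500 : ℝ)) :=
    le_trans (by norm_num) (septic_le_exp_neg (by norm_num))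
  have hEe : 1523/2000 * (1 - 2 * (s * v) + (2 * (s * v)) ^ 2 / 2 - (2 * (s * v)) ^ 3 / 6) ≤ E := by
    have e : -2 * (s * u) = -(681 / 2500 : ℝ) + -(2 * (s * v)) := by
      rw [huv, hs]; ring
    rw [hE, e, exp_add]
    exact (mul_le_mul_of_nonneg_left (cubic_le_exp_neg (by positivity)) (by norm_num)).trans
      (mul_le_mul_of_nonneg_right hE0 (exp_nonneg _))
  have hE1 : E ≤ 1 := by
    rw [hE, exp_le_one_iff]
    have : 0 ≤ s * u := by positivity
    linarith
  refine exp_bound_of_le hs hp (by linarith) (hy ▸ exp_nonneg _) hyz hY' hEe hE1 ?_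
  have key : 0 ≤
      21983061326869337961 / 305175781250000000000 * w ^ 8 +
        271012279360321620149 / 381469726562500000000 * v * w ^ 7 +
        8593745803741241185147 / 3051757812500000000000 * v ^ 2 * w ^ 6 +
        4634519275820141986329 / 762939453125000000000 * v ^ 3 * w ^ 5 +
        96749198771877330574727 / 12207031250000000000000 * v ^ 4 * w ^ 4 +
        15677619922593328072411 / 2441406250000000000000 * v ^ 5 * w ^ 3 +
        37841196977808339438051 / 12207031250000000000000 * v ^ 6 * w ^ 2 +
        9340943755068915522697 / 12207031250000000000000 * v ^ 7 * w +
        708763295829561345823 / 12207031250000000000000 * v ^ 8 := by positivity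
  refine key.trans_eq ?_
  rw [hwv, hp, huv, hs]
  ring

theorem logarithmic_exp_bound_two {u : ℝ} (hu : 2 ≤ u) (hu' : u ≤ 5/2) {s y E p : ℝ}
    (hs : s = 227 / 2500) (hy : y = exp (-2 * u)) (hE : E = exp (-2 * (s * u)))
    (hp : p = (1 - s) * u) :
    469501 / 500000 * (1 + s * y) * (p * (1 + y) + (1 + s) * (1 - y)) ≤
      p * (1 + E * y) + (1 + s) * (1 - y) * (1 + E) / 2 := by
  obtain ⟨v, hv⟩ : ∃ v, v = u - 2 := ⟨_, rfl⟩
  obtain ⟨w, hw⟩ : ∃ w, w = 5/2 - u := ⟨_, rfl⟩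
  have hv0 : 0 ≤ v := by linarith
  have hw0 : 0 ≤ w := by linarith
  have huv : u = 2 + v := by linarith
  have hwv : w = 1/2 - v := by linarith
  have hs0 : 0 < s := by rw [hs]; norm_num
  have hY : exp (-((4 : ℕ) : ℝ)) ≤ 4579/250000 :=
    (exp_neg_natCast_le 4).trans (by norm_num)
  have hY' : y ≤ 4579/250000 := by
    rw [hy]
    refine le_trans (exp_le_exp.2 ?_) hY
    push_cast
    linarith
  have hyz : y ≤ 4579/250000 * (1 - 2 * v + (2 * v) ^ 2 / 2 - (2 * v) ^ 3 / 6 + (2 * v) ^ 4 / 24) := by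
    have e : -2 * u = -((4 : ℕ) : ℝ) + -(2 * v) := by push_cast; linarith
    rw [hy, e, exp_add]
    exact mul_le_mul hY (exp_neg_le_quartic (by linarith)) (exp_nonneg _) (by norm_num)
  have hE0 : 3477/5000 ≤ exp (-(227 / 625 : ℝ)) :=
    le_trans (by norm_num) (septic_le_exp_neg (by norm_num))
  have hEe : 3477/5000 * (1 - 2 * (s * v) + (2 * (s * v)) ^ 2 / 2 - (2 * (s * v)) ^ 3 / 6) ≤ E := by
    have e : -2 * (s * u) = -(227 / 625 : ℝ) + -(2 * (s * v)) := by
      rw [huv, hs]; ring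
    rw [hE, e, exp_add]
    exact (mul_le_mul_of_nonneg_left (cubic_le_exp_neg (by positivity)) (by norm_num)).trans
      (mul_le_mul_of_nonneg_right hE0 (exp_nonneg _))
  have hE1 : E ≤ 1 := by
    rw [hE, exp_le_one_iff]
    have : 0 ≤ s * u := by positivity
    linarith
  refine exp_bound_of_le hs hp (by linarith) (hy ▸ exp_nonneg _) hyz hY' hEe hE1 ?_
  have key : 0 ≤
      92451813290717373467 / 762939453125000000000 * w ^ 8 +
        1448582864174205508027 / 1525878906250000000000 * v * w ^ 7 +
        984859068525455702203 / 305175781250000000000 * v ^ 2 * w ^ 6 +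
        11437355139393966234911 / 1831054687500000000000 * v ^ 3 * w ^ 5 +
        138578842808405411325223 / 18310546875000000000000 * v ^ 4 * w ^ 4 +
        71899588003258283388187 / 12207031250000000000000 * v ^ 5 * w ^ 3 +
        34829541990179499381317 / 12207031250000000000000 * v ^ 6 * w ^ 2 +
        9341318448323201604819 / 12207031250000000000000 * v ^ 7 * w +
        197896122119976064021 / 2441406250000000000000 * v ^ 8 := by positivity
  refine key.trans_eq ?_
  rw [hwv, hp, huv, hs]
  ring

theorem logarithmic_exp_bound_five_halves {u : ℝ} (hu : 5/2 ≤ u) (hu' : u ≤ 3) {s y E p : ℝ}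
    (hs : s = 227 / 2500) (hy : y = exp (-2 * u)) (hE : E = exp (-2 * (s * u)))
    (hp : p = (1 - s) * u) :
    469501 / 500000 * (1 + s * y) * (p * (1 + y) + (1 + s) * (1 - y)) ≤
      p * (1 + E * y) + (1 + s) * (1 - y) * (1 + E) / 2 := by
  obtain ⟨v, hv⟩ : ∃ v, v = u - 5/2 := ⟨_, rfl⟩
  obtain ⟨w, hw⟩ : ∃ w, w = 3 - u := ⟨_, rfl⟩
  have hv0 : 0 ≤ v := by linarith
  have hw0 : 0 ≤ w := by linarith
  have huv : u = 5/2 + v := by linarith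
  have hwv : w = 1/2 - v := by linarith
  have hs0 : 0 < s := by rw [hs]; norm_num
  have hY : exp (-((5 : ℕ) : ℝ)) ≤ 3369/500000 :=
    (exp_neg_natCast_le 5).trans (by norm_num)
  have hY' : y ≤ 3369/500000 := by
    rw [hy]
    refine le_trans (exp_le_exp.2 ?_) hY
    push_cast
    linarith
  have hyz : y ≤ 3369/500000 * (1 - 2 * v + (2 * v) ^ 2 / 2 - (2 * v) ^ 3 / 6 + (2 * v) ^ 4 / 24) := by
    have e : -2 * u = -((5 : ℕ) : ℝ) + -(2 * v) := by push_cast; linarith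
    rw [hy, e, exp_add]
    exact mul_le_mul hY (exp_neg_le_quartic (by linarith)) (exp_nonneg _) (by norm_num)
  have hE0 : 127/200 ≤ exp (-(227 / 500 : ℝ)) :=
    le_trans (by norm_num) (septic_le_exp_neg (by norm_num))
  have hEe : 127/200 * (1 - 2 * (s * v) + (2 * (s * v)) ^ 2 / 2 - (2 * (s * v)) ^ 3 / 6) ≤ E := by
    have e : -2 * (s * u) = -(227 / 500 : ℝ) + -(2 * (s * v)) := by
      rw [huv, hs]; ring
    rw [hE, e, exp_add]
    exact (mul_le_mul_of_nonneg_left (cubic_le_exp_neg (by positivity)) (by norm_num)).trans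
      (mul_le_mul_of_nonneg_right hE0 (exp_nonneg _))
  have hE1 : E ≤ 1 := by
    rw [hE, exp_le_one_iff]
    have : 0 ≤ s * u := by positivity
    linarith
  refine exp_bound_of_le hs hp (by linarith) (hy ▸ exp_nonneg _) hyz hY' hEe hE1 ?_
  have key : 0 ≤
      647038547527150189183 / 6103515625000000000000 * w ^ 8 +
        107204388002109659969 / 122070312500000000000 * v * w ^ 7 +
        39736527503534251224897 / 12207031250000000000000 * v ^ 2 * w ^ 6 +
        43078163510911553113643 / 6103515625000000000000 * v ^ 3 * w ^ 5 +
        477366895183711582795589 / 48828125000000000000000 * v ^ 4 * w ^ 4 +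
        430528879085567539512983 / 48828125000000000000000 * v ^ 5 * w ^ 3 +
        734803519479810529163729 / 146484375000000000000000 * v ^ 6 * w ^ 2 +
        79542458131077431799613 / 48828125000000000000000 * v ^ 7 * w +
        2788613508932071684539 / 12207031250000000000000 * v ^ 8 := by positivity
  refine key.trans_eq ?_
  rw [hwv, hp, huv, hs]
  ring

theorem logarithmic_exp_bound_three {u : ℝ} (hu : 3 ≤ u) (hu' : u ≤ 4) {s y E p : ℝ}
    (hs : s = 227 / 2500) (hy : y = exp (-2 * u)) (hE : E = exp (-2 * (s * u)))
    (hp : p = (1 - s) * u) :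
    469501 / 500000 * (1 + s * y) * (p * (1 + y) + (1 + s) * (1 - y)) ≤
      p * (1 + E * y) + (1 + s) * (1 - y) * (1 + E) / 2 := by
  obtain ⟨v, hv⟩ : ∃ v, v = u - 3 := ⟨_, rfl⟩
  obtain ⟨w, hw⟩ : ∃ w, w = 4 - u := ⟨_, rfl⟩
  have hv0 : 0 ≤ v := by linarith
  have hw0 : 0 ≤ w := by linarith
  have huv : u = 3 + v := by linarith
  have hwv : w = 1 - v := by linarith
  have hs0 : 0 < s := by rw [hs]; norm_num
  have hY : exp (-((6 : ℕ) : ℝ)) ≤ 2479/1000000 :=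
    (exp_neg_natCast_le 6).trans (by norm_num)
  have hY' : y ≤ 2479/1000000 := by
    rw [hy]
    refine le_trans (exp_le_exp.2 ?_) hY
    push_cast
    linarith
  -- On this piece of length 1 the exponent 2v reaches 2, so degree six replaces degree four.
  have hyz : y ≤ 2479/1000000 * (1 - 2 * v + (2 * v) ^ 2 / 2 - (2 * v) ^ 3 / 6 + (2 * v) ^ 4 / 24 -
      (2 * v) ^ 5 / 120 + (2 * v) ^ 6 / 720) := by
    have e : -2 * u = -((6 : ℕ) : ℝ) + -(2 * v) := by push_cast; linarith
    rw [hy, e, exp_add]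
    exact mul_le_mul hY (exp_neg_le_sextic (by linarith)) (exp_nonneg _) (by norm_num)
  have hE0 : 5799/10000 ≤ exp (-(681 / 1250 : ℝ)) :=
    le_trans (by norm_num) (septic_le_exp_neg (by norm_num))
  have hEe : 5799/10000 * (1 - 2 * (s * v) + (2 * (s * v)) ^ 2 / 2 - (2 * (s * v)) ^ 3 / 6) ≤ E := by
    have e : -2 * (s * u) = -(681 / 1250 : ℝ) + -(2 * (s * v)) := by
      rw [huv, hs]; ring
    rw [hE, e, exp_add]
    exact (mul_le_mul_of_nonneg_left (cubic_le_exp_neg (by positivity)) (by norm_num)).trans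
      (mul_le_mul_of_nonneg_right hE0 (exp_nonneg _))
  have hE1 : E ≤ 1 := by
    rw [hE, exp_le_one_iff]
    have : 0 ≤ s * u := by positivity
    linarith
  refine exp_bound_of_le hs hp (by linarith) (hy ▸ exp_nonneg _) hyz hY' hEe hE1 ?_
  have key : 0 ≤
      749375314801350606039 / 781250000000000000000000 * w ^ 10 +
        36592883016726100990537 / 3125000000000000000000000 * v * w ^ 9 +
        202282625812478933461547 / 3125000000000000000000000 * v ^ 2 * w ^ 8 +
        331414792574595939863139 / 1562500000000000000000000 * v ^ 3 * w ^ 7 +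
        2129381691596286301746389 / 4687500000000000000000000 * v ^ 4 * w ^ 6 +
        15529370682467451510032533 / 23437500000000000000000000 * v ^ 5 * w ^ 5 +
        15597207907262133708568901 / 23437500000000000000000000 * v ^ 6 * w ^ 4 +
        6385007941449071863780061 / 14062500000000000000000000 * v ^ 7 * w ^ 3 +
        4716079952942913519870941 / 23437500000000000000000000 * v ^ 8 * w ^ 2 +
        2447586026435076913739183 / 46875000000000000000000000 * v ^ 9 * w +
        93808080102556412624379 / 15625000000000000000000000 * v ^ 10 := by positivity
  refine key.trans_eq ?_
  rw [hwv, hp, huv, hs]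
  ring

/-- On the tail y and uy are bounded by small constants and E by a line. The loss in slope, s(1+s) ·
0.4836 ≈ 0.048, is less than the gain (1-s)(1 - 469501/500000) ≈ 0.055, so linear estimates suffice.
-/
theorem logarithmic_exp_bound_four {u : ℝ} (hu : 4 ≤ u) {s y E p : ℝ}
    (hs : s = 227 / 2500) (hy : y = exp (-2 * u)) (hE : E = exp (-2 * (s * u)))
    (hp : p = (1 - s) * u) :
    469501 / 500000 * (1 + s * y) * (p * (1 + y) + (1 + s) * (1 - y)) ≤
      p * (1 + E * y) + (1 + s) * (1 - y) * (1 + E) / 2 := by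
  have hY : exp (-((8 : ℕ) : ℝ)) ≤ 336 / 1000000 :=
    (exp_neg_natCast_le 8).trans (by norm_num)
  have hy0 : 0 < y := hy ▸ exp_pos _
  have hE0 : 0 < E := hE ▸ exp_pos _
  have hs0 : 0 < s := by rw [hs]; norm_num
  have e : y = exp (-((8 : ℕ) : ℝ)) * exp (-(2 * (u - 4))) := by
    rw [hy, ← exp_add]
    push_cast
    ring_nf
  have h1 : exp (-(2 * (u - 4))) ≤ 1 / (1 + 2 * (u - 4)) := by
    rw [exp_neg, one_div]
    refine inv_anti₀ (by linarith) ?_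
    have := add_one_le_exp (2 * (u - 4))
    linarith
  have h2 : exp (-(2 * (u - 4))) ≤ 1 := by rw [exp_le_one_iff]; linarith
  have h3 : u * exp (-(2 * (u - 4))) ≤ 4 := by
    refine (mul_le_mul_of_nonneg_left h1 (by linarith)).trans ?_
    rw [mul_one_div, div_le_iff₀ (by linarith)]
    linarith
  have hyY : y ≤ 336 / 1000000 := by
    rw [e]
    exact (mul_le_mul hY h2 (exp_nonneg _) (by norm_num)).trans (by norm_num)
  have huy : u * y ≤ 4 * (336 / 1000000) := by
    rw [e]
    have := mul_le_mul hY h3 (by positivity) (by norm_num)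
    linarith
  have hE4 : 0.4836 ≤ exp (-(2 * (s * 4))) :=
    le_trans (by rw [hs]; norm_num) (septic_le_exp_neg (by positivity))
  have hEe : 0.4836 * (1 - 2 * s * (u - 4)) ≤ E := by
    have e : E = exp (-(2 * (s * 4))) * exp (-(2 * s * (u - 4))) := by
      rw [hE, ← exp_add]
      ring_nf
    have h5 := one_sub_le_exp_neg (2 * s * (u - 4))
    rw [e]
    have h6 := mul_le_mul_of_nonneg_right hE4 (exp_nonneg (-(2 * s * (u - 4))))
    linarith
  have huy0 : 0 ≤ u * y := by positivity
  have hE1 : E ≤ 1 := by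
    rw [hE, exp_le_one_iff]
    have : 0 ≤ s * u := by positivity
    linarith
  have h7 : 0 ≤ y * E := by positivity
  have h8 : 0 ≤ u * y * E := by positivity
  have h9 : 0 ≤ y * (1 - E) := mul_nonneg hy0.le (by linarith)
  have h10 : u * y * y ≤ u * y * (336 / 1000000) := mul_le_mul_of_nonneg_left hyY huy0
  have h11 : 0 ≤ y * y := by positivity
  rw [hp, hs]
  rw [hs] at hEe
  nlinarith

end LogarithmicLarge

/-! ### Continuity in s and existence of thresholds. -/

theorem continuousAt_jensenBar_fPow {a b : ℝ} (ha : 0 < a) (hb : 0 < b) {s : ℝ} (h0 : s ≠ 0)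
    (h1 : s ≠ 1) : ContinuousAt (fun s => jensenBar (fPow s) a b) s := by
  have hm : (0 : ℝ) < (a + b) / 2 := by positivity
  have he : (fun s => jensenBar (fPow s) a b) =ᶠ[𝓝 s]
      fun s => (a ^ s + b ^ s - 2 * ((a + b) / 2) ^ s) / (s * (s - 1)) := by
    filter_upwards [isOpen_ne.mem_nhds h0, isOpen_ne.mem_nhds h1] with t ht0 ht1
    exact jensenBar_fPow_of_ne ht0 ht1 a b
  refine ContinuousAt.congr ?_ he.symm
  exact (((Real.continuousAt_const_rpow ha.ne').add (Real.continuousAt_const_rpow hb.ne')).sub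
    (continuousAt_const.mul (Real.continuousAt_const_rpow hm.ne'))).div
    (continuousAt_id.mul (continuousAt_id.sub continuousAt_const))
    (mul_ne_zero h0 (sub_ne_zero.2 h1))

theorem continuousAt_lambdaMean {a b : ℝ} (ha : 0 < a) (hb : 0 < b) {s : ℝ} (h0 : s ≠ 0)
    (h1 : s ≠ 1) (hn : s + 1 ≠ 0) : ContinuousAt (fun s => lambdaMean s a b) s := by
  by_cases hab : a = b
  · subst hab
    simp only [lambdaMean_self]
    exact continuousAt_const
  · simp only [lambdaMean_of_ne _ hab]
    refine ContinuousAt.div ?_ (continuousAt_jensenBar_fPow ha hb h0 h1)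
      (jensenBar_fPow_pos s ha hb hab).ne'
    have h := continuousAt_jensenBar_fPow ha hb (s := s + 1) hn (by simpa using h0)
    exact ContinuousAt.comp' (f := fun s => s + 1) h (continuousAt_id.add continuousAt_const)

/-- If `M ≤ λ_r` but not `M ≤ λ_l`, then the parameters `s` with `M ≤ λ_s` form a closed
half-line whose end lies in `(l, r]`. -/
theorem exists_threshold {M : ℝ → ℝ → ℝ} {l r : ℝ}
    (hl : ¬ ∀ a b : ℝ, 0 < a → 0 < b → M a b ≤ lambdaMean l a b)
    (hr : ∀ a b : ℝ, 0 < a → 0 < b → M a b ≤ lambdaMean r a b)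
    (hlr : ∀ s, l ≤ s → s ≤ r → s ≠ 0 ∧ s ≠ 1 ∧ s + 1 ≠ 0) :
    ∃ s₀, l < s₀ ∧ s₀ ≤ r ∧
      ∀ s : ℝ, (∀ a b : ℝ, 0 < a → 0 < b → M a b ≤ lambdaMean s a b) ↔ s₀ ≤ s := by
  set T := {s : ℝ | ∀ a b : ℝ, 0 < a → 0 < b → M a b ≤ lambdaMean s a b} with hT
  have hr : r ∈ T := hr
  have hup : ∀ s ∈ T, ∀ t, s ≤ t → t ∈ T := fun s hs t hst a b ha hb =>
    (hs a b ha hb).trans (lambdaMean_monotone ha hb hst)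
  have hlb : ∀ s ∈ T, l < s := fun s hs => by
    by_contra! h
    exact hl (hup s hs l h)
  have hbdd : BddBelow T := ⟨l, fun s hs => (hlb s hs).le⟩
  have hgt : ∀ s, sInf T < s → s ∈ T := fun s hs => by
    obtain ⟨t, ht, hts⟩ := exists_lt_of_csInf_lt ⟨r, hr⟩ hs
    exact hup t ht s hts.le
  have hle : sInf T ≤ r := csInf_le hbdd hr
  -- Continuity of λ_s in s comes from the power formula, available off s = -1, 0, 1; it puts the
  -- infimum into the set.
  obtain ⟨h0, h1, hn⟩ := hlr (sInf T) (le_csInf ⟨r, hr⟩ fun s hs => (hlb s hs).le) hle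
  have hmem : sInf T ∈ T := fun a b ha hb =>
    ge_of_tendsto ((continuousAt_lambdaMean ha hb h0 h1 hn).tendsto.mono_left
      (nhdsWithin_le_nhds (s := Ioi (sInf T))))
      (by filter_upwards [self_mem_nhdsWithin] with s hs using hgt s hs a b ha hb)
  exact ⟨sInf T, hlb _ hmem, hle, fun s => ⟨fun h => csInf_le hbdd h, hup _ hmem s⟩⟩

/-! ### The threshold for L lies between 1/12 and 227/2500. -/

section Logarithmic
open Real

theorem meanL_le_lambdaMean_exp_iff {s u : ℝ} (hs0 : 0 < s) (hs1 : s < 1) (hu : 0 < u) :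
    meanL (exp (-u)) (exp u) ≤ lambdaMean s (exp (-u)) (exp u) ↔
    cosh u ^ s * ((1 - s) * u * cosh u + (1 + s) * sinh u) ≤
      cosh (s * u) * ((1 - s) * u * cosh u + (1 + s) * sinh u) +
        (1 - s) * u * sinh u * sinh (s * u) := by
  rw [lambdaMean_of_ne s (exp_neg_ne_exp hu), le_div_iff₀
    (jensenBar_fPow_pos s (exp_pos _) (exp_pos _) (exp_neg_ne_exp hu)), meanL_exp hu,
    jensenBar_fPow_exp hs0.ne' hs1.ne, jensenBar_fPow_exp (by linarith) (by linarith),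
    show (s + 1) * u = u + s * u by ring, cosh_add, rpow_add_one (cosh_pos u).ne',
    ← sub_nonneg, ← sub_nonneg (b := cosh u ^ s * _)]
  have hs1' : 0 < 1 - s := by linarith
  have h1 : s - 1 ≠ 0 := by linarith
  have e : 2 * (cosh u * cosh (s * u) + sinh u * sinh (s * u) - cosh u ^ s * cosh u) /
        ((s + 1) * (s + 1 - 1)) -
      sinh u / u * (2 * (cosh (s * u) - cosh u ^ s) / (s * (s - 1))) =
      2 / ((1 + s) * s * (1 - s) * u) *
      (cosh (s * u) * ((1 - s) * u * cosh u + (1 + s) * sinh u) +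
        (1 - s) * u * sinh u * sinh (s * u) -
      cosh u ^ s * ((1 - s) * u * cosh u + (1 + s) * sinh u)) := by
    obtain ⟨q, hq⟩ : ∃ q, q = 1 - s := ⟨_, rfl⟩
    have h2 : s = 1 - q := by linarith
    have hq0 : q ≠ 0 := by linarith
    rw [show s - 1 = -q by linarith, show (1 - s) = q by linarith, show s + 1 - 1 = s by ring,
      add_comm s 1]
    have : 1 + s ≠ 0 := by linarith
    field_simp
    ring
  rw [e]
  exact mul_nonneg_iff_of_pos_left (by positivity)

theorem meanL_le_lambdaMean :
    ∀ a b : ℝ, 0 < a → 0 < b → meanL a b ≤ lambdaMean (227 / 2500) a b := by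
  refine isHomMean_meanL.le (isHomMean_lambdaMean _) fun u hu => ?_
  rw [meanL_le_lambdaMean_exp_iff (by norm_num) (by norm_num) hu]
  rcases le_total u (3 / 2) with h1 | h1
  · exact logarithmic_small hu h1 rfl
  refine logarithmic_of_exp_bound hu rfl rfl rfl rfl ?_
  rcases le_total u 2 with h2 | h2
  · exact logarithmic_exp_bound_three_halves h1 h2 rfl rfl rfl rfl
  rcases le_total u (5 / 2) with h3 | h3
  · exact logarithmic_exp_bound_two h2 h3 rfl rfl rfl rfl
  rcases le_total u 3 with h4 | h4
  · exact logarithmic_exp_bound_five_halves h3 h4 rfl rfl rfl rfl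
  rcases le_total u 4 with h5 | h5
  · exact logarithmic_exp_bound_three h4 h5 rfl rfl rfl rfl
  · exact logarithmic_exp_bound_four h5 rfl rfl rfl rfl

/-- The choice u = 12 log (5/4) ≈ 2.68 makes e^u and e^(u/12) rational, so only log (5/4) and one
twelfth root need numerical bounds. -/
theorem not_meanL_le_lambdaMean :
    ¬ ∀ a b : ℝ, 0 < a → 0 < b → meanL a b ≤ lambdaMean (1 / 12) a b := by
  intro h
  have hl0 : 0 < log (5 / 4) := log_pos (by norm_num)
  have hl1 : log (5 / 4) ≤ 0.2232 := by
    rw [log_le_iff_le_exp (by norm_num)]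
    have := sum_le_exp_of_nonneg (x := 0.2232) (by norm_num) 5
    simp only [Finset.sum_range_succ, Finset.sum_range_zero, Nat.factorial] at this
    norm_num at this ⊢
    linarith
  set l := log (5 / 4) with hl
  have hel : exp l = 5 / 4 := exp_log (by norm_num)
  have he : exp (12 * l) = (5 / 4) ^ 12 := by
    rw [← hel, ← exp_nat_mul]; norm_num
  have key := (meanL_le_lambdaMean_exp_iff (s := 1 / 12) (u := 12 * l) (by norm_num)
    (by norm_num) (by positivity)).1 (h _ _ (exp_pos _) (exp_pos _))
  rw [show 1 / 12 * (12 * l) = l by ring, cosh_eq l, sinh_eq l, exp_neg l, hel] at key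
  have hc : cosh (12 * l) = ((5 / 4) ^ 12 + ((5 / 4) ^ 12)⁻¹) / 2 := by
    rw [cosh_eq, exp_neg, he]
  have hS : sinh (12 * l) = ((5 / 4) ^ 12 - ((5 / 4) ^ 12)⁻¹) / 2 := by
    rw [sinh_eq, exp_neg, he]
  have hX : 1.1802 ≤ cosh (12 * l) ^ (1 / 12 : ℝ) := by
    have h12 : (1.1802 : ℝ) = ((1.1802 : ℝ) ^ (12 : ℕ)) ^ (1 / 12 : ℝ) := by
      rw [← rpow_natCast, ← rpow_mul (by norm_num)]; norm_num
    rw [h12, hc]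
    exact rpow_le_rpow (by norm_num) (by norm_num) (by norm_num)
  have h2 := (mul_le_mul_of_nonneg_right hX (show 0 ≤ (1 - 1 / 12) * (12 * l) * cosh (12 * l) +
    (1 + 1 / 12) * sinh (12 * l) by
      have := cosh_pos (12 * l)
      have := sinh_pos_iff.2 (show 0 < 12 * l by positivity)
      positivity)).trans key
  rw [hc, hS] at h2
  norm_num at h2 hl1
  linarith

end Logarithmic

/-! ### I ≤ λ_s at s = 10399/10000 for u ≤ 21/20. -/

section IdentricSmall
open Real

/-- The extreme case of `identric_quadratic_nonneg`: h and i equal their upper bounds, and the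
result is in Bernstein form on [0, (21/20)²]. -/
theorem identric_poly_nonneg {U h i ε s : ℝ} (hU : 0 ≤ U) (hU' : U ≤ 441 / 400)
    (hε : ε = 399 / 10000) (hs : s = 1 + ε)
    (hh : h = (105 + 45 * U + U ^ 2) / (105 + 10 * U))
    (hi : i = (2 + ε) * (1 + U / 3 + U ^ 2 / 30 + U ^ 3 / 200) / (1 + U / 2 + U ^ 2 / 24)) :
    0 ≤ s * (i - ε) + (i * h - ε) * (1 + ε * h) - h * s * (i - ε) ^ 2 := by
  obtain ⟨w, hw⟩ : ∃ w, w = 441 / 400 - U := ⟨_, rfl⟩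
  have hw0 : 0 ≤ w := by linarith
  have key : s * (i - ε) + (i * h - ε) * (1 + ε * h) - h * s * (i - ε) ^ 2 = U * (
      127002542080000000000 / 463417133217358383 * w ^ 8 +
        1087745355034695680000 / 463417133217358383 * U * w ^ 7 +
        569351017292297090560 / 66202447602479769 * U ^ 2 * w ^ 6 +
        28977097145744157101828 / 1655061190061994225 * U ^ 3 * w ^ 5 +
        17760131777368894515507149 / 827530595030997112500 * U ^ 4 * w ^ 4 +
        13202483158129887184018163377 / 827530595030997112500000 * U ^ 5 * w ^ 3 +
        4494688668013614196897729013263 / 662024476024797690000000000 * U ^ 6 * w ^ 2 +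
        12833371875484614356099163500161573 / 9268342664347167660000000000000 * U ^ 7 * w +
        127902794553847964283424287342428383 / 1853668532869433532000000000000000 * U ^ 8) /
      ((105 + 10 * U) * (1 + U / 2 + U ^ 2 / 24)) ^ 2 := by
    rw [hh, hi, hs, hε, hw]
    field_simp
    ring
  rw [key]
  positivity

theorem exp_sub_one_le_of_le {U h : ℝ} (hU : 0 ≤ U) (hU' : U ≤ 441 / 400)
    (hh : h ≤ (105 + 45 * U + U ^ 2) / (105 + 10 * U)) :
    exp (h - 1) ≤ 1 + U / 3 + U ^ 2 / 30 + U ^ 3 / 200 := by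
  obtain ⟨g, hg⟩ : ∃ g, g = (35 * U + U ^ 2) / (105 + 10 * U) := ⟨_, rfl⟩
  have hgh : h - 1 ≤ g := by
    have e : g = (105 + 45 * U + U ^ 2) / (105 + 10 * U) - 1 := by rw [hg]; field_simp; ring
    linarith
  have hg0 : 0 ≤ g := by rw [hg]; positivity
  have hg1 : g ≤ 1 := by
    rw [hg, div_le_one (by positivity)]
    nlinarith
  refine (exp_le_exp.2 hgh).trans ((exp_bound' hg0 hg1 (n := 3) (by norm_num)).trans ?_)
  obtain ⟨w, hw⟩ : ∃ w, w = 441 / 400 - U := ⟨_, rfl⟩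
  have hw0 : 0 ≤ w := by linarith
  -- The coefficient 4/18 = (n+1)/(n! n), with n = 3, is the remainder constant of `exp_bound'`.
  have key : 1 + U / 3 + U ^ 2 / 30 + U ^ 3 / 200 - (1 + g + g ^ 2 / 2 + g ^ 3 * (4 / 18)) =
      U ^ 3 * (
      28040000000 / 15752961 * w ^ 3 + 35461400000 / 5250987 * U * w ^ 2 +
        43656755000 / 5250987 * U ^ 2 * w + 52701329147 / 15752961 * U ^ 3) / (105 + 10 * U) ^ 3 := by
    rw [hg, hw]
    field_simp
    ring
  have hk : 0 ≤ 1 + U / 3 + U ^ 2 / 30 + U ^ 3 / 200 -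
      (1 + g + g ^ 2 / 2 + g ^ 3 * (4 / 18)) := by
    rw [key]
    positivity
  simp only [Finset.sum_range_succ, Finset.sum_range_zero, Nat.factorial]
  norm_num
  linarith

theorem quartic_le_cosh (u : ℝ) : 1 + u ^ 2 / 2 + u ^ 4 / 24 ≤ cosh u := by
  have := (hasSum_cosh u).summable.sum_le_tsum (Finset.range 3)
    (fun n _ => by rw [pow_mul]; positivity)
  rw [(hasSum_cosh u).tsum_eq] at this
  simp only [Finset.sum_range_succ, Finset.sum_range_zero, Nat.factorial] at this
  norm_num at this
  linarith

/-- The expression decreases when h, and then i, is raised to its upper bound; `b1` and `b2` are the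
two decrements. -/
theorem identric_quadratic_nonneg {U h i ε s : ℝ} (hU : 0 ≤ U) (hU' : U ≤ 441 / 400)
    (hε : ε = 399 / 10000) (hs : s = 1 + ε) (hh1 : 1 ≤ h)
    (hh : h ≤ (105 + 45 * U + U ^ 2) / (105 + 10 * U)) (hi1 : 1.15 ≤ i)
    (hi : i ≤ (2 + ε) * (1 + U / 3 + U ^ 2 / 30 + U ^ 3 / 200) / (1 + U / 2 + U ^ 2 / 24)) :
    0 ≤ s * (i - ε) + (i * h - ε) * (1 + ε * h) - h * s * (i - ε) ^ 2 := by
  have key := identric_poly_nonneg hU hU' hε hs rfl rfl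
  set h₂ := (105 + 45 * U + U ^ 2) / (105 + 10 * U) with hh₂
  set i₂ := (2 + ε) * (1 + U / 3 + U ^ 2 / 30 + U ^ 3 / 200) / (1 + U / 2 + U ^ 2 / 24) with hi₂
  have a1 : h₂ ≤ 1.4 := by
    rw [hh₂, div_le_iff₀ (by positivity)]
    nlinarith
  have a2 : 1.6 ≤ i₂ := by
    rw [hi₂, le_div_iff₀ (by positivity), hε]
    have : 0 ≤ U ^ 3 := by positivity
    nlinarith
  have b1 : 0 ≤ (h₂ - h) * (s * (i₂ - ε) ^ 2 + ε ^ 2 - i₂ * (1 + ε * (h + h₂))) := by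
    refine mul_nonneg (by linarith) ?_
    have c1 : i₂ * (1 + ε * (h + h₂)) ≤ i₂ * 1.2 :=
      mul_le_mul_of_nonneg_left (by rw [hε]; linarith) (by linarith)
    rw [hs, hε] at *
    nlinarith
  have b2 : 0 ≤ (i₂ - i) * (s * h * (i + i₂ - 2 * ε) - h - ε * h ^ 2 - s) := by
    refine mul_nonneg (by linarith) ?_
    have c1 : h * 2.6 ≤ h * (i + i₂ - 2 * ε) :=
      mul_le_mul_of_nonneg_left (by rw [hε]; linarith) (by linarith)
    have c2 : h ^ 2 ≤ 1.4 * h := by nlinarith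
    rw [hs, hε] at *
    nlinarith
  linarith

/-- When the factor of q is nonnegative, q ≤ εvp (from tanh z ≤ z at z = εv) and vc = hS reduce the
claim to `hQ`; otherwise both terms help. -/
theorem identric_combine {p q ε s c S h i v : ℝ} (hε : 0 < ε) (hs : 0 < s) (hc : 0 < c)
    (hS : 0 < S) (hp : 0 ≤ p) (hq : 0 ≤ q) (hqp : q ≤ ε * v * p)
    (hvc : v * c = h * S) (hi : 0 < i - ε) (hih : 0 ≤ i * h - ε)
    (hQ : 0 ≤ s * (i - ε) + (i * h - ε) * (1 + ε * h) - h * s * (i - ε) ^ 2) :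
    0 ≤ p * (ε * c * S * (s * (i - ε) + (i * h - ε))) -
      q * (c ^ 2 * (s * (i - ε) ^ 2 - ε * (i * h - ε))) := by
  rcases le_total 0 (s * (i - ε) ^ 2 - ε * (i * h - ε)) with h1 | h1
  · have h2 := mul_le_mul_of_nonneg_right hqp (mul_nonneg (sq_nonneg c) h1)
    have h3 : 0 ≤ ε * p * c * S *
      (s * (i - ε) + (i * h - ε) * (1 + ε * h) - h * s * (i - ε) ^ 2) :=
      mul_nonneg (by positivity) hQ
    have h4 : ε * v * p * (c ^ 2 * (s * (i - ε) ^ 2 - ε * (i * h - ε))) =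
        ε * p * c * (h * S) * (s * (i - ε) ^ 2 - ε * (i * h - ε)) := by
      rw [← hvc]; ring
    rw [h4] at h2
    linarith
  · have h2 : q * (c ^ 2 * (s * (i - ε) ^ 2 - ε * (i * h - ε))) ≤ 0 := by
      refine mul_nonpos_of_nonneg_of_nonpos hq ?_
      exact mul_nonpos_of_nonneg_of_nonpos (by positivity) h1
    have h3 : 0 ≤ p * (ε * c * S * (s * (i - ε) + (i * h - ε))) := by positivity
    linarith

/-- Rearranged, I ≤ λ_s says P ≤ cosh^s Δ with P = CΔ - ε sinh v Z. The last claim is the numerator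
of the logarithmic derivative of cosh^s Δ / P. Splitting sv = v + εv by the addition formulas makes
it linear in cosh (εv) and sinh (εv). -/
theorem identric_deriv_nonneg {v ε s T d Δ C Z : ℝ} (hv : 0 < v) (hv' : v ≤ 21 / 20)
    (hε : ε = 399 / 10000) (hs : s = 1 + ε) (hT : T = exp (v * cosh v / sinh v - 1))
    (hd : d = (2 + ε) * (T * ((cosh v * sinh v - v) / sinh v ^ 2)) - ε * sinh v)
    (hΔ : Δ = (2 + ε) * T - ε * cosh v) (hC : C = cosh (s * v)) (hZ : Z = sinh (s * v)) :
    0 < Δ ∧ 0 < C * Δ - ε * sinh v * Z ∧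
      0 ≤ s * sinh v * (C * Δ - ε * sinh v * Z) * Δ -
        (s * Z * Δ + C * d - ε * (cosh v * Z + sinh v * (s * C))) * Δ * cosh v +
        d * (C * Δ - ε * sinh v * Z) * cosh v := by
  have hU : v ^ 2 ≤ 441 / 400 := by nlinarith
  have hS : 0 < sinh v := sinh_pos_iff.2 hv
  have hc : 0 < cosh v := cosh_pos v
  have hε0 : 0 < ε := by rw [hε]; norm_num
  have hs0 : 0 < s := by rw [hs]; linarith
  obtain ⟨h, hh⟩ : ∃ h, h = v * cosh v / sinh v := ⟨_, rfl⟩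
  obtain ⟨i, hi⟩ : ∃ i, i = (2 + ε) * (T / cosh v) := ⟨_, rfl⟩
  have hh1 : 1 ≤ h := by rw [hh]; exact one_le_mul_cosh_div_sinh hv
  have hvc : v * cosh v = h * sinh v := by rw [hh]; field_simp
  have hh2 : h ≤ (105 + 45 * v ^ 2 + (v ^ 2) ^ 2) / (105 + 10 * v ^ 2) := by
    rw [hh, div_le_div_iff₀ hS (by positivity)]
    have := mul_cosh_le_sinh_three hv.le
    nlinarith
  have hT1 : T ≤ 1 + v ^ 2 / 3 + (v ^ 2) ^ 2 / 30 + (v ^ 2) ^ 3 / 200 := by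
    rw [hT, ← hh]
    exact exp_sub_one_le_of_le (sq_nonneg v) hU hh2
  have hT0 : 0 < T := hT ▸ exp_pos _
  have hi2 : i ≤ (2 + ε) * (1 + v ^ 2 / 3 + (v ^ 2) ^ 2 / 30 + (v ^ 2) ^ 3 / 200) /
      (1 + v ^ 2 / 2 + (v ^ 2) ^ 2 / 24) := by
    rw [hi, mul_div_assoc]
    refine mul_le_mul_of_nonneg_left ?_ (by linarith)
    refine div_le_div₀ (by positivity) hT1 (by positivity) ?_
    have := quartic_le_cosh v
    linarith
  -- Here T ≥ 1 and cosh v ≤ e^(v²/2), so i ≥ (2 + ε) e^(-441/800).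
  have hi1 : 1.15 ≤ i := by
    have e1 : exp (-(v ^ 2 / 2)) ≤ T / cosh v := by
      rw [le_div_iff₀ hc]
      have e2 : cosh v ≤ exp (v ^ 2 / 2) := cosh_le_exp_half_sq v
      have e3 : exp (-(v ^ 2 / 2)) * cosh v ≤ 1 := by
        have := mul_le_mul_of_nonneg_left e2 (exp_nonneg (-(v ^ 2 / 2)))
        rwa [← exp_add, neg_add_cancel, exp_zero] at this
      have e4 : 1 ≤ T := by
        rw [hT, ← hh]
        exact one_le_exp (by linarith)
      linarith
    have e2 : (0.57 : ℝ) ≤ exp (-(441 / 800)) :=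
      le_trans (by norm_num) (cubic_le_exp_neg (by norm_num))
    have e3 : exp (-(441 / 800)) ≤ exp (-(v ^ 2 / 2)) := exp_le_exp.2 (by linarith)
    rw [hi, hε]
    linarith
  have hQ := identric_quadratic_nonneg (sq_nonneg v) hU hε hs hh1 hh2 hi1 hi2
  have hΔi : Δ = cosh v * (i - ε) := by rw [hΔ, hi]; field_simp
  have hiε : 1 ≤ i - ε := by rw [hε]; linarith
  have hΔc : cosh v ≤ Δ := by rw [hΔi]; exact le_mul_of_one_le_right hc.le hiε
  have hΔ0 : 0 < Δ := hc.trans_le hΔc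
  have hC0 : 0 < C := hC ▸ cosh_pos _
  have hZ0 : 0 < Z := hZ ▸ sinh_pos_iff.2 (by positivity)
  have hCZ : Z < C := by rw [hC, hZ]; exact sinh_lt_cosh _
  have hSc : sinh v < cosh v := sinh_lt_cosh _
  refine ⟨hΔ0, ?_, ?_⟩
  · have e1 : Z * sinh v ≤ C * Δ := mul_le_mul hCZ.le (hSc.le.trans hΔc) hS.le hC0.le
    have e2 : 0 < (1 - ε) * (Z * sinh v) := mul_pos (by rw [hε]; norm_num) (by positivity)
    linarith
  · have hM : cosh v * Δ - sinh v * d = i * h - ε := by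
      rw [hΔ, hd, hi, hh]
      have := cosh_sq v
      field_simp
      linear_combination (-ε * sinh v) * this
    have hE1 : 0 < cosh (ε * v) := cosh_pos _
    have hE2 : sinh (ε * v) ≤ ε * v * cosh (ε * v) := sinh_le_mul_cosh (by positivity)
    have hE0 : 0 < sinh (ε * v) := sinh_pos_iff.2 (by positivity)
    have hC' : C = cosh v * cosh (ε * v) + sinh v * sinh (ε * v) := by
      rw [hC, hs, show (1 + ε) * v = v + ε * v by ring, cosh_add]
    have hZ' : Z = sinh v * cosh (ε * v) + cosh v * sinh (ε * v) := by
      rw [hZ, hs, show (1 + ε) * v = v + ε * v by ring, sinh_add]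
    have hcS := cosh_sq v
    set c := cosh v
    set S := sinh v
    set p := cosh (ε * v)
    set q := sinh (ε * v)
    have e : s * S * (C * Δ - ε * S * Z) * Δ -
        (s * Z * Δ + C * d - ε * (c * Z + S * (s * C))) * Δ * c +
        d * (C * Δ - ε * S * Z) * c =
        p * (ε * c * S * (s * (i - ε) + (i * h - ε))) -
          q * (c ^ 2 * (s * (i - ε) ^ 2 - ε * (i * h - ε))) := by
      rw [← hM, hC', hZ', hΔi]
      linear_combination (c * (i - ε) * ε * s * S * p - (c * (i - ε)) ^ 2 * s * q) * hcS
    rw [e]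
    exact identric_combine hε0 hs0 hc hS hE1.le hE0.le hE2 hvc (one_pos.trans_le hiε)
      (by nlinarith) hQ

/-- The inequality `I ≤ λ_s` on the pair `(exp (-u), exp u)`, for `1 < s`. -/
theorem meanI_le_lambdaMean_exp_iff {s u : ℝ} (hs : 1 < s) (hu : 0 < u) :
    meanI (exp (-u)) (exp u) ≤ lambdaMean s (exp (-u)) (exp u) ↔
    (s + 1) * exp (u * cosh u / sinh u - 1) * (cosh (s * u) - cosh u ^ s) ≤
      (s - 1) * (cosh u * cosh (s * u) + sinh u * sinh (s * u) - cosh u ^ s * cosh u) := by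
  rw [lambdaMean_of_ne s (exp_neg_ne_exp hu), le_div_iff₀
    (jensenBar_fPow_pos s (exp_pos _) (exp_pos _) (exp_neg_ne_exp hu)), meanI_exp hu,
    jensenBar_fPow_exp (by linarith) hs.ne', jensenBar_fPow_exp (by linarith) (by linarith),
    show (s + 1) * u = u + s * u by ring, cosh_add, rpow_add_one (cosh_pos u).ne']
  obtain ⟨q, hq⟩ : ∃ q, q = s - 1 := ⟨_, rfl⟩
  have hq0 : 0 < q := by linarith
  have hs0 : 0 < s := by linarith
  rw [show s + 1 - 1 = s by ring, ← hq, mul_div_assoc', div_le_div_iff₀ (by positivity)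
    (by positivity), ← sub_nonneg, ← sub_nonneg (b := (s + 1) * _ * _)]
  refine iff_of_eq (congrArg _ ?_) |>.trans (mul_nonneg_iff_of_pos_left
    (show 0 < 2 * s by positivity))
  ring

theorem identric_small {u : ℝ} (hu : 0 < u) (hu' : u ≤ 21 / 20) {s : ℝ} (hs : s = 10399 / 10000) :
    (s + 1) * exp (u * cosh u / sinh u - 1) * (cosh (s * u) - cosh u ^ s) ≤
      (s - 1) * (cosh u * cosh (s * u) + sinh u * sinh (s * u) - cosh u ^ s * cosh u) := by
  obtain ⟨ε, hε⟩ : ∃ ε : ℝ, ε = 399 / 10000 := ⟨_, rfl⟩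
  have hsε : s = 1 + ε := by rw [hs, hε]; norm_num
  have hs0 : 0 < s := by rw [hs]; norm_num
  have hε0 : 0 < ε := by rw [hε]; norm_num
  have dT : ∀ v, 0 < v → HasDerivAt
      (fun v => (2 + ε) * exp (v * cosh v / sinh v - 1) - ε * cosh v)
      ((2 + ε) * (exp (v * cosh v / sinh v - 1) * ((cosh v * sinh v - v) / sinh v ^ 2)) -
        ε * sinh v) v := fun v hv =>
    ((((hasDerivAt_mul_cosh_div_sinh hv).sub_const 1).exp.const_mul (2 + ε)).sub
      ((hasDerivAt_cosh v).const_mul ε))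
  have dP : ∀ v, 0 < v → HasDerivAt
      (fun v => cosh (s * v) * ((2 + ε) * exp (v * cosh v / sinh v - 1) - ε * cosh v) -
        ε * sinh v * sinh (s * v)) _ v := fun v hv =>
    ((hasDerivAt_cosh_mul s v).fun_mul (dT v hv)).sub
      (((hasDerivAt_sinh v).const_mul ε).mul (hasDerivAt_sinh_mul s v))
  have key := nonneg_of_hasDerivAt_of_tendsto hu
    (fun v hv hvu => (((hasDerivAt_log_cosh v).const_mul s).sub ((dP v hv).log
      (identric_deriv_nonneg hv (hvu.trans hu') hε hsε rfl rfl rfl rfl rfl).2.1.ne')).add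
      ((dT v hv).log (identric_deriv_nonneg hv (hvu.trans hu') hε hsε rfl rfl rfl rfl rfl).1.ne'))
    ?_ (g := fun v => -log (cosh (s * v))) ?_ ?_
  · obtain ⟨h1, h2, -⟩ := identric_deriv_nonneg hu hu' hε hsε rfl rfl rfl rfl rfl
    simp only [Pi.add_apply, Pi.sub_apply] at key
    have hc := cosh_pos u
    set Δ := (2 + ε) * exp (u * cosh u / sinh u - 1) - ε * cosh u with hΔ
    have h3 : cosh (s * u) * Δ - ε * sinh u * sinh (s * u) ≤ cosh u ^ s * Δ := by
      rw [← log_le_log_iff h2 (by positivity), log_mul (by positivity) h1.ne', log_rpow hc]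
      linarith
    rw [hΔ] at h3
    rw [hsε] at h3 ⊢
    linarith
  · intro v hv hvu
    obtain ⟨h1, h2, h3⟩ :=
      identric_deriv_nonneg hv (hvu.le.trans hu') hε hsε rfl rfl rfl rfl rfl
    have hc := cosh_pos v
    have combine : ∀ P P' Δ d c S : ℝ, 0 < P → 0 < Δ → 0 < c →
        0 ≤ s * S * P * Δ - P' * Δ * c + d * P * c → 0 ≤ s * (S / c) - P' / P + d / Δ := by
      intro P P' Δ d c S hP hΔ hc h
      have e : s * (S / c) - P' / P + d / Δ =
          (s * S * P * Δ - P' * Δ * c + d * P * c) / (P * Δ * c) := by field_simp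
      rw [e]
      positivity
    refine combine _ _ _ _ _ _ h2 h1 hc (h3.trans_eq ?_)
    ring
  · have h : ContinuousAt (fun v => -log (cosh (s * v))) 0 :=
      ((hasDerivAt_cosh_mul s 0).continuousAt.log (cosh_pos _).ne').neg
    have := h.tendsto.mono_left (nhdsWithin_le_nhds (s := Ioi 0))
    rwa [mul_zero, cosh_zero, log_one, neg_zero] at this
  · filter_upwards [Ioc_mem_nhdsGT hu] with v hv
    obtain ⟨h1, h2, -⟩ :=
      identric_deriv_nonneg hv.1 (hv.2.trans hu') hε hsε rfl rfl rfl rfl rfl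
    have h4 := log_cosh_nonneg v
    have h5 : 0 ≤ ε * sinh v * sinh (s * v) := by
      have := sinh_pos_iff.2 hv.1
      have := sinh_pos_iff.2 (mul_pos hs0 hv.1)
      positivity
    have h6 := log_le_log h2 (sub_le_self _ h5)
    rw [log_mul (cosh_pos _).ne' h1.ne'] at h6
    have h7 : 0 ≤ s * log (cosh v) := by positivity
    simp only [Pi.add_apply, Pi.sub_apply]
    linarith

end IdentricSmall

/-! ### I ≤ λ_s at s = 10399/10000 for u ≥ 21/20. -/

section IdentricLarge
open Real

/-- Bernoulli's inequality for the exponent 1 - p bounds (1 + x)^(p-1) from below; two integrations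
give the cubic. -/
theorem cubic_le_one_add_rpow {p y : ℝ} (hp : 0 ≤ p) (hp1 : p ≤ 1) (hy : 0 ≤ y) :
    1 + (1 + p) * y + (1 + p) * p / 2 * y ^ 2 - (1 + p) * p * (1 - p) / 6 * y ^ 3 ≤
      (1 + y) ^ (1 + p) := by
  have d : ∀ q x : ℝ, 0 ≤ x → HasDerivAt (fun x => (1 + x) ^ q) (q * (1 + x) ^ (q - 1)) x := by
    intro q x hx
    refine (((hasDerivAt_id x).const_add 1).rpow_const (p := q)
      (Or.inl (show 1 + x ≠ 0 by linarith))).congr_deriv ?_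
    simp only [id]
    ring
  have h1 : ∀ x, 0 ≤ x → 1 - (1 - p) * x ≤ (1 + x) ^ (p - 1) := by
    intro x hx
    have e : (1 + x) ^ (p - 1) = ((1 + x) ^ (1 - p))⁻¹ := by
      rw [← rpow_neg (by linarith)]; ring_nf
    have h2 : (1 + x) ^ (1 - p) ≤ 1 + (1 - p) * x :=
      rpow_one_add_le_one_add_mul_self (by linarith) (by linarith) (by linarith)
    have h3 : 0 < (1 + x) ^ (1 - p) := rpow_pos_of_pos (by linarith) _
    rw [e, ← one_div, le_div_iff₀ h3]
    rcases le_total 0 (1 - (1 - p) * x) with h4 | h4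
    · nlinarith [mul_le_mul_of_nonneg_left h2 h4, sq_nonneg ((1 - p) * x)]
    · nlinarith
  have h2 : ∀ x, 0 ≤ x → 1 + p * x - p * (1 - p) / 2 * x ^ 2 ≤ (1 + x) ^ p := by
    intro x hx
    rw [← sub_nonneg]
    refine nonneg_of_hasDerivAt_nonneg
      (f := fun x => (1 + x) ^ p - (1 + p * x - p * (1 - p) / 2 * x ^ 2)) (by simp)
      (fun z hz => (d p z hz).sub ((((hasDerivAt_id z).const_mul p).const_add 1).sub
        (((hasDerivAt_id z).fun_pow 2).const_mul (p * (1 - p) / 2)))) ?_ hx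
    intro z hz
    have := mul_le_mul_of_nonneg_left (h1 z hz.le) hp
    simp only [id]
    norm_num
    linarith
  rw [← sub_nonneg]
  refine nonneg_of_hasDerivAt_nonneg
    (f := fun y => (1 + y) ^ (1 + p) - (1 + (1 + p) * y + (1 + p) * p / 2 * y ^ 2 -
      (1 + p) * p * (1 - p) / 6 * y ^ 3)) (by simp)
    (fun z hz => (d (1 + p) z hz).sub (((((hasDerivAt_id z).const_mul (1 + p)).const_add 1).add
      (((hasDerivAt_id z).fun_pow 2).const_mul ((1 + p) * p / 2))).sub
      (((hasDerivAt_id z).fun_pow 3).const_mul ((1 + p) * p * (1 - p) / 6)))) ?_ hy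
  intro z hz
  have := mul_le_mul_of_nonneg_left (h2 z hz.le) (show 0 ≤ 1 + p by linarith)
  simp only [id, add_sub_cancel_left]
  norm_num
  linarith

theorem le_two_rpow_neg : 486361 / 500000 ≤ (2 : ℝ) ^ (-(399 / 10000) : ℝ) := by
  rw [rpow_def_of_pos (by norm_num)]
  have h1 : -(0.0276566 : ℝ) ≤ log 2 * -(399 / 10000) := by
    have := log_two_lt_d9
    linarith
  refine le_trans ?_ ((cubic_le_exp_neg (by norm_num)).trans (exp_le_exp.2 h1))
  norm_num

/-- Since u coth u = u + θ, one has I = e^(u - 1 + θ), and cosh^s = e^(su) R/2. Dividing by e^(su +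
u + θ)/4 leaves bounded quantities. -/
theorem identric_of_exp_bound {u s ε y Y R θ : ℝ} (hu : 0 < u) (hs : s = 1 + ε)
    (hy : y = exp (-2 * u)) (hY : Y = exp (-2 * (s * u)))
    (hR : R = 2 ^ (-ε) * (1 + y) ^ s) (hθ : θ = y * (2 * u) / (1 - y))
    (h : 2 * (2 + ε) * exp (-1) * (1 + Y - R) ≤
      ε * exp (-θ) * (2 + 2 * y * Y - (1 + y) * R)) :
    (s + 1) * exp (u * cosh u / sinh u - 1) * (cosh (s * u) - cosh u ^ s) ≤
      (s - 1) * (cosh u * cosh (s * u) + sinh u * sinh (s * u) - cosh u ^ s * cosh u) := by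
  have hy1 : 0 < 1 - y := by
    have : y < 1 := by rw [hy, exp_lt_one_iff]; linarith
    linarith
  have eT : exp (u * cosh u / sinh u - 1) = exp u * exp (-1) * exp θ := by
    rw [← exp_add, ← exp_add, cosh_eq_exp_mul u, sinh_eq_exp_mul u, ← hy, hθ]
    congr 1
    have := (exp_pos u).ne'
    field_simp
    ring
  have eX : cosh u ^ s = exp (s * u) * (R / 2) := by
    rw [cosh_rpow_eq, ← hy, hR, hs, neg_add, rpow_add (by norm_num), rpow_neg_one]
    ring
  rw [eT, eX, cosh_eq_exp_mul u, sinh_eq_exp_mul u, cosh_eq_exp_mul (s * u),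
    sinh_eq_exp_mul (s * u), ← hy, ← hY]
  have h2 := mul_le_mul_of_nonneg_left h
    (show 0 ≤ exp (s * u) * exp u * exp θ / 4 by positivity)
  have e1 : exp θ * exp (-θ) = 1 := by rw [← exp_add, add_neg_cancel, exp_zero]
  have hs1 : s - 1 = ε := by linarith
  have hs2 : s + 1 = 2 + ε := by linarith
  rw [hs1, hs2]
  refine le_trans (le_of_eq ?_) (h2.trans (le_of_eq ?_))
  · ring
  · linear_combination (exp (s * u) * exp u * ε * (2 + 2 * y * Y - (1 + y) * R) / 4) * e1

/-- R has coefficient a on the left and only εE(1 + y) on the right, so its lower bound r is the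
worst case. The constant 18761/12500 bounds 2(2 + ε)/e. -/
theorem identric_exp_bound_of_le {ε y Y E R r a : ℝ} (hε : ε = 399 / 10000) (hy : 0 < y)
    (hy' : y ≤ 1 / 8) (hE : 0 ≤ E) (hE1 : E ≤ 1) (hr : r ≤ R) (ha1 : 1 ≤ a)
    (ha : a ≤ 18761 / 12500) (h0 : 0 ≤ 2 + 2 * y * Y - (1 + y) * r)
    (h : 18761 / 12500 * (1 + Y - r) ≤ ε * E * (2 + 2 * y * Y - (1 + y) * r)) :
    a * (1 + Y - R) ≤ ε * E * (2 + 2 * y * Y - (1 + y) * R) := by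
  have hε0 : 0 ≤ ε := by rw [hε]; norm_num
  have h1 : a * (1 + Y - r) ≤ ε * E * (2 + 2 * y * Y - (1 + y) * r) := by
    rcases le_total 0 (1 + Y - r) with h2 | h2
    · exact (mul_le_mul_of_nonneg_right ha h2).trans h
    · exact (mul_nonpos_of_nonneg_of_nonpos (by linarith) h2).trans (by positivity)
  have h2 : ε * E * (1 + y) ≤ a := by
    have h3 : ε * E ≤ ε * 1 := mul_le_mul_of_nonneg_left hE1 hε0
    have h4 : ε * E * (1 + y) ≤ ε * 1 * (9 / 8) :=
      mul_le_mul h3 (by linarith) (by linarith) (by linarith)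
    rw [hε] at *
    linarith
  have h3 := mul_nonneg (sub_nonneg.2 hr) (sub_nonneg.2 h2)
  linarith

theorem two_mul_exp_neg_one_bounds {ε : ℝ} (hε : ε = 399 / 10000) :
    1 ≤ 2 * (2 + ε) * exp (-1) ∧ 2 * (2 + ε) * exp (-1) ≤ 18761 / 12500 := by
  have h1 := exp_neg_one_gt_d9
  have h2 := exp_neg_one_lt_d9
  rw [hε]
  constructor <;> linarith

/-- The bracket controlling the identric bound increases with its middle variable. -/
theorem identric_bracket_mono {ε y l w c r m : ℝ} (hε : ε = 399 / 10000) (hy : 0 < y)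
    (hy' : y ≤ 1 / 8) (hl : 0 ≤ l) (hlw : l ≤ w) (hw : w ≤ 0.26) (hc : 0 ≤ c)
    (hc' : c ≤ 1.005 + 1.14 * y) (hr : 486361 / 500000 * (1 + y) ≤ r) (hr' : r ≤ 1 + y)
    (hm : 1.18 ≤ m) :
    (1 - l * c + 9 / 20 * (l * c) ^ 2) * (2 + 2 * y * (y - ε * l) - (1 + y) * r) + m * l ≤
    (1 - w * c + 9 / 20 * (w * c) ^ 2) * (2 + 2 * y * (y - ε * w) - (1 + y) * r) + m * w := by
  have hε0 : 0 ≤ ε := by rw [hε]; norm_num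
  have hB0 : 0 ≤ 2 + 2 * y * (y - ε * w) - (1 + y) * r := by
    have h1 : (1 + y) * r ≤ (1 + y) * (1 + y) := mul_le_mul_of_nonneg_left hr' (by linarith)
    have h2 : y * w ≤ 1 / 8 * 0.26 := mul_le_mul hy' hw (by linarith) (by norm_num)
    rw [hε]
    nlinarith
  have hB1 : 2 + 2 * y * (y - ε * w) - (1 + y) * r ≤ 1.028 - 1.7 * y := by
    have h1 : (1 + y) * (486361 / 500000 * (1 + y)) ≤ (1 + y) * r :=
      mul_le_mul_of_nonneg_left hr (by linarith)
    have h2 : 0 ≤ y * (ε * w) := mul_nonneg hy.le (mul_nonneg hε0 (hl.trans hlw))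
    nlinarith
  have hcB : c * (2 + 2 * y * (y - ε * w) - (1 + y) * r) ≤ 1.05 := by
    have := mul_le_mul hc' hB1 hB0 (by linarith)
    nlinarith
  have hg : 1 - l * c + 9 / 20 * (l * c) ^ 2 ≤ 1 := by
    have h1 : l * c ≤ 0.26 * 1.16 := mul_le_mul (hlw.trans hw) (by linarith) hc (by norm_num)
    have h2 : 0 ≤ l * c := by positivity
    nlinarith
  have h1 : 2 * y * ε * (1 - l * c + 9 / 20 * (l * c) ^ 2) ≤ 0.01 := by
    have : 2 * y * ε ≤ 0.01 := by rw [hε]; linarith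
    have h3 := mul_le_mul_of_nonneg_left hg (show 0 ≤ 2 * y * ε by positivity)
    linarith
  have h2 : 0 ≤ (w - l) * (m - c * (2 + 2 * y * (y - ε * w) - (1 + y) * r) -
      2 * y * ε * (1 - l * c + 9 / 20 * (l * c) ^ 2)) :=
    mul_nonneg (by linarith) (by linarith)
  have h3 : 0 ≤ 9 / 20 * c ^ 2 * ((w - l) * (w + l)) *
      (2 + 2 * y * (y - ε * w) - (1 + y) * r) := by
    have h4 : 0 ≤ (w - l) * (w + l) := mul_nonneg (by linarith) (by linarith)
    positivity
  linarith

theorem binomial_cubic_bounds {ε s y r : ℝ} (hε : ε = 399 / 10000) (hs : s = 1 + ε) (hy : 0 < y)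
    (hy' : y ≤ 1 / 8)
    (hr : r = 486361 / 500000 * (1 + s * y + s * ε / 2 * y ^ 2 - s * ε * (1 - ε) / 6 * y ^ 3)) :
    486361 / 500000 * (1 + y) ≤ r ∧ r ≤ 1 + y ∧ r ≤ 2 ^ (-ε) * (1 + y) ^ s := by
  have h3 : y ^ 3 ≤ 1 / 8 * y ^ 2 := by nlinarith [mul_nonneg (sq_nonneg y) (sub_nonneg.2 hy')]
  have h2 : y ^ 2 ≤ 1 / 8 * y := by nlinarith
  have h0 : 0 ≤ y ^ 3 := by positivity
  refine ⟨?_, ?_, ?_⟩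
  · rw [hr, hs, hε]
    linarith
  · rw [hr, hs, hε]
    linarith
  · have h4 := cubic_le_one_add_rpow (p := ε) (by rw [hε]; norm_num) (by rw [hε]; norm_num) hy.le
    have h5 : 486361 / 500000 ≤ (2 : ℝ) ^ (-ε) := by
      rw [hε]; exact le_two_rpow_neg
    have h6 : 0 < (1 + y) ^ s := rpow_pos_of_pos (by linarith) _
    rw [hr, hs]
    rw [hs] at h6
    exact (mul_le_mul_of_nonneg_left h4 (by norm_num)).trans (mul_le_mul_of_nonneg_right h5 h6.le)

/-- For y ≤ 1/8, log x ≥ 1 - 1/x at x = 8y gives yL ≤ 1/8 + (3 log 2 - 1)y, which stays just below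
0.26. -/
theorem exp_neg_mul_le {y L : ℝ} (hyL : y = exp (-L)) : y * L ≤ 0.26 ∨ 1 / 8 < y := by
  refine or_iff_not_imp_right.2 fun hy' => ?_
  have hy' : y ≤ 1 / 8 := not_lt.1 hy'
  have hy : 0 < y := hyL ▸ exp_pos _
  have h2 : 1 - 1 / (8 * y) ≤ log (8 * y) := by
    have := one_sub_inv_le_log_of_pos (show 0 < 8 * y by positivity)
    rwa [← one_div] at this
  have h3 : log (8 * y) = 3 * log 2 - L := by
    rw [log_mul (by norm_num) hy.ne', hyL, log_exp, show (8 : ℝ) = 2 ^ 3 by norm_num, log_pow]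
    push_cast
    ring
  have h4 : L ≤ 3 * log 2 - 1 + 1 / (8 * y) := by linarith
  have h5 := mul_le_mul_of_nonneg_left h4 hy.le
  have h6 : y * (1 / (8 * y)) = 1 / 8 := by field_simp
  have h7 := log_two_lt_d9
  nlinarith

/-- For z ≤ 3/10 the cubic term z³/6 is at most z²/20, and 9/20 = 1/2 - 1/20. -/
theorem quadratic_le_exp_neg {z : ℝ} (hz : 0 ≤ z) (hz' : z ≤ 3 / 10) :
    1 - z + 9 / 20 * z ^ 2 ≤ exp (-z) := by
  have h := cubic_le_exp_neg hz
  have := mul_nonneg (sq_nonneg z) (sub_nonneg.2 hz')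
  linarith

/-- Y = y e^(-εL), and L² ≤ (m + M)L - mM on [m, M] makes the quadratic Taylor bound linear in L. -/
theorem exp_neg_mul_exp_bounds {ε s y L Y m M : ℝ} (hε : 0 ≤ ε) (hs : s = 1 + ε)
    (hyL : y = exp (-L)) (hY : Y = exp (-(s * L))) (hL : 0 ≤ L) (hmL : m ≤ L) (hLM : L ≤ M) :
    y - ε * (y * L) ≤ Y ∧
      Y ≤ y * (1 - ε ^ 2 * m * M / 2) - ε * (1 - ε * (m + M) / 2) * (y * L) := by
  have hy : 0 < y := hyL ▸ exp_pos _
  have hYe : Y = y * exp (-(ε * L)) := by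
    rw [hY, hyL, ← exp_add, hs]; ring_nf
  constructor
  · have := mul_le_mul_of_nonneg_left (one_sub_le_exp_neg (ε * L)) hy.le
    rw [hYe]
    linarith
  · have h1 := alternating_exp_neg 3 (ε * L) (by positivity)
    simp only [Finset.sum_range_succ, Finset.sum_range_zero, Nat.factorial] at h1
    norm_num at h1
    have h2 : 0 ≤ (L - m) * (M - L) := mul_nonneg (by linarith) (by linarith)
    have h3 : exp (-(ε * L)) ≤ 1 - ε ^ 2 * m * M / 2 - ε * (1 - ε * (m + M) / 2) * L := by
      have := mul_nonneg (sq_nonneg ε) h2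
      linarith
    have := mul_le_mul_of_nonneg_left h3 hy.le
    rw [hYe]
    linarith

/-- With l below yL and c above 1/(1 - y), `identric_bracket_mono` allows yL to be replaced by l.
Once l and c are linear in y, the hypothesis `h` is a polynomial inequality in y alone. -/
theorem identric_exp_bound_of_poly {ε s y L Y R l c m M r : ℝ} (hε : ε = 399 / 10000)
    (hs : s = 1 + ε) (hy' : y ≤ 1 / 8) (hyL : y = exp (-L)) (hY : Y = exp (-(s * L)))
    (hR : R = 2 ^ (-ε) * (1 + y) ^ s) (hmL : m ≤ L) (hLM : L ≤ M) (hm : 0 ≤ m)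
    (hmM : m + M ≤ 10.41) (hl0 : 0 ≤ l) (hl : l ≤ y * L) (hc : 1 ≤ c * (1 - y))
    (hc' : c ≤ 1.005 + 1.14 * y)
    (hr : r = 486361 / 500000 * (1 + s * y + s * ε / 2 * y ^ 2 - s * ε * (1 - ε) / 6 * y ^ 3))
    (h : 0 ≤ ε * (1 - l * c + 9 / 20 * (l * c) ^ 2) *
        (2 + 2 * y * (y - ε * l) - (1 + y) * r) -
      18761 / 12500 * (1 + y * (1 - ε ^ 2 * m * M / 2) - ε * (1 - ε * (m + M) / 2) * l - r)) :
    2 * (2 + ε) * exp (-1) * (1 + Y - R) ≤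
      ε * exp (-(y * L / (1 - y))) * (2 + 2 * y * Y - (1 + y) * R) := by
  have hε0 : 0 < ε := by rw [hε]; norm_num
  have hy : 0 < y := hyL ▸ exp_pos _
  have hL0 : 0 ≤ L := hm.trans hmL
  obtain ⟨hr1, hr2, hr3⟩ := binomial_cubic_bounds hε hs hy hy' hr
  obtain ⟨hYl, hYu⟩ := exp_neg_mul_exp_bounds hε0.le hs hyL hY hL0 hmL hLM
  have hw1 : y * L ≤ 0.26 := (exp_neg_mul_le hyL).resolve_right (not_lt.2 hy')
  have hw0 : 0 ≤ y * L := by positivity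
  obtain ⟨w, hw⟩ : ∃ w, w = y * L := ⟨_, rfl⟩
  rw [← hw] at hYl hYu hw1 hw0 hl ⊢
  have hc0 : 0 < c := by
    by_contra! hcn
    have := mul_nonneg_of_nonpos_of_nonpos hcn (show -(1 - y) ≤ 0 by linarith)
    linarith
  have hwc0 : 0 ≤ w * c := by positivity
  have hwc : w * c ≤ 3 / 10 := by
    have := mul_le_mul hw1 (show c ≤ 1.1475 by linarith) hc0.le (by norm_num)
    linarith
  have hexp : 1 - w * c + 9 / 20 * (w * c) ^ 2 ≤ exp (-(w / (1 - y))) := by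
    refine (quadratic_le_exp_neg hwc0 hwc).trans (exp_le_exp.2 (neg_le_neg ?_))
    rw [div_le_iff₀ (by linarith), mul_assoc]
    exact le_mul_of_one_le_right hw0 hc
  have hY0 : 0 ≤ Y := hY ▸ exp_nonneg _
  have hmono := identric_bracket_mono (m := 18761 / 12500 * (1 - ε * (m + M) / 2)) hε hy hy' hl0
    hl hw1 hc0.le hc' hr1 hr2 (by rw [hε]; linarith)
  obtain ⟨ha1, ha2⟩ := two_mul_exp_neg_one_bounds hε
  have hB0 : 0 ≤ 2 + 2 * y * Y - (1 + y) * r := by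
    have h2 : (1 + y) * r ≤ (9 / 8) * (9 / 8) :=
      mul_le_mul (by linarith) (by linarith) (by linarith) (by norm_num)
    have h3 : 0 ≤ 2 * y * Y := by positivity
    linarith
  have hE1 : exp (-(w / (1 - y))) ≤ 1 := by
    rw [exp_le_one_iff, neg_nonpos]
    exact div_nonneg hw0 (by linarith)
  refine identric_exp_bound_of_le hε hy hy' (exp_nonneg _) hE1 (hr3.trans_eq hR.symm) ha1 ha2
    hB0 ?_
  have hg0 : 0 ≤ 1 - w * c + 9 / 20 * (w * c) ^ 2 := by
    have := sq_nonneg (w * c)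
    linarith
  have h4 := mul_le_mul_of_nonneg_right hexp hB0
  have h5 : (1 - w * c + 9 / 20 * (w * c) ^ 2) *
      (2 + 2 * y * (y - ε * w) - (1 + y) * r) ≤
      (1 - w * c + 9 / 20 * (w * c) ^ 2) * (2 + 2 * y * Y - (1 + y) * r) := by
    refine mul_le_mul_of_nonneg_left ?_ hg0
    have := mul_le_mul_of_nonneg_left hYl hy.le
    linarith
  have h6 := mul_le_mul_of_nonneg_left
    (hmono.trans (add_le_add_left (h5.trans h4) _)) hε0.le
  clear hmono h5 h4 hexp hwc hr hr3
  linarith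

theorem chord_le_neg_mul_log {x y z A B : ℝ} (hx : 0 < x) (hxy : x ≤ y) (hyz : y ≤ z)
    (hA : A ≤ -x * log x) (hB : B ≤ -z * log z) :
    A * (z - y) + B * (y - x) ≤ (z - x) * (-y * log y) := by
  rcases eq_or_lt_of_le (hxy.trans hyz) with h | h
  · have h1 : y = x := by linarith
    subst h1
    rw [← h]
    simp
  have hzx : 0 < z - x := by linarith
  have := concaveOn_negMulLog.2 (mem_Ici.2 hx.le) (mem_Ici.2 (hx.le.trans h.le))
    (div_nonneg (sub_nonneg.2 hyz) hzx.le) (div_nonneg (sub_nonneg.2 hxy) hzx.le)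
    (by field_simp; ring)
  have e : ((z - y) / (z - x)) • x + ((y - x) / (z - x)) • z = y := by
    simp only [smul_eq_mul]
    field_simp
    ring
  rw [e] at this
  simp only [smul_eq_mul, negMulLog] at this
  have h2 := mul_le_mul_of_nonneg_left this hzx.le
  have e2 : (z - x) * ((z - y) / (z - x) * (-x * log x) + (y - x) / (z - x) * (-z * log z)) =
      (z - y) * (-x * log x) + (y - x) * (-z * log z) := by
    field_simp
  rw [e2] at h2
  have h3 := mul_le_mul_of_nonneg_right hA (sub_nonneg.2 hyz)
  have h4 := mul_le_mul_of_nonneg_right hB (sub_nonneg.2 hxy)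
  linarith

/-- Here l comes from a chord of the concave -y log y, and c is the chord of the convex 1/(1 - y):
c(1 - y) - 1 is a positive multiple of the product of the distances to the two ends. The final
polynomial is in Bernstein form of degree 8. -/
theorem identric_exp_bound_three_thirty_seconds {ε s y L Y R : ℝ} (hε : ε = 399 / 10000)
    (hs : s = 1 + ε) (h1 : 3 / 32 ≤ y) (h2 : y ≤ 1 / 8) (hyL : y = exp (-L))
    (hY : Y = exp (-(s * L))) (hR : R = 2 ^ (-ε) * (1 + y) ^ s) :
    2 * (2 + ε) * exp (-1) * (1 + Y - R) ≤
      ε * exp (-(y * L / (1 - y))) * (2 + 2 * y * Y - (1 + y) * R) := by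
  have hy : 0 < y := hyL ▸ exp_pos _
  have hyl : log y = -L := by rw [hyL, log_exp]
  have h3 := log_two_gt_d9
  have h4 := log_two_lt_d9
  have h5 := log_three_gt_d9
  have h6 := log_three_lt_d9
  have hla : log (3 / 32) = log 3 - 5 * log 2 := by
    rw [log_div (by norm_num) (by norm_num), show (32 : ℝ) = 2 ^ 5 by norm_num,
      log_pow]
    norm_num
  have hlb : log (1 / 8) = -(3 * log 2) := by
    rw [show (1 / 8 : ℝ) = (2 ^ 3)⁻¹ by norm_num, log_inv, log_pow]
    norm_num
  have hmL : 2079 / 1000 ≤ L := by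
    have := log_le_log hy h2
    rw [hlb] at this
    linarith
  have hLM : L ≤ 296 / 125 := by
    have := log_le_log (by norm_num) h1
    rw [hla] at this
    linarith
  obtain ⟨t, ht⟩ : ∃ t, t = y - 3 / 32 := ⟨_, rfl⟩
  obtain ⟨v, hv⟩ : ∃ v, v = 1 / 8 - y := ⟨_, rfl⟩
  have ht0 : 0 ≤ t := by linarith
  have hv0 : 0 ≤ v := by linarith
  have hl : (22191 / 100000 * (1 / 8 - y) + 25993 / 100000 * (y - 3 / 32)) / (1 / 32) ≤ y * L := by
    have := chord_le_neg_mul_log (by norm_num) h1 h2 (A := 22191 / 100000) (B := 25993 / 100000)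
      (by rw [hla]; linarith) (by rw [hlb]; linarith)
    rw [div_le_iff₀ (by norm_num)]
    rw [hyl] at this
    linarith
  refine identric_exp_bound_of_poly hε hs (by linarith) hyL hY hR hmL hLM (by norm_num)
    (by norm_num) ?_ hl (c := (25 / 32 + y) / (203 / 256)) ?_ (by linarith) rfl ?_
  · rw [ht.symm, hv.symm]; positivity
  · rw [div_mul_eq_mul_div, le_div_iff₀ (by norm_num)]
    have := mul_nonneg ht0 hv0
    rw [ht, hv] at this
    linarith
  · have key : 0 ≤
      23271441294031504388670137045803753 / 313296914100646972656250000 * v ^ 8 +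
        1335022990261256501689489618546532593 / 3132969141006469726562500000 * t * v ^ 7 +
        186047379171718313876887117032807015003 / 175446271896362304687500000000 * t ^ 2 * v ^ 6 +
        138112021953322168039595234813919108801 / 87723135948181152343750000000 * t ^ 3 * v ^ 5 +
        58958133118655193377235328641987941167 / 35089254379272460937500000000 * t ^ 4 * v ^ 4 +
        3137714302599306689834808650879437459 / 2193078398704528808593750000 * t ^ 5 * v ^ 3 +
        5029001063074485415907040971126462357 / 5482695996761322021484375000 * t ^ 6 * v ^ 2 +
        8628555778358523248695319900197221 / 23632310330867767333984375 * t ^ 7 * v +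
        52313037677269188018439414958171 / 814907252788543701171875 * t ^ 8 := by positivity
    refine key.trans_eq ?_
    rw [ht, hv, hs, hε]
    ring

theorem identric_exp_bound_sixteenth {ε s y L Y R : ℝ} (hε : ε = 399 / 10000)
    (hs : s = 1 + ε) (h1 : 1 / 16 ≤ y) (h2 : y ≤ 3 / 32) (hyL : y = exp (-L))
    (hY : Y = exp (-(s * L))) (hR : R = 2 ^ (-ε) * (1 + y) ^ s) :
    2 * (2 + ε) * exp (-1) * (1 + Y - R) ≤
      ε * exp (-(y * L / (1 - y))) * (2 + 2 * y * Y - (1 + y) * R) := by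
  have hy : 0 < y := hyL ▸ exp_pos _
  have hyl : log y = -L := by rw [hyL, log_exp]
  have h3 := log_two_gt_d9
  have h4 := log_two_lt_d9
  have h5 := log_three_gt_d9
  have h6 := log_three_lt_d9
  have hla : log (1 / 16) = -(4 * log 2) := by
    rw [show (1 / 16 : ℝ) = (2 ^ 4)⁻¹ by norm_num, log_inv, log_pow]
    norm_num
  have hlb : log (3 / 32) = log 3 - 5 * log 2 := by
    rw [log_div (by norm_num) (by norm_num), show (32 : ℝ) = 2 ^ 5 by norm_num,
      log_pow]
    norm_num
  have hmL : 2367 / 1000 ≤ L := by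
    have := log_le_log hy h2
    rw [hlb] at this
    linarith
  have hLM : L ≤ 2773 / 1000 := by
    have := log_le_log (by norm_num) h1
    rw [hla] at this
    linarith
  obtain ⟨t, ht⟩ : ∃ t, t = y - 1 / 16 := ⟨_, rfl⟩
  obtain ⟨v, hv⟩ : ∃ v, v = 3 / 32 - y := ⟨_, rfl⟩
  have ht0 : 0 ≤ t := by linarith
  have hv0 : 0 ≤ v := by linarith
  have hl : (1083 / 6250 * (3 / 32 - y) + 22191 / 100000 * (y - 1 / 16)) / (1 / 32) ≤ y * L := by
    have := chord_le_neg_mul_log (by norm_num) h1 h2 (A := 1083 / 6250) (B := 22191 / 100000)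
      (by rw [hla]; linarith) (by rw [hlb]; linarith)
    rw [div_le_iff₀ (by norm_num)]
    rw [hyl] at this
    linarith
  refine identric_exp_bound_of_poly hε hs (by linarith) hyL hY hR hmL hLM (by norm_num)
    (by norm_num) ?_ hl (c := (27 / 32 + y) / (435 / 512)) ?_ (by linarith) rfl ?_
  · rw [ht.symm, hv.symm]; positivity
  · rw [div_mul_eq_mul_div, le_div_iff₀ (by norm_num)]
    have := mul_nonneg ht0 hv0
    rw [ht, hv] at this
    linarith
  · have key : 0 ≤
      285450528689872325643815630737316 / 2910383045673370361328125 * v ^ 8 +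
        48285779666419566187227931521317374 / 84401108324527740478515625 * t * v ^ 7 +
        113245890330092344443810933628513137 / 78324228525161743164062500 * t ^ 2 * v ^ 6 +
        363788084742981046122395532615845607 / 168802216649055480957031250 * t ^ 3 * v ^ 5 +
        43966171299070711156371790115987500129 / 19581057131290435791015625000 * t ^ 4 * v ^ 4 +
        17784022766187903789423066305236356239 / 9790528565645217895507812500 * t ^ 5 * v ^ 3 +
        34725128786882847042199014230313448289 / 31329691410064697265625000000 * t ^ 6 * v ^ 2 +
        134187024079134930079742602060802577 / 313296914100646972656250000 * t ^ 7 * v +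
        23281483515255379096330937045803753 / 313296914100646972656250000 * t ^ 8 := by positivity
    refine key.trans_eq ?_
    rw [ht, hv, hs, hε]
    ring

theorem identric_exp_bound_thirty_second {ε s y L Y R : ℝ} (hε : ε = 399 / 10000)
    (hs : s = 1 + ε) (h1 : 1 / 32 ≤ y) (h2 : y ≤ 1 / 16) (hyL : y = exp (-L))
    (hY : Y = exp (-(s * L))) (hR : R = 2 ^ (-ε) * (1 + y) ^ s) :
    2 * (2 + ε) * exp (-1) * (1 + Y - R) ≤
      ε * exp (-(y * L / (1 - y))) * (2 + 2 * y * Y - (1 + y) * R) := by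
  have hy : 0 < y := hyL ▸ exp_pos _
  have hyl : log y = -L := by rw [hyL, log_exp]
  have h3 := log_two_gt_d9
  have h4 := log_two_lt_d9
  have hla : log (1 / 32) = -(5 * log 2) := by
    rw [show (1 / 32 : ℝ) = (2 ^ 5)⁻¹ by norm_num, log_inv, log_pow]
    norm_num
  have hlb : log (1 / 16) = -(4 * log 2) := by
    rw [show (1 / 16 : ℝ) = (2 ^ 4)⁻¹ by norm_num, log_inv, log_pow]
    norm_num
  have hmL : 693 / 250 ≤ L := by
    have := log_le_log hy h2
    rw [hlb] at this
    linarith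
  have hLM : L ≤ 1733 / 500 := by
    have := log_le_log (by norm_num) h1
    rw [hla] at this
    linarith
  obtain ⟨t, ht⟩ : ∃ t, t = y - 1 / 32 := ⟨_, rfl⟩
  obtain ⟨v, hv⟩ : ∃ v, v = 1 / 16 - y := ⟨_, rfl⟩
  have ht0 : 0 ≤ t := by linarith
  have hv0 : 0 ≤ v := by linarith
  have hl : (1083 / 10000 * (1 / 16 - y) + 1083 / 6250 * (y - 1 / 32)) / (1 / 32) ≤ y * L := by
    have := chord_le_neg_mul_log (by norm_num) h1 h2 (A := 1083 / 10000) (B := 1083 / 6250)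
      (by rw [hla]; linarith) (by rw [hlb]; linarith)
    rw [div_le_iff₀ (by norm_num)]
    rw [hyl] at this
    linarith
  refine identric_exp_bound_of_poly hε hs (by linarith) hyL hY hR hmL hLM (by norm_num)
    (by norm_num) ?_ hl (c := (29 / 32 + y) / (465 / 512)) ?_ (by linarith) rfl ?_
  · rw [ht.symm, hv.symm]; positivity
  · rw [div_mul_eq_mul_div, le_div_iff₀ (by norm_num)]
    have := mul_nonneg ht0 hv0
    rw [ht, hv] at this
    linarith
  · have key : 0 ≤
      569204394235567273233612439153001 / 4475004971027374267578125 * v ^ 8 +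
        16649285297488455347089547114432338 / 22375024855136871337890625 * t * v ^ 7 +
        3381256142577787317031862466736001037 / 1790001988410949707031250000 * t ^ 2 * v ^ 6 +
        6340045803818446260762016707747530961 / 2237502485513687133789062500 * t ^ 3 * v ^ 5 +
        33257046935165123697272985762193889951 / 11187512427568435668945312500 * t ^ 4 * v ^ 4 +
        6752256367719699699354278820971715806 / 2796878106892108917236328125 * t ^ 5 * v ^ 3 +
        823375524499865143707510257845354871 / 559375621378421783447265625 * t ^ 6 * v ^ 2 +
        51158725021950492199896891230792076 / 90221874415874481201171875 * t ^ 7 * v +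
        285421368257389090443815630737316 / 2910383045673370361328125 * t ^ 8 := by positivity
    refine key.trans_eq ?_
    rw [ht, hv, hs, hε]
    ring

theorem identric_exp_bound_sixty_fourth {ε s y L Y R : ℝ} (hε : ε = 399 / 10000)
    (hs : s = 1 + ε) (h1 : 1 / 64 ≤ y) (h2 : y ≤ 1 / 32) (hyL : y = exp (-L))
    (hY : Y = exp (-(s * L))) (hR : R = 2 ^ (-ε) * (1 + y) ^ s) :
    2 * (2 + ε) * exp (-1) * (1 + Y - R) ≤
      ε * exp (-(y * L / (1 - y))) * (2 + 2 * y * Y - (1 + y) * R) := by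
  have hy : 0 < y := hyL ▸ exp_pos _
  have hyl : log y = -L := by rw [hyL, log_exp]
  have h3 := log_two_gt_d9
  have h4 := log_two_lt_d9
  have hla : log (1 / 64) = -(6 * log 2) := by
    rw [show (1 / 64 : ℝ) = (2 ^ 6)⁻¹ by norm_num, log_inv, log_pow]
    norm_num
  have hlb : log (1 / 32) = -(5 * log 2) := by
    rw [show (1 / 32 : ℝ) = (2 ^ 5)⁻¹ by norm_num, log_inv, log_pow]
    norm_num
  have hmL : 693 / 200 ≤ L := by
    have := log_le_log hy h2
    rw [hlb] at this
    linarith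
  have hLM : L ≤ 4159 / 1000 := by
    have := log_le_log (by norm_num) h1
    rw [hla] at this
    linarith
  obtain ⟨t, ht⟩ : ∃ t, t = y - 1 / 64 := ⟨_, rfl⟩
  obtain ⟨v, hv⟩ : ∃ v, v = 1 / 32 - y := ⟨_, rfl⟩
  have ht0 : 0 ≤ t := by linarith
  have hv0 : 0 ≤ v := by linarith
  have hl : (3249 / 50000 * (1 / 32 - y) + 1083 / 10000 * (y - 1 / 64)) / (1 / 64) ≤ y * L := by
    have := chord_le_neg_mul_log (by norm_num) h1 h2 (A := 3249 / 50000) (B := 1083 / 10000)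
      (by rw [hla]; linarith) (by rw [hlb]; linarith)
    rw [div_le_iff₀ (by norm_num)]
    rw [hyl] at this
    linarith
  refine identric_exp_bound_of_poly hε hs (by linarith) hyL hY hR hmL hLM (by norm_num)
    (by norm_num) ?_ hl (c := (61 / 64 + y) / (1953 / 2048)) ?_ (by linarith) rfl ?_
  · rw [ht.symm, hv.symm]; positivity
  · rw [div_mul_eq_mul_div, le_div_iff₀ (by norm_num)]
    have := mul_nonneg ht0 hv0
    rw [ht, hv] at this
    linarith
  · have key : 0 ≤
      5337565863321597345341816796131308 / 162981450557708740234375 * v ^ 8 +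
        6071725638237690195609603476615980696 / 25262124836444854736328125 * t * v ^ 7 +
        616149156808160119948772305123780534924 / 783125869929790496826171875 * t ^ 2 * v ^ 6 +
        1180543094257661182821473403454431300896 / 783125869929790496826171875 * t ^ 3 * v ^ 5 +
        58120191868957567446186988673896167888 / 31325034797191619873046875 * t ^ 4 * v ^ 4 +
        1177981270241633480655911118267390902656 / 783125869929790496826171875 * t ^ 5 * v ^ 3 +
        613685900428260206886550139288003939648 / 783125869929790496826171875 * t ^ 6 * v ^ 2 +
        5349663282186603702033276808550724096 / 22375024855136871337890625 * t ^ 7 * v +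
        145709807014715248372534384423168256 / 4475004971027374267578125 * t ^ 8 := by positivity
    refine key.trans_eq ?_
    rw [ht, hv, hs, hε]
    ring

theorem identric_exp_bound_five_hundred_twelfth {ε s y L Y R : ℝ} (hε : ε = 399 / 10000)
    (hs : s = 1 + ε) (h1 : 1 / 512 ≤ y) (h2 : y ≤ 1 / 64) (hyL : y = exp (-L))
    (hY : Y = exp (-(s * L))) (hR : R = 2 ^ (-ε) * (1 + y) ^ s) :
    2 * (2 + ε) * exp (-1) * (1 + Y - R) ≤
      ε * exp (-(y * L / (1 - y))) * (2 + 2 * y * Y - (1 + y) * R) := by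
  have hy : 0 < y := hyL ▸ exp_pos _
  have hyl : log y = -L := by rw [hyL, log_exp]
  have h3 := log_two_gt_d9
  have h4 := log_two_lt_d9
  have hla : log (1 / 512) = -(9 * log 2) := by
    rw [show (1 / 512 : ℝ) = (2 ^ 9)⁻¹ by norm_num, log_inv, log_pow]
    norm_num
  have hlb : log (1 / 64) = -(6 * log 2) := by
    rw [show (1 / 64 : ℝ) = (2 ^ 6)⁻¹ by norm_num, log_inv, log_pow]
    norm_num
  have hmL : 2079 / 500 ≤ L := by
    have := log_le_log hy h2
    rw [hlb] at this
    linarith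
  have hLM : L ≤ 6239 / 1000 := by
    have := log_le_log (by norm_num) h1
    rw [hla] at this
    linarith
  obtain ⟨t, ht⟩ : ∃ t, t = y - 1 / 512 := ⟨_, rfl⟩
  obtain ⟨v, hv⟩ : ∃ v, v = 1 / 64 - y := ⟨_, rfl⟩
  have ht0 : 0 ≤ t := by linarith
  have hv0 : 0 ≤ v := by linarith
  -- In place of a chord, L is simply bounded below by its minimum on this piece.
  have hl : 2079 / 500 * y ≤ y * L := by
    have := mul_le_mul_of_nonneg_left hmL hy.le
    linarith
  refine identric_exp_bound_of_poly hε hs (by linarith) hyL hY hR hmL hLM (by norm_num)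
    (by norm_num) ?_ hl (c := (503 / 512 + y) / (32193 / 32768)) ?_ (by linarith) rfl ?_
  · linarith
  · rw [div_mul_eq_mul_div, le_div_iff₀ (by norm_num)]
    have := mul_nonneg ht0 hv0
    rw [ht, hv] at this
    linarith
  · have key : 0 ≤
      195557892844913323654238560209129081238784 / 5722162226028740406036376953125 * v ^ 8 +
        1444979417445194279891976889809454994868032 / 5722162226028740406036376953125 * t * v ^ 7 +
        729303138923872893204647000820138730797132 / 817451746575534343719482421875 * t ^ 2 * v ^ 6 +
        321152931854798495271980530542011197731648 / 163490349315106868743896484375 * t ^ 3 * v ^ 5 +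
        471714975465140049295025181748864160434432 / 163490349315106868743896484375 * t ^ 4 * v ^ 4 +
        2302281674871129653325916611293486997364736 / 817451746575534343719482421875 * t ^ 5 * v ^ 3 +
        1426201951358207548682867846028508124889088 / 817451746575534343719482421875 * t ^ 6 * v ^ 2 +
        48460064283514191416709547493482810834944 / 78385783918201923370361328125 * t ^ 7 * v +
        20445516346714914776291959060896415744 / 214755572378635406494140625 * t ^ 8 := by positivity
    refine key.trans_eq ?_
    rw [ht, hv, hs, hε]
    ring

/-- As y → 0 the inequality tends to about 0.04094 ≤ 0.04099; the margin is small, but linear bounds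
in y still fit. -/
theorem identric_exp_bound_tail {ε s y L Y R : ℝ} (hε : ε = 399 / 10000)
    (hs : s = 1 + ε) (h2 : y ≤ 1 / 512) (hyL : y = exp (-L))
    (hY : Y = exp (-(s * L))) (hR : R = 2 ^ (-ε) * (1 + y) ^ s) :
    2 * (2 + ε) * exp (-1) * (1 + Y - R) ≤
      ε * exp (-(y * L / (1 - y))) * (2 + 2 * y * Y - (1 + y) * R) := by
  have hy : 0 < y := hyL ▸ exp_pos _
  have hε0 : 0 < ε := by rw [hε]; norm_num
  have hyl : log y = -L := by rw [hyL, log_exp]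
  have h3 := log_two_gt_d9
  have hmL : 6.238 ≤ L := by
    have := log_le_log hy h2
    rw [show (1 / 512 : ℝ) = (2 ^ 9)⁻¹ by norm_num, log_inv, log_pow, hyl] at this
    push_cast at this
    linarith
  obtain ⟨ha1, ha2⟩ := two_mul_exp_neg_one_bounds hε
  obtain ⟨hr1, hr2, hr3⟩ := binomial_cubic_bounds hε hs hy (by linarith) rfl
  have hY0 : 0 ≤ Y := hY ▸ exp_nonneg _
  have hYu : Y ≤ 0.78 * y := by
    have e : Y = exp (-(ε * L)) * y := by
      rw [hY, hyL, ← exp_add, hs]; ring_nf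
    have h4 : exp (-(ε * L)) ≤ exp (-0.2488) := exp_le_exp.2 (by rw [hε]; linarith)
    have h5 : exp (-0.2488 : ℝ) ≤ 0.78 :=
      (exp_neg_le_quartic (by norm_num)).trans (by norm_num)
    rw [e]
    exact mul_le_mul_of_nonneg_right (h4.trans h5) hy.le
  -- The tangent to e^L at L = 7.4 gives yL ≤ 6.4 y + e^(-7.4).
  have hyL' : y * L ≤ 6.4 * y + 0.000612 := by
    have h4 := add_one_le_exp (L - 7.4)
    have h5 := mul_le_mul_of_nonneg_left h4 hy.le
    have h6 : y * exp (L - 7.4) = exp (-((7 : ℕ) : ℝ)) * exp (-0.4) := by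
      rw [hyL, ← exp_add, ← exp_add]
      congr 1
      push_cast
      ring
    have h7 : exp (-0.4 : ℝ) ≤ 0.6705 :=
      (exp_neg_le_quartic (by norm_num)).trans (by norm_num)
    have h8 := mul_le_mul (exp_neg_natCast_le 7) h7 (exp_nonneg _) (by norm_num)
    rw [h6] at h5
    norm_num at h5 h8 ⊢
    linarith
  have hL0 : 0 ≤ y * L := mul_nonneg hy.le (by linarith)
  have hE : 1 - 512 / 511 * (y * L) ≤ exp (-(y * L / (1 - y))) := by
    have h4 := one_sub_le_exp_neg (y * L / (1 - y))
    have h5 : y * L / (1 - y) ≤ 512 / 511 * (y * L) := by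
      rw [div_le_iff₀ (by linarith)]
      nlinarith
    linarith
  have hE1 : exp (-(y * L / (1 - y))) ≤ 1 := by
    rw [exp_le_one_iff, neg_nonpos]
    exact div_nonneg hL0 (by linarith)
  set r := 486361 / 500000 * (1 + s * y + s * ε / 2 * y ^ 2 - s * ε * (1 - ε) / 6 * y ^ 3)
    with hr
  have hy2 : y ^ 2 ≤ 1 / 512 * y := by nlinarith
  have hy3 : y ^ 3 ≤ 1 / 512 * y ^ 2 := by
    nlinarith [mul_nonneg (sq_nonneg y) (sub_nonneg.2 h2)]
  have hrl : 486361 / 500000 * (1 + s * y) ≤ r := by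
    rw [hr, hs, hε]
    nlinarith [sq_nonneg y]
  have hru : r ≤ 0.972723 + 1.012 * y := by
    rw [hr, hs, hε]
    have : 0 ≤ y ^ 3 := by positivity
    linarith
  have h5 : (1 + y) * r ≤ 0.972723 + 1.987 * y := by
    have := mul_le_mul_of_nonneg_left hru (show 0 ≤ 1 + y by linarith)
    linarith
  have h6 : 0 ≤ y * Y := by positivity
  have hB : 1.027277 - 1.987 * y ≤ 2 + 2 * y * Y - (1 + y) * r := by linarith
  have hB0 : 0 ≤ 1.027277 - 1.987 * y := by linarith
  refine identric_exp_bound_of_le hε hy (by linarith) (exp_nonneg _) hE1 (hr3.trans_eq hR.symm)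
    ha1 ha2 (hB0.trans hB) ?_
  have h7 : (1 - 512 / 511 * (6.4 * y + 0.000612)) * (1.027277 - 1.987 * y) ≤
      exp (-(y * L / (1 - y))) * (2 + 2 * y * Y - (1 + y) * r) := by
    refine mul_le_mul (le_trans ?_ hE) hB hB0 (exp_nonneg _)
    linarith
  have h8 := mul_le_mul_of_nonneg_left h7 hε0.le
  rw [hs, hε] at hrl
  rw [hε] at h8 ⊢
  nlinarith

theorem meanI_le_lambdaMean :
    ∀ a b : ℝ, 0 < a → 0 < b → meanI a b ≤ lambdaMean (10399 / 10000) a b := by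
  refine isHomMean_meanI.le (isHomMean_lambdaMean _) fun u hu => ?_
  rw [meanI_le_lambdaMean_exp_iff (by norm_num) hu]
  rcases le_total u (21 / 20) with h1 | h1
  · exact identric_small hu h1 rfl
  have hs : (10399 / 10000 : ℝ) = 1 + 399 / 10000 := by norm_num
  obtain ⟨y, hy⟩ : ∃ y, y = exp (-(2 * u)) := ⟨_, rfl⟩
  have hY : exp (-2 * (10399 / 10000 * u)) = exp (-(10399 / 10000 * (2 * u))) := by ring_nf
  -- Here 2u ≥ 2.1 exceeds 3 log 2 ≈ 2.0794.
  have hy8 : y ≤ 1 / 8 := by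
    rw [hy, ← le_log_iff_exp_le (by norm_num), show (1 / 8 : ℝ) = (2 ^ 3)⁻¹ by norm_num, log_inv,
      log_pow]
    have := log_two_lt_d9
    push_cast
    linarith
  refine identric_of_exp_bound hu hs (hy.trans (by ring_nf)) hY.symm rfl rfl ?_
  rcases le_total (3 / 32) y with h2 | h2
  · exact identric_exp_bound_three_thirty_seconds rfl hs h2 hy8 hy rfl rfl
  rcases le_total (1 / 16) y with h3 | h3
  · exact identric_exp_bound_sixteenth rfl hs h3 h2 hy rfl rfl
  rcases le_total (1 / 32) y with h4 | h4
  · exact identric_exp_bound_thirty_second rfl hs h4 h3 hy rfl rfl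
  rcases le_total (1 / 64) y with h5 | h5
  · exact identric_exp_bound_sixty_fourth rfl hs h5 h4 hy rfl rfl
  rcases le_total (1 / 512) y with h6 | h6
  · exact identric_exp_bound_five_hundred_twelfth rfl hs h6 h5 hy rfl rfl
  · exact identric_exp_bound_tail rfl hs h6 hy rfl rfl

end IdentricLarge

theorem theorem3 :
    -- 1: monotone in the parameter
    (∀ a b : ℝ, 0 < a → 0 < b → Monotone (fun s : ℝ => lambdaMean s a b)) ∧
    -- 2: below H, with the best possible bound on the parameter
    (∀ s : ℝ, (∀ a b : ℝ, 0 < a → 0 < b → lambdaMean s a b ≤ meanH a b) ↔ s ≤ -4) ∧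
    -- 3: between H and G, with both ends of the parameter range best possible
    (∀ s : ℝ, (∀ a b : ℝ, 0 < a → 0 < b → meanH a b ≤ lambdaMean s a b) ↔ -3 ≤ s) ∧
    (∀ s : ℝ, (∀ a b : ℝ, 0 < a → 0 < b → lambdaMean s a b ≤ meanG a b) ↔ s ≤ -1) ∧
    -- 4: between G and L
    (∀ s : ℝ, (∀ a b : ℝ, 0 < a → 0 < b → meanG a b ≤ lambdaMean s a b) ↔ -1 / 2 ≤ s) ∧
    (∀ s : ℝ, (∀ a b : ℝ, 0 < a → 0 < b → lambdaMean s a b ≤ meanL a b) ↔ s ≤ 0) ∧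
    -- 5: between L and I
    (∃ s₀ : ℝ, 1 / 12 < s₀ ∧ s₀ < 1 / 11 ∧
      ∀ s : ℝ, (∀ a b : ℝ, 0 < a → 0 < b → meanL a b ≤ lambdaMean s a b) ↔ s₀ ≤ s) ∧
    (∀ s : ℝ, (∀ a b : ℝ, 0 < a → 0 < b → lambdaMean s a b ≤ meanI a b) ↔ s ≤ 1) ∧
    -- 6: between I and A
    (∃ s₁ : ℝ, 1.03 < s₁ ∧ s₁ < 1.04 ∧
      ∀ s : ℝ, (∀ a b : ℝ, 0 < a → 0 < b → meanI a b ≤ lambdaMean s a b) ↔ s₁ ≤ s) ∧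
    (∀ s : ℝ, (∀ a b : ℝ, 0 < a → 0 < b → lambdaMean s a b ≤ meanA a b) ↔ s ≤ 2) ∧
    -- 7: between A and S
    (∀ s : ℝ, (∀ a b : ℝ, 0 < a → 0 < b → meanA a b ≤ lambdaMean s a b) ↔ 2 ≤ s) ∧
    (∀ s : ℝ, (∀ a b : ℝ, 0 < a → 0 < b → lambdaMean s a b ≤ meanS a b) ↔ s ≤ 5) ∧
    -- 8: never above S
    (¬ ∃ s : ℝ, ∀ a b : ℝ, 0 < a → 0 < b → meanS a b ≤ lambdaMean s a b) := by
  refine ⟨fun a b ha hb => lambdaMean_monotone ha hb, fun s => ?_, fun s => ?_, fun s => ?_,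
    fun s => ?_, fun s => ?_, ?_, fun s => ?_, ?_, fun s => ?_, fun s => ?_, fun s => ?_, ?_⟩
  · exact ⟨le_neg_four_of_lambdaMean_le_meanH, fun h a b ha hb =>
      (lambdaMean_monotone ha hb h).trans (lambdaMean_le_meanH a b ha hb)⟩
  · exact ⟨neg_three_le_of_meanH_le_lambdaMean, fun h a b ha hb =>
      (meanH_le_lambdaMean a b ha hb).trans (lambdaMean_monotone ha hb h)⟩
  · exact ⟨le_neg_one_of_lambdaMean_le_meanG, fun h a b ha hb =>
      (lambdaMean_monotone ha hb h).trans (lambdaMean_le_meanG a b ha hb)⟩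
  · exact ⟨fun h => by linarith [neg_half_le_of_meanG_le_lambdaMean h], fun h a b ha hb =>
      (meanG_le_lambdaMean a b ha hb).trans (lambdaMean_monotone ha hb h)⟩
  · exact ⟨nonpos_of_lambdaMean_le_meanL, fun h a b ha hb =>
      (lambdaMean_monotone ha hb h).trans (lambdaMean_le_meanL a b ha hb)⟩
  · obtain ⟨s₀, h1, h2, h3⟩ := exists_threshold not_meanL_le_lambdaMean meanL_le_lambdaMean
      fun s hs hs' => ⟨by linarith, by linarith, by linarith⟩
    exact ⟨s₀, h1, h2.trans_lt (by norm_num), h3⟩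
  · exact ⟨le_one_of_lambdaMean_le_meanI, fun h a b ha hb =>
      (lambdaMean_monotone ha hb h).trans (lambdaMean_le_meanI a b ha hb)⟩
  · obtain ⟨s₁, h1, h2, h3⟩ := exists_threshold not_meanI_le_lambdaMean meanI_le_lambdaMean
      fun s hs hs' => ⟨by linarith, by linarith, by linarith⟩
    exact ⟨s₁, h1, h2.trans_lt (by norm_num), h3⟩
  · exact ⟨le_two_of_lambdaMean_le_meanA, fun h a b ha hb =>
      (lambdaMean_monotone ha hb h).trans (lambdaMean_two ha hb).le⟩
  · exact ⟨two_le_of_meanA_le_lambdaMean, fun h a b ha hb =>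
      (lambdaMean_two ha hb).ge.trans (lambdaMean_monotone ha hb h)⟩
  · exact ⟨le_five_of_lambdaMean_le_meanS, fun h a b ha hb =>
      (lambdaMean_monotone ha hb h).trans (lambdaMean_le_meanS a b ha hb)⟩
  · rintro ⟨s, hs⟩
    exact not_meanS_le_lambdaMean s hs
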